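/- Let $G=PSL_2(\mathbb R)$, let $\Xi=\tfrac12\begin{pmatrix}0&1\\-1&0\end{pmatrix}$, $H=\tfrac12\begin{pmatrix}1&0\\0&-1\end{pmatrix}$, $B=\tfrac12\begin{pmatrix}0&1\\1&0\end{pmatrix}$ and $\Omega=4\Xi^2-4H^2-4B^2$ (the Casimir element). For an irreducible unitary representation $\pi$ of $G$ on a Hilbert space $\mathcal H_\pi$ let $\lambda_\pi$ be the scalar by which $\Omega$ acts on smooth vectors. The representation $\pi$ is a principal series representation if $\lambda_\pi=1+s^2$ with $s\in\mathbb R$ and $\frac1i\sigma(\pi(\Xi))=\mathbb Z$; a complementary series representation if $\lambda_\pi=1-s^2$ with $0<|s|<1$ and $\frac1i\sigma(\pi(\Xi))=\mathbb Z$; and a discrete series representation $\pi^{\pm}_{\pm2n}$, $n\ge1$, if $\lambda_\pi=1-(2n-1)^2$ and $\frac1i\sigma(\pi(\Xi))=\pm(n+\mathbb N_0)$. Let $T_\pi(x)=-\Xi^2+xH$ with domain $\{u\in\mathcal H_\pi : T_\pi(x)u\in\mathcal H_\pi\}$ and $\mathcal H^2_\pi=\{u\in\mathcal H_\pi : (I-\Xi^2-H^2-B^2)u\in\mathcal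 H_\pi\}$, where the operators act on $u$ in the sense of functionals on smooth vectors. Let $R_\pi(\zeta,x)=(T_\pi(x)-\zeta)^{-1}$, and for real $x$ let $e^{-tT_\pi(x)}$ be the strongly continuous contraction semigroup with generator $-T_\pi(x)$. (i) Let $\pi$ be a principal or complementary series representation, $r_\pi=(\lambda_\pi+6)^{-1/2}$, and $x\in\mathbb R$ with $|x|<r_\pi$. Then $-T_\pi(x)$ generates a strongly continuous contraction semigroup, there is exactly one point $\mu(x)$ of $\sigma(T_\pi(x))$ with $\operatorname{Re}\mu(x)\le\frac12$, and $|\mu(x)|<\frac12$. The operator $$P(x)=-\frac1{2\pi i}\int_{|\zeta|=1/2}R_\pi(\zeta,x)\,d\zeta$$ is a projection onto the eigenspace $\ker(T_\pi(x)-\mu(x))$, which is one-dimensional. For all $t>0$ and $u\in\mathcal H^2_\pi$, $$e^{-tT_\pi(x)}u=e^{-\mu(x)t}P(x)u+\frac1t\,\frac1{2\pi i}\int_{1/2-i\infty}^{1/2+i\infty}e^{-\zeta t}R_\pi(\zeta,x)^2u\,d\zeta,$$ where the integral converges absolutely. If $|x|\le r_\pi/2$ then, for all $t>0$ and $u\in\mathcal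 H_\pi$, $$\|e^{-tT_\pi(x)}u-e^{-\mu(x)t}P(x)u\|\le\frac4t e^{-t/2}\|u\|.$$ (ii) Let $\pi=\pi^\pm_{\pm2n}$ be a discrete series representation and $x\in\mathbb R$ with $|x|<1/\sqrt{32}$. Then $-T_\pi(x)$ generates a strongly continuous contraction semigroup, $\sigma(T_\pi(x))\cap\{\operatorname{Re}\zeta\le\frac12\}=\emptyset$, and for all $t>0$ and $u\in\mathcal H^2_\pi$, $$e^{-tT_\pi(x)}u=\frac1t\,\frac1{2\pi i}\int_{1/2-i\infty}^{1/2+i\infty}e^{-\zeta t}R_\pi(\zeta,x)^2u\,d\zeta$$ with absolute convergence. If $|x|\le\frac1{2\sqrt{32}}$ then, for all $t>0$ and $u\in\mathcal H_\pi$, $$\|e^{-tT_\pi(x)}u\|\le\frac2{t(n^2-1/2)}e^{-t/2}\|u\|\le\frac4te^{-t/2}\|u\|.$$ -/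

import Mathlib

open scoped MatrixGroups ContDiff Topology ComplexConjugate LinearPMap

noncomputable section

namespace KineticBM

/-- The rotation `exp (t Ξ)`, where `Ξ = (1/2) (0 1; -1 0)`. -/
def expXi (t : ℝ) : SL(2, ℝ) :=
  ⟨!![Real.cos (t / 2), Real.sin (t / 2); -Real.sin (t / 2), Real.cos (t / 2)], by
    rw [Matrix.det_fin_two_of]; nlinarith [Real.sin_sq_add_cos_sq (t / 2)]⟩

/-- The diagonal matrix `exp (t H)`, where `H = (1/2) (1 0; 0 -1)`. -/
def expH (t : ℝ) : SL(2, ℝ) :=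
  ⟨!![Real.exp (t / 2), 0; 0, Real.exp (-(t / 2))], by
    rw [Matrix.det_fin_two_of, ← Real.exp_add]; simp⟩

/-- The hyperbolic matrix `exp (t B)`, where `B = (1/2) (0 1; 1 0)`. -/
def expB (t : ℝ) : SL(2, ℝ) :=
  ⟨!![Real.cosh (t / 2), Real.sinh (t / 2); Real.sinh (t / 2), Real.cosh (t / 2)], by
    rw [Matrix.det_fin_two_of]; nlinarith [Real.cosh_sq_sub_sinh_sq (t / 2)]⟩

/-- A map from a normed space to `SL(2, ℝ)` is smooth if its four matrix entries are. -/
def IsSmoothMap {E : Type*} [NormedAddCommGroup E] [NormedSpace ℝ E] (γ : E → SL(2, ℝ)) : Prop :=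
  ∀ i j, ContDiff ℝ ∞ (fun p => (γ p).1 i j)

theorem isSmoothMap_expXi : IsSmoothMap expXi := by
  intro i j
  fin_cases i <;> fin_cases j <;> simp [expXi] <;> fun_prop

theorem isSmoothMap_expH : IsSmoothMap expH := by
  intro i j
  fin_cases i <;> fin_cases j <;> simp [expH] <;> fun_prop

theorem isSmoothMap_expB : IsSmoothMap expB := by
  intro i j
  fin_cases i <;> fin_cases j <;> simp [expB] <;> fun_prop

/-- A (strongly continuous) unitary representation of `PSL(2, ℝ)` on the Hilbert space `V`. -/
structure UnitaryRep (V : Type*) [NormedAddCommGroup V] [InnerProductSpace ℂ V] where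
  toHom : PSL(2, ℝ) →* (V ≃ₗᵢ[ℂ] V)
  continuous_orbit : ∀ v : V, Continuous (fun g : PSL(2, ℝ) => toHom g v)

namespace UnitaryRep

variable {V : Type*} [NormedAddCommGroup V] [InnerProductSpace ℂ V]

/-- The unitary operator by which (the class of) a matrix `g` acts. -/
def act (π : UnitaryRep V) (g : SL(2, ℝ)) : V ≃ₗᵢ[ℂ] V :=
  π.toHom (QuotientGroup.mk g)

/-- Irreducibility: `V ≠ 0` and the only closed invariant subspaces are `0` and `V`. -/
def IsIrreducible (π : UnitaryRep V) : Prop :=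
  Nontrivial V ∧ ∀ W : Submodule ℂ V, IsClosed (W : Set V) →
    (∀ g : PSL(2, ℝ), ∀ v ∈ W, π.toHom g v ∈ W) → W = ⊥ ∨ W = ⊤

/-- `v` is a smooth vector if its orbit map `g ↦ π(g) v` is smooth on the Lie group. Smoothness on
the group is tested on smooth maps from `ℝⁿ` into it, among which are all local
parametrizations of the group. -/
def IsSmoothVector (π : UnitaryRep V) (v : V) : Prop :=
  ∀ (n : ℕ) (γ : (Fin n → ℝ) → SL(2, ℝ)), IsSmoothMap γ →
    ContDiff ℝ ∞ (fun p => π.act (γ p) v)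

/-- The space `C^∞` of smooth vectors. -/
def smoothVectors (π : UnitaryRep V) : Submodule ℂ V where
  carrier := {v | π.IsSmoothVector v}
  zero_mem' := by
    intro n γ _
    simpa using contDiff_const
  add_mem' := by
    intro a b ha hb n γ hγ
    simpa using (ha n γ hγ).add (hb n γ hγ)
  smul_mem' := by
    intro c a ha n γ hγ
    simpa using (ha n γ hγ).const_smul c

theorem contDiff_orbit (π : UnitaryRep V) {c : ℝ → SL(2, ℝ)} (hc : IsSmoothMap c)
    (v : π.smoothVectors) : ContDiff ℝ ∞ (fun t => π.act (c t) (v : V)) := by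
  have h := v.2 1 (fun p => c (p 0)) (fun i j => (hc i j).comp (contDiff_apply ℝ ℝ (0 : Fin 1)))
  have h2 : ContDiff ℝ ∞ (fun t : ℝ => (fun _ : Fin 1 => t)) :=
    contDiff_pi.2 fun _ => contDiff_id
  exact h.comp h2

/-- For a one-parameter group `c t = exp (t A)`, this is `π(A) v = d/dt π(exp (t A)) v` at `t = 0`,
on smooth vectors `v`. -/
def lieDer (π : UnitaryRep V) (c : ℝ → SL(2, ℝ)) (hc : IsSmoothMap c) :
    π.smoothVectors →ₗ[ℂ] V where
  toFun v := deriv (fun t => π.act (c t) (v : V)) 0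
  map_add' a b := by
    have ha := ((π.contDiff_orbit hc a).differentiable (by simp)) 0
    have hb := ((π.contDiff_orbit hc b).differentiable (by simp)) 0
    simpa using deriv_fun_add ha hb
  map_smul' r a := by
    have ha := ((π.contDiff_orbit hc a).differentiable (by simp)) 0
    simpa using deriv_fun_const_smul r ha

/-- For a one-parameter group `c t = exp (t A)`, this is
`π(A)² v = d²/dt² π(exp (t A)) v` at `t = 0`, on smooth vectors `v`. -/
def lieDerSq (π : UnitaryRep V) (c : ℝ → SL(2, ℝ)) (hc : IsSmoothMap c) :
    π.smoothVectors →ₗ[ℂ] V where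
  toFun v := deriv (deriv (fun t => π.act (c t) (v : V))) 0
  map_add' a b := by
    have ha := (π.contDiff_orbit hc a).differentiable (by simp)
    have hb := (π.contDiff_orbit hc b).differentiable (by simp)
    have ha2 := ((contDiff_infty_iff_deriv.1 (π.contDiff_orbit hc a)).2.differentiable
      (by simp)) 0
    have hb2 := ((contDiff_infty_iff_deriv.1 (π.contDiff_orbit hc b)).2.differentiable
      (by simp)) 0
    have h1 : deriv (fun t => π.act (c t) ((a + b : π.smoothVectors) : V)) =
        fun t => deriv (fun t => π.act (c t) (a : V)) t + deriv (fun t => π.act (c t) (b : V)) t := by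
      funext t
      simpa using deriv_fun_add (ha t) (hb t)
    rw [h1]
    exact deriv_fun_add ha2 hb2
  map_smul' r a := by
    have ha := (π.contDiff_orbit hc a).differentiable (by simp)
    have ha2 := ((contDiff_infty_iff_deriv.1 (π.contDiff_orbit hc a)).2.differentiable
      (by simp)) 0
    have h1 : deriv (fun t => π.act (c t) ((r • a : π.smoothVectors) : V)) =
        fun t => r • deriv (fun t => π.act (c t) (a : V)) t := by
      funext t
      simpa using deriv_fun_const_smul r (ha t)
    rw [h1]
    exact deriv_fun_const_smul r ha2

/-- `π(Ξ)²` on smooth vectors. -/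
def xiSq (π : UnitaryRep V) : π.smoothVectors →ₗ[ℂ] V := π.lieDerSq expXi isSmoothMap_expXi

/-- `π(H)²` on smooth vectors. -/
def hSq (π : UnitaryRep V) : π.smoothVectors →ₗ[ℂ] V := π.lieDerSq expH isSmoothMap_expH

/-- `π(B)²` on smooth vectors. -/
def bSq (π : UnitaryRep V) : π.smoothVectors →ₗ[ℂ] V := π.lieDerSq expB isSmoothMap_expB

/-- `π(H)` on smooth vectors. -/
def hDer (π : UnitaryRep V) : π.smoothVectors →ₗ[ℂ] V := π.lieDer expH isSmoothMap_expH

/-- The Casimir element `Ω = 4 Ξ² - 4 H² - 4 B²` acts on smooth vectors as the scalar `lam`. -/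
def HasCasimir (π : UnitaryRep V) (lam : ℝ) : Prop :=
  ∀ v : π.smoothVectors,
    (4 : ℂ) • π.xiSq v - (4 : ℂ) • π.hSq v - (4 : ℂ) • π.bSq v = (lam : ℂ) • (v : V)

/-- The `k ∈ ℤ` for which `V_k = {v | π(exp (θ Ξ)) v = e^{ikθ} v for all θ}` is non-zero. As
`V` is the Hilbert sum of the `V_k`, this is the spectrum of `π(Ξ) / i`. -/
def kTypes (π : UnitaryRep V) : Set ℤ :=
  {k | ∃ v : V, v ≠ 0 ∧ ∀ θ : ℝ, π.act (expXi θ) v = Complex.exp (Complex.I * k * θ) • v}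

/-- `π` is (equivalent to) the principal series representation `π_{is}`: irreducible,
`π(Ω) = 1 + s²`, and `π(Ξ)/i` has spectrum `ℤ`. -/
def IsPrincipalSeries (π : UnitaryRep V) (s : ℝ) : Prop :=
  π.IsIrreducible ∧ π.HasCasimir (1 + s ^ 2) ∧ π.kTypes = Set.univ

/-- `π` is (equivalent to) the complementary series representation `π_s`, `0 < |s| < 1`:
irreducible, `π(Ω) = 1 - s²`, and `π(Ξ)/i` has spectrum `ℤ`. -/
def IsComplementarySeries (π : UnitaryRep V) (s : ℝ) : Prop :=
  (-1 < s ∧ s < 1 ∧ s ≠ 0) ∧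
    π.IsIrreducible ∧ π.HasCasimir (1 - s ^ 2) ∧ π.kTypes = Set.univ

/-- `π` is (equivalent to) one of the discrete series representations `π^+_{2n}`, `π^-_{-2n}`,
`n ≥ 1`: irreducible, `π(Ω) = 1 - (2n - 1)²`, and `π(Ξ)/i` has spectrum `n + ℕ₀`,
respectively `-(n + ℕ₀)`. -/
def IsDiscreteSeries (π : UnitaryRep V) (n : ℕ) : Prop :=
  1 ≤ n ∧ π.IsIrreducible ∧ π.HasCasimir (1 - (2 * (n : ℝ) - 1) ^ 2) ∧
    (π.kTypes = {k : ℤ | (n : ℤ) ≤ k} ∨ π.kTypes = {k : ℤ | (n : ℤ) ≤ -k})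

/-- The operator `-Ξ² + x H` on smooth vectors. -/
def kineticCore (π : UnitaryRep V) (x : ℂ) : V →ₗ.[ℂ] V where
  domain := π.smoothVectors
  toFun := -π.xiSq + x • π.hDer

/-- The operator `I - Ξ² - H² - B²` on smooth vectors. -/
def sobolevCore (π : UnitaryRep V) : V →ₗ.[ℂ] V where
  domain := π.smoothVectors
  toFun := π.smoothVectors.subtype - π.xiSq - π.hSq - π.bSq

variable [CompleteSpace V]

/-- `T_π(x) = -Ξ² + x H` with domain `{u ∈ V | T_π(x) u ∈ V}`, where `T_π(x) u` is understood as a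
functional on smooth vectors. As `Ξ` and `H` are skew-symmetric, the formal adjoint of `-Ξ² + x H`
is `-Ξ² - x̄ H`; thus `T_π(x) u = w` means `⟪w, v⟫ = ⟪u, (-Ξ² - x̄ H) v⟫` for all smooth `v`. -/
def kineticOp (π : UnitaryRep V) (x : ℂ) : V →ₗ.[ℂ] V := (π.kineticCore (-conj x))†

/-- The Sobolev space of order two, `{u ∈ V | (I - Ξ² - H² - B²) u ∈ V}`, where
`(I - Ξ² - H² - B²) u` is understood as a functional on smooth vectors. -/
def sobolev2 (π : UnitaryRep V) : Submodule ℂ V := (π.sobolevCore)†.domain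

end UnitaryRep

section Operators

variable {V : Type*} [NormedAddCommGroup V] [InnerProductSpace ℂ V]

/-- The bounded operator `R` is the inverse `(T - ζ)⁻¹` of `T - ζ : dom T → V`. -/
def IsResolventAt (T : V →ₗ.[ℂ] V) (ζ : ℂ) (R : V →L[ℂ] V) : Prop :=
  (∀ w : V, ∃ h : R w ∈ T.domain, T ⟨R w, h⟩ - ζ • R w = w) ∧
    ∀ u : T.domain, R (T u - ζ • (u : V)) = u

/-- The spectrum of a (possibly unbounded) operator. -/
def opSpectrum (T : V →ₗ.[ℂ] V) : Set ℂ := {ζ | ¬ ∃ R : V →L[ℂ] V, IsResolventAt T ζ R}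

open scoped Classical in
/-- The resolvent `(T - ζ)⁻¹` for `ζ` outside the spectrum (and `0` on the spectrum). -/
def opResolvent (T : V →ₗ.[ℂ] V) (ζ : ℂ) : V →L[ℂ] V :=
  if h : ∃ R : V →L[ℂ] V, IsResolventAt T ζ R then h.choose else 0

/-- `S t`, `t ≥ 0`, is the strongly continuous contraction semigroup `e^{-tT}`: its infinitesimal
generator is `-T`, with the domain of `T`. -/
structure IsContractionSemigroup (T : V →ₗ.[ℂ] V) (S : ℝ → V →L[ℂ] V) : Prop where
  map_zero : S 0 = 1
  map_add : ∀ s t : ℝ, 0 ≤ s → 0 ≤ t → S (s + t) = (S s).comp (S t)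
  contraction : ∀ t : ℝ, 0 ≤ t → ‖S t‖ ≤ 1
  strongly_continuous : ∀ u : V, ContinuousOn (fun t => S t u) (Set.Ici 0)
  generator : ∀ u w : V,
    Filter.Tendsto (fun t : ℝ => ((t⁻¹ : ℝ) : ℂ) • (S t u - u)) (𝓝[>] 0) (𝓝 (-w)) ↔
      ∃ h : u ∈ T.domain, T ⟨u, h⟩ = w

open scoped Classical in
/-- The semigroup `e^{-tT}` generated by `-T` if there is one (it is then unique for `t ≥ 0`). -/
def expNeg (T : V →ₗ.[ℂ] V) : ℝ → V →L[ℂ] V :=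
  if h : ∃ S, IsContractionSemigroup T S then h.choose else 0

/-- The integrand of `∫ e^{-ζt} (T - ζ)^{-2} u dζ` at the point `ζ = 1/2 + iy`. -/
def lineIntegrand (T : V →ₗ.[ℂ] V) (t : ℝ) (u : V) (y : ℝ) : V :=
  Complex.exp (-((1 / 2 : ℂ) + y * Complex.I) * t) •
    opResolvent T ((1 / 2 : ℂ) + y * Complex.I) (opResolvent T ((1 / 2 : ℂ) + y * Complex.I) u)

/-- `∫ e^{-ζt} (T - ζ)^{-2} u dζ` along the line `Re ζ = 1/2`, upwards, where `dζ = i dy`. -/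
def lineIntegral (T : V →ₗ.[ℂ] V) (t : ℝ) (u : V) : V :=
  Complex.I • ∫ y : ℝ, lineIntegrand T t u y

/-- The operator `-(2πi)⁻¹ ∮ (T - ζ)⁻¹ dζ` over the circle `|ζ| = 1/2`, counterclockwise. -/
def circleProjection (T : V →ₗ.[ℂ] V) : V →L[ℂ] V :=
  (-(2 * (Real.pi : ℂ) * Complex.I)⁻¹) • ∮ ζ in C(0, 1 / 2), opResolvent T ζ

end Operators

end KineticBM

end

/-! The operator `-Ξ²` is diagonal in the K-types, with eigenvalues `k²`, and the Casimir relation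
gives `‖H v‖² + ‖B v‖² = ⟪-Ξ² v, v⟫ + (λ/4) ‖v‖²`. Hence `‖H v‖ ≤ κ ‖(-Ξ² - ζ) v‖` on K-finite
smooth vectors as soon as `k² + λ/4 ≤ κ² |k² - ζ|²` for all K-types `k`. For `λ > 0` and `κ = √(λ +
6)` this holds when `Re ζ ≤ 1/2` and `|ζ| ≥ 1/2`; in the discrete series, where `k² ≥ 1` and `λ ≤
0`, it holds with `κ = 2` on the whole half plane `Re ζ ≤ 1/2`. If `|x| κ < 1`, then `x H` is a
small perturbation and `IsDiagonal.exists_isResolventAt` produces the resolvent with a norm bound.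
As `H` is skew-symmetric, the real part of the quadratic form does not see `x`, so `‖(T + a)⁻¹‖ ≤
1/a` and the Hille–Yosida theorem gives the semigroup.

Inside the disc `|ζ| < 1/2` only the K-type `0` is an obstacle. It has multiplicity one: a spherical
function that vanishes at the origin vanishes identically, by an energy estimate for its radial
differential equation (`exists_unit_kSpace_zero`). With a unit vector `e` of K-type `0`, the
operator `-Ξ² + 2 ⟪e, ·⟫ e + x H` has a resolvent `R` of norm at most `2` on the whole half plane,
and `T` differs from it by rank one. So the spectrum of `T` there is the zero set of `1 - 2 ⟪e, R(ζ)
e⟫`. Because `⟪e, H e⟫ = 0` and `‖H e‖² = λ/8`, this becomes a fixed point equation for a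
contraction of the half plane into the disc: one zero `μ`, which is a simple pole of the resolvent
(`exists_simple_eigenvalue`). Its residue is `-P` (`circleProjection_of_simplePole`).

The square of the resolvent is the Laplace transform of `t e^{-tT}`, and Fourier inversion recovers
the semigroup from the line `Re ζ = -1/2`. On `u - P u` the squared resolvent continues
holomorphically across `μ`, so the line can be moved to `Re ζ = 1/2`, where `P u` contributes
nothing (`semigroup_expansion`). The norm estimates follow from the resolvent bound on that line. -/

open scoped MatrixGroups ContDiff Topology ComplexConjugate LinearPMap

noncomputable section

namespace KineticBM

/-! ### Smooth maps into SL(2, ℝ) and one-parameter groups -/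

section SmoothMaps

variable {E E' : Type*} [NormedAddCommGroup E] [NormedSpace ℝ E]
  [NormedAddCommGroup E'] [NormedSpace ℝ E']

theorem IsSmoothMap.mul {γ δ : E → SL(2, ℝ)} (hγ : IsSmoothMap γ) (hδ : IsSmoothMap δ) :
    IsSmoothMap (fun p => γ p * δ p) := by
  intro i j
  simp only [Matrix.SpecialLinearGroup.coe_mul, Matrix.mul_apply, Fin.sum_univ_two]
  exact ((hγ i 0).mul (hδ 0 j)).add ((hγ i 1).mul (hδ 1 j))

theorem isSmoothMap_const (g : SL(2, ℝ)) : IsSmoothMap (fun _ : E => g) :=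
  fun _ _ => contDiff_const

theorem IsSmoothMap.comp {γ : E → SL(2, ℝ)} (hγ : IsSmoothMap γ) {f : E' → E}
    (hf : ContDiff ℝ ∞ f) : IsSmoothMap (fun p => γ (f p)) :=
  fun i j => (hγ i j).comp hf

theorem continuous_of_entries {X : Type*} [TopologicalSpace X] {γ : X → SL(2, ℝ)}
    (h : ∀ i j, Continuous fun p => (γ p).1 i j) : Continuous γ :=
  Continuous.subtype_mk (continuous_matrix h) _

theorem IsSmoothMap.continuous {γ : E → SL(2, ℝ)} (hγ : IsSmoothMap γ) : Continuous γ :=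
  continuous_of_entries fun i j => (hγ i j).continuous

end SmoothMaps

theorem expXi_add (s t : ℝ) : expXi (s + t) = expXi s * expXi t := by
  ext i j
  rw [Matrix.SpecialLinearGroup.coe_mul, Matrix.mul_apply, Fin.sum_univ_two]
  fin_cases i <;> fin_cases j <;>
    simp [expXi, add_div, Real.cos_add, Real.sin_add] <;> ring_nf

theorem expH_add (s t : ℝ) : expH (s + t) = expH s * expH t := by
  ext i j
  rw [Matrix.SpecialLinearGroup.coe_mul, Matrix.mul_apply, Fin.sum_univ_two]
  fin_cases i <;> fin_cases j <;>
    simp [expH, add_div, Real.exp_add, mul_comm]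

theorem expB_add (s t : ℝ) : expB (s + t) = expB s * expB t := by
  ext i j
  rw [Matrix.SpecialLinearGroup.coe_mul, Matrix.mul_apply, Fin.sum_univ_two]
  fin_cases i <;> fin_cases j <;>
    simp [expB, add_div, Real.cosh_add, Real.sinh_add] <;> ring_nf

/-! ### The Lie algebra action on smooth vectors -/

namespace UnitaryRep

variable {V : Type*} [NormedAddCommGroup V] [InnerProductSpace ℂ V] (π : UnitaryRep V)

theorem act_one (v : V) : π.act 1 v = v := by
  have : π.act 1 = 1 := by
    unfold act
    exact π.toHom.map_one
  rw [this]; rfl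

theorem act_mul (g h : SL(2, ℝ)) (v : V) : π.act (g * h) v = π.act g (π.act h v) := by
  have : π.act (g * h) = π.act g * π.act h := by
    have h1 : (QuotientGroup.mk (g * h) : PSL(2, ℝ)) =
        (QuotientGroup.mk g : PSL(2, ℝ)) * (QuotientGroup.mk h : PSL(2, ℝ)) := rfl
    exact (congrArg π.toHom h1).trans (π.toHom.map_mul _ _)
  rw [this]; rfl

theorem continuous_act (v : V) : Continuous (fun g : SL(2, ℝ) => π.act g v) :=
  (π.continuous_orbit v).comp continuous_quotient_mk'

theorem inner_act_left (g h : SL(2, ℝ)) (hgh : h * g = 1) (v w : V) :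
    inner ℂ (π.act g v) w = inner ℂ v (π.act h w) := by
  rw [← (π.act h).inner_map_map, ← act_mul, hgh, act_one]

theorem act_smooth (g : SL(2, ℝ)) (v : π.smoothVectors) : π.act g (v : V) ∈ π.smoothVectors := by
  intro n γ hγ
  have h := v.2 n (fun p => γ p * g) (hγ.mul (isSmoothMap_const g))
  simpa only [act_mul] using h

section OneParameter

variable {c : ℝ → SL(2, ℝ)} (hc : IsSmoothMap c)

theorem hasDerivAt_lieDer_zero (v : π.smoothVectors) :
    HasDerivAt (fun t => π.act (c t) (v : V)) (π.lieDer c hc v) 0 :=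
  ((π.contDiff_orbit hc v).differentiable (by simp) 0).hasDerivAt

variable (hadd : ∀ s t, c (s + t) = c s * c t)

include hadd

theorem oneParameter_zero : c 0 = 1 := by
  have h := hadd 0 0
  rw [add_zero] at h
  exact (mul_eq_left.1 h.symm)

theorem oneParameter_neg (t : ℝ) : c (-t) * c t = 1 := by
  rw [← hadd, neg_add_cancel, oneParameter_zero hadd]

theorem hasDerivAt_lieDer (v : π.smoothVectors) (t : ℝ) :
    HasDerivAt (fun t => π.act (c t) (v : V)) (π.act (c t) (π.lieDer c hc v)) t := by
  have h1 : (fun s => π.act (c s) (v : V)) = fun s => π.act (c t) (π.act (c (s - t)) (v : V)) := by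
    funext s
    rw [← act_mul, ← hadd, add_sub_cancel]
  rw [h1]
  have h2 : HasDerivAt (fun s => π.act (c (s - t)) (v : V)) (π.lieDer c hc v) t := by
    have h3 := π.hasDerivAt_lieDer_zero hc v
    rw [← sub_self t] at h3
    exact h3.comp_sub_const t t
  exact (((π.act (c t)).toContinuousLinearEquiv : V →L[ℂ] V).restrictScalars
    ℝ).hasFDerivAt.comp_hasDerivAt t h2

theorem deriv_orbit (v : π.smoothVectors) :
    deriv (fun t => π.act (c t) (v : V)) = fun t => π.act (c t) (π.lieDer c hc v) :=
  funext fun t => (π.hasDerivAt_lieDer hc hadd v t).deriv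

theorem hasDerivAt_lieDerSq (v : π.smoothVectors) :
    HasDerivAt (fun t => π.act (c t) (π.lieDer c hc v)) (π.lieDerSq c hc v) 0 := by
  have h := ((contDiff_infty_iff_deriv.1 (π.contDiff_orbit hc v)).2.differentiable (by simp) 0)
  have h2 := h.hasDerivAt
  rw [π.deriv_orbit hc hadd v] at h2
  have h3 : π.lieDerSq c hc v = deriv (deriv (fun t => π.act (c t) (v : V))) 0 := rfl
  rw [h3, π.deriv_orbit hc hadd v]
  exact h2

/-- Differentiates `⟪π(c t) a, b⟫ = ⟪a, π(c (-t)) b⟫` at `0`. The vectors are only required to have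
differentiable orbits, so that `a = π(A) v` is admissible without showing that it is smooth. -/
theorem inner_derivs_of_hasDerivAt {a b a' b' : V}
    (ha : HasDerivAt (fun t => π.act (c t) a) a' 0)
    (hb : HasDerivAt (fun t => π.act (c t) b) b' 0) :
    inner ℂ a' b = - inner ℂ a b' := by
  have h1 : HasDerivAt (fun t => inner ℂ (π.act (c t) a) b) (inner ℂ a' b) 0 := by
    simpa using ha.inner ℂ (hasDerivAt_const (0 : ℝ) b)
  have hb2 : HasDerivAt (fun t : ℝ => π.act (c (-t)) b) (-b') 0 := by
    have := HasDerivAt.scomp (0 : ℝ) (by simpa using hb) (hasDerivAt_neg (0 : ℝ))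
    simpa [Function.comp_def] using this
  have h2 : HasDerivAt (fun t => inner ℂ a (π.act (c (-t)) b)) (inner ℂ a (-b')) 0 := by
    simpa using (hasDerivAt_const (0 : ℝ) a).inner ℂ hb2
  have h3 : (fun t => inner ℂ (π.act (c t) a) b) = fun t => inner ℂ a (π.act (c (-t)) b) :=
    funext fun t => π.inner_act_left _ _ (oneParameter_neg hadd t) a b
  rw [h3] at h1
  rw [h1.unique h2, inner_neg_right]

theorem inner_lieDer_left (v w : π.smoothVectors) :
    inner ℂ (π.lieDer c hc v) (w : V) = - inner ℂ (v : V) (π.lieDer c hc w) :=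
  π.inner_derivs_of_hasDerivAt hadd (π.hasDerivAt_lieDer_zero hc v) (π.hasDerivAt_lieDer_zero hc w)

theorem inner_lieDerSq_left (v w : π.smoothVectors) :
    inner ℂ (π.lieDerSq c hc v) (w : V) = - inner ℂ (π.lieDer c hc v) (π.lieDer c hc w) :=
  π.inner_derivs_of_hasDerivAt hadd (π.hasDerivAt_lieDerSq hc hadd v)
    (π.hasDerivAt_lieDer_zero hc w)

theorem inner_lieDerSq_symm (v w : π.smoothVectors) :
    inner ℂ (π.lieDerSq c hc v) (w : V) = inner ℂ (v : V) (π.lieDerSq c hc w) := by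
  rw [inner_lieDerSq_left π hc hadd, ← inner_conj_symm (v : V), inner_lieDerSq_left π hc hadd,
    map_neg, inner_conj_symm]

end OneParameter

/-- Pair the Casimir relation with `v` and move one factor of each of `H²` and `B²` across by
skew-symmetry. -/
theorem norm_sq_hDer_add (lam : ℝ) (h : π.HasCasimir lam) (v : π.smoothVectors) :
    ((‖π.hDer v‖ ^ 2 + ‖π.lieDer expB isSmoothMap_expB v‖ ^ 2 : ℝ) : ℂ) =
      inner ℂ (-π.xiSq v) (v : V) + (lam / 4 : ℝ) * ((‖(v : V)‖ ^ 2 : ℝ) : ℂ) := by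
  have h1 := h v
  have hH := π.inner_lieDerSq_left isSmoothMap_expH expH_add v v
  have hB := π.inner_lieDerSq_left isSmoothMap_expB expB_add v v
  have h2 : inner ℂ ((4 : ℂ) • π.xiSq v - (4 : ℂ) • π.hSq v - (4 : ℂ) • π.bSq v) (v : V) =
      inner ℂ ((lam : ℂ) • (v : V)) (v : V) := by rw [h1]
  simp only [inner_sub_left, inner_smul_left] at h2
  change inner ℂ (π.hSq v) (v : V) = - inner ℂ (π.hDer v) (π.hDer v) at hH
  change inner ℂ (π.bSq v) (v : V) = _ at hB
  rw [hH, hB, inner_self_eq_norm_sq_to_K, inner_self_eq_norm_sq_to_K,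
    inner_self_eq_norm_sq_to_K] at h2
  simp only [inner_neg_left]
  push_cast
  simp only [Complex.conj_ofReal, map_ofNat, Complex.coe_algebraMap] at h2
  linear_combination (1 / 4 : ℂ) * h2

/-- The source of all relative bounds for `x H`: the contribution of `B` is nonnegative and is
dropped. -/
theorem norm_sq_hDer_le (lam : ℝ) (h : π.HasCasimir lam) (v : π.smoothVectors) :
    ‖π.hDer v‖ ^ 2 ≤ (inner ℂ (-π.xiSq v) (v : V)).re + lam / 4 * ‖(v : V)‖ ^ 2 := by
  have h1 := congrArg Complex.re (π.norm_sq_hDer_add lam h v)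
  rw [Complex.ofReal_re, Complex.add_re, ← Complex.ofReal_mul, Complex.ofReal_re] at h1
  nlinarith [sq_nonneg ‖π.lieDer expB isSmoothMap_expB v‖]

end UnitaryRep

end KineticBM

/-! ### Density of the smooth vectors -/

namespace KineticBM

open MeasureTheory Set

/-- The integral is the convolution of `f` with `x ↦ g p (-x)`, evaluated at `0`, so that smoothness
of convolutions depending on a parameter applies. -/
theorem contDiff_integral_of_compactly_supported {G P E E' F : Type*}
    [NormedAddCommGroup G] [NormedSpace ℝ G] [MeasurableSpace G] [BorelSpace G]
    [NormedAddCommGroup P] [NormedSpace ℝ P] [NormedAddCommGroup E] [NormedSpace ℝ E]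
    [NormedAddCommGroup E'] [NormedSpace ℝ E'] [NormedAddCommGroup F] [NormedSpace ℝ F]
    {μ : Measure G} (L : E →L[ℝ] E' →L[ℝ] F) {f : G → E} {g : P → G → E'}
    (hf : LocallyIntegrable f μ) (hg : ContDiff ℝ ∞ (fun q : P × G => g q.1 q.2))
    (hk : ∀ p₀, ∃ k : Set G, IsCompact k ∧ ∃ s ∈ 𝓝 p₀, ∀ p ∈ s, ∀ x, x ∉ k → g p x = 0) :
    ContDiff ℝ ∞ (fun p => ∫ t, L (f t) (g p t) ∂μ) := by
  rw [contDiff_iff_contDiffAt]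
  intro p₀
  obtain ⟨k, hkc, s, hs, hks⟩ := hk p₀
  obtain ⟨s', hs's, hs'o, hp₀⟩ := mem_nhds_iff.1 hs
  have h := contDiffOn_convolution_right_with_param_comp (𝕜 := ℝ) (n := (⊤ : ℕ∞)) (μ := μ) L
    (s := s') (v := fun _ => (0 : G)) contDiffOn_const (f := f) (g := fun p x => g p (-x))
    (k := -k) hs'o hkc.neg
    (fun p x hp hx => hks p (hs's hp) _ (by simpa using hx)) hf
    (ContDiff.contDiffOn (hg.comp (contDiff_fst.prodMk contDiff_snd.neg)))
  have h2 := h.contDiffAt (hs'o.mem_nhds hp₀)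
  simpa [convolution] using h2

theorem IsSmoothMap.inv {E : Type*} [NormedAddCommGroup E] [NormedSpace ℝ E] {γ : E → SL(2, ℝ)}
    (hγ : IsSmoothMap γ) : IsSmoothMap (fun p => (γ p)⁻¹) := by
  intro i j
  simp only [Matrix.SpecialLinearGroup.coe_inv, Matrix.adjugate_fin_two]
  fin_cases i <;> fin_cases j <;> simp <;> first | exact hγ _ _ | exact (hγ _ _).neg

/-- Pairs of columns of length two, that is, real `2 × 2` matrices. -/
abbrev Columns : Type := Fin 2 → Fin 2 → ℝ

namespace Columns

/-- The determinant of the matrix with given columns. -/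
def det (m : Columns) : ℝ := m 0 0 * m 1 1 - m 1 0 * m 0 1

theorem continuous_det : Continuous det := by unfold det; fun_prop

/-- The matrix `m / √(det m)` if `det m > 0`. -/
def toSL (m : Columns) : SL(2, ℝ) :=
  if h : 0 < m.det then
    ⟨!![m 0 0 / √m.det, m 1 0 / √m.det; m 0 1 / √m.det, m 1 1 / √m.det], by
      have h1 : √m.det * √m.det = m.det := Real.mul_self_sqrt h.le
      have h2 : √m.det ≠ 0 := (Real.sqrt_pos.2 h).ne'
      rw [Matrix.det_fin_two_of]
      field_simp
      rw [pow_two, h1, det]⟩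
  else 1

theorem toSL_apply {m : Columns} (hm : 0 < m.det) (i j : Fin 2) :
    (toSL m).1 i j = m j i / √m.det := by
  have h : toSL m = _ := dif_pos hm
  rw [h]
  fin_cases i <;> fin_cases j <;> rfl

/-- Left multiplication of a matrix by an element of `SL(2, ℝ)`. -/
def lmul (g : SL(2, ℝ)) (m : Columns) : Columns := fun j => g.1.mulVec (m j)

theorem lmul_apply (g : SL(2, ℝ)) (m : Columns) (j i : Fin 2) :
    lmul g m j i = g.1 i 0 * m j 0 + g.1 i 1 * m j 1 := by
  simp [lmul, Matrix.mulVec, dotProduct, Fin.sum_univ_two]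

theorem det_lmul (g : SL(2, ℝ)) (m : Columns) : (lmul g m).det = m.det := by
  have h := g.2
  rw [Matrix.det_fin_two] at h
  simp only [det, lmul_apply]
  linear_combination (m 0 0 * m 1 1 - m 1 0 * m 0 1) * h

theorem lmul_lmul (g h : SL(2, ℝ)) (m : Columns) : lmul g (lmul h m) = lmul (g * h) m := by
  funext j
  simp only [lmul, Matrix.SpecialLinearGroup.coe_mul, Matrix.mulVec_mulVec]

theorem lmul_one (m : Columns) : lmul 1 m = m := by
  funext j
  simp [lmul]

theorem toSL_lmul (g : SL(2, ℝ)) {m : Columns} (hm : 0 < m.det) :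
    toSL (lmul g m) = g * toSL m := by
  ext i j
  rw [Matrix.SpecialLinearGroup.coe_mul, Matrix.mul_apply, Fin.sum_univ_two, toSL_apply hm,
    toSL_apply hm, toSL_apply (by rwa [det_lmul]), lmul_apply, det_lmul]
  ring

theorem continuous_lmul (g : SL(2, ℝ)) : Continuous (lmul g) := by
  refine continuous_pi fun j => continuous_pi fun i => ?_
  simp only [lmul_apply]
  fun_prop

/-- Left multiplication as a homeomorphism. -/
def lmulHomeomorph (g : SL(2, ℝ)) : Columns ≃ₜ Columns where
  toFun := lmul g
  invFun := lmul g⁻¹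
  left_inv m := by rw [lmul_lmul, inv_mul_cancel, lmul_one]
  right_inv m := by rw [lmul_lmul, mul_inv_cancel, lmul_one]
  continuous_toFun := continuous_lmul g
  continuous_invFun := continuous_lmul g⁻¹

/-- Lebesgue measure on matrices takes the place of Haar measure. Storing a matrix by its columns
makes left multiplication a product of two maps of determinant one. -/
theorem measurePreserving_lmul (g : SL(2, ℝ)) :
    MeasurePreserving (lmul g) (volume : Measure Columns) volume := by
  have h1 : MeasurePreserving (fun x : Fin 2 → ℝ => g.1.mulVec x) volume volume := by
    refine ⟨(continuous_const.matrix_mulVec continuous_id).measurable, ?_⟩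
    have h := Real.map_matrix_volume_pi_eq_smul_volume_pi (M := g.1) (by rw [g.2]; exact one_ne_zero)
    rw [g.2] at h
    rw [inv_one, abs_one, ENNReal.ofReal_one, one_smul] at h
    exact h
  exact volume_preserving_pi fun _ => h1

theorem continuousOn_toSL : ContinuousOn toSL {m | 0 < m.det} := by
  rw [continuousOn_iff_continuous_domRestrict]
  refine continuous_of_entries fun i j => ?_
  have h : (fun m : {m : Columns | 0 < m.det} => (toSL m.1).1 i j) =
      fun m : {m : Columns | 0 < m.det} => m.1 j i / √(m.1.det) :=
    funext fun m => toSL_apply m.2 i j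
  refine Eq.mpr (congrArg Continuous h) ?_
  refine Continuous.div ?_ ?_ ?_
  · exact (continuous_apply i).comp ((continuous_apply j).comp continuous_subtype_val)
  · exact (continuous_det.comp continuous_subtype_val).sqrt
  · exact fun m => (Real.sqrt_pos.2 m.2).ne'

/-- The identity matrix. -/
def one : Columns := fun j i => if i = j then 1 else 0

theorem det_one : one.det = 1 := by simp [one, det]

theorem toSL_one : toSL one = 1 := by
  ext i j
  rw [toSL_apply (by rw [det_one]; exact one_pos), det_one]
  fin_cases i <;> fin_cases j <;> simp [one]

end Columns

open Columns

namespace UnitaryRep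

variable {V : Type*} [NormedAddCommGroup V] [InnerProductSpace ℂ V] (π : UnitaryRep V)

/-- The orbit map `m ↦ π(m / √(det m)) v` on matrices of positive determinant. -/
def matrixOrbit (v : V) : Columns → V := {m | 0 < m.det}.indicator fun m => π.act (toSL m) v

theorem isOpen_det_pos : IsOpen {m : Columns | 0 < m.det} :=
  isOpen_lt continuous_const continuous_det

theorem norm_matrixOrbit_le (v : V) (m : Columns) : ‖π.matrixOrbit v m‖ ≤ ‖v‖ :=
  (norm_indicator_le_norm_self _ _).trans (by rw [LinearIsometryEquiv.norm_map])

theorem locallyIntegrable_matrixOrbit (v : V) :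
    LocallyIntegrable (π.matrixOrbit v) (volume : Measure Columns) := by
  refine (locallyIntegrable_const (‖v‖ : ℝ)).mono ?_ (Filter.Eventually.of_forall fun m => ?_)
  · rw [matrixOrbit, aestronglyMeasurable_indicator_iff isOpen_det_pos.measurableSet]
    exact ((π.continuous_act v).comp_continuousOn continuousOn_toSL).aestronglyMeasurable
      isOpen_det_pos.measurableSet
  · simpa using π.norm_matrixOrbit_le v m

/-- Gårding's argument: invariance of the measure moves the group element from the vector to the
function `f`, so the parameter enters only through a smooth compactly supported factor. -/
theorem integral_bump_smooth {f : Columns → ℝ} (hf : ContDiff ℝ ∞ f) (hfc : HasCompactSupport f)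
    (hfd : ∀ m, f m ≠ 0 → 0 < m.det) (v : V) :
    ∫ m, f m • π.matrixOrbit v m ∈ π.smoothVectors := by
  intro n γ hγ
  have h1 : ∀ p, π.act (γ p) (∫ m, f m • π.matrixOrbit v m) =
      ∫ m, f (lmul (γ p)⁻¹ m) • π.matrixOrbit v m := by
    intro p
    have h2 := (measurePreserving_lmul (γ p)).integral_comp
      (lmulHomeomorph (γ p)).measurableEmbedding
      (fun m => f (lmul (γ p)⁻¹ m) • π.matrixOrbit v m)
    rw [← h2]
    have h3 := ((π.act (γ p)).toContinuousLinearEquiv.integral_comp_comm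
      (μ := (volume : Measure Columns)) (fun m => f m • π.matrixOrbit v m))
    refine h3.symm.trans (integral_congr_ae (Filter.Eventually.of_forall fun m => ?_))
    simp only [lmul_lmul, inv_mul_cancel, lmul_one]
    by_cases hm : f m = 0
    · simp [hm]
    · have hd := hfd m hm
      have hd' : 0 < (lmul (γ p) m).det := by rwa [det_lmul]
      rw [matrixOrbit, indicator_of_mem (by exact hd), indicator_of_mem (by exact hd'),
        toSL_lmul _ hd, act_mul]
      exact ((π.act (γ p)).toContinuousLinearEquiv.toContinuousLinearMap.restrictScalars
        ℝ).map_smul _ _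
  simp only [h1]
  refine contDiff_integral_of_compactly_supported (ContinuousLinearMap.lsmul ℝ ℝ).flip
    (g := fun p m => f (lmul (γ p)⁻¹ m)) (π.locallyIntegrable_matrixOrbit v) ?_ ?_
  · refine hf.comp (contDiff_pi.2 fun j => contDiff_pi.2 fun i => ?_)
    simp only [lmul_apply]
    have h4 : ∀ a b, ContDiff ℝ ∞ (fun q : (Fin n → ℝ) × Columns => q.2 a b) := fun a b =>
      (contDiff_apply_apply ℝ ℝ a b).comp contDiff_snd
    exact (((hγ.inv i 0).comp contDiff_fst).mul (h4 j 0)).add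
      (((hγ.inv i 1).comp contDiff_fst).mul (h4 j 1))
  · intro p₀
    have hcont : Continuous (fun q : (Fin n → ℝ) × Columns => lmul (γ q.1) q.2) := by
      refine continuous_pi fun j => continuous_pi fun i => ?_
      simp only [lmul_apply]
      have h4 : ∀ a b, Continuous (fun q : (Fin n → ℝ) × Columns => q.2 a b) := fun a b =>
        (continuous_apply b).comp ((continuous_apply a).comp continuous_snd)
      exact (((hγ i 0).continuous.comp continuous_fst).mul (h4 j 0)).add
        (((hγ i 1).continuous.comp continuous_fst).mul (h4 j 1))
    -- For `p` near `p₀` the translated supports all lie in the image of one compact set under `(p,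
    -- m) ↦ γ p · m`.
    refine ⟨_, ((isCompact_closedBall p₀ 1).prod hfc).image hcont, Metric.closedBall p₀ 1,
      Metric.closedBall_mem_nhds _ one_pos, fun p hp m hm => ?_⟩
    by_contra hne
    refine hm ⟨(p, lmul (γ p)⁻¹ m), ⟨hp, subset_tsupport f hne⟩, ?_⟩
    simp only [lmul_lmul, mul_inv_cancel, lmul_one]

/-- Average the orbit of `v` against a normalised bump near the identity matrix; by strong
continuity the average is close to `v`. -/
theorem dense_smoothVectors [CompleteSpace V] : Dense (π.smoothVectors : Set V) := by
  intro v
  rw [Metric.mem_closure_iff]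
  intro ε hε
  have hcont : ContinuousAt (fun m => π.act (toSL m) v) one :=
    ((π.continuous_act v).comp_continuousOn continuousOn_toSL).continuousAt
      (isOpen_det_pos.mem_nhds (by simp [det_one]))
  have hev : ∀ᶠ m in 𝓝 one, 0 < m.det ∧ dist (π.act (toSL m) v) v < ε / 2 := by
    refine Filter.Eventually.and (isOpen_det_pos.mem_nhds (by simp [det_one])) ?_
    have := Metric.tendsto_nhds.1 hcont (ε / 2) (by positivity)
    simpa only [toSL_one, act_one] using this
  obtain ⟨r, hr, hball⟩ := Metric.eventually_nhds_iff_ball.1 hev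
  let φ : ContDiffBump one := ⟨r / 2, r, by positivity, by linarith⟩
  let f : Columns → ℝ := φ.normed volume
  have hsupp : ∀ m, f m ≠ 0 → m ∈ Metric.ball one r := by
    intro m hm
    have : m ∈ Function.support (φ.normed (volume : Measure Columns)) := hm
    rwa [ContDiffBump.support_normed_eq] at this
  refine ⟨_, π.integral_bump_smooth (f := f) φ.contDiff_normed φ.hasCompactSupport_normed
    (fun m hm => (hball m (hsupp m hm)).1) v, ?_⟩
  have hfi : Integrable f := φ.integrable_normed
  have hint : Integrable (fun m => f m • π.matrixOrbit v m) := by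
    refine Integrable.mono' (hfi.norm.mul_const ‖v‖)
      (hfi.aestronglyMeasurable.smul (π.locallyIntegrable_matrixOrbit v).aestronglyMeasurable)
      (Filter.Eventually.of_forall fun m => ?_)
    rw [norm_smul]
    exact mul_le_mul_of_nonneg_left (π.norm_matrixOrbit_le v m) (norm_nonneg _)
  have hf1 : ∫ m, f m = 1 := φ.integral_normed
  have hdiff : v - ∫ m, f m • π.matrixOrbit v m = ∫ m, f m • (v - π.matrixOrbit v m) := by
    simp only [smul_sub]
    rw [integral_sub (hfi.smul_const v) hint, integral_smul_const, hf1, one_smul]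
  rw [dist_eq_norm, hdiff]
  have hle : ‖∫ m, f m • (v - π.matrixOrbit v m)‖ ≤ ∫ m, f m * (ε / 2) := by
    refine norm_integral_le_of_norm_le (hfi.mul_const _) (Filter.Eventually.of_forall fun m => ?_)
    have hf0 : 0 ≤ f m := φ.nonneg_normed m
    rw [norm_smul, Real.norm_of_nonneg hf0]
    by_cases hm : f m = 0
    · simp [hm]
    · have hb := hball m (hsupp m hm)
      refine mul_le_mul_of_nonneg_left ?_ hf0
      rw [matrixOrbit, indicator_of_mem (by exact hb.1), ← dist_eq_norm, dist_comm]
      exact hb.2.le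
  rw [integral_mul_const, hf1, one_mul] at hle
  linarith

end UnitaryRep

end KineticBM

/-! ### Decomposition into K-types -/

namespace KineticBM

open MeasureTheory Set

theorem expXi_two_pi : expXi (2 * Real.pi) = -1 := by
  ext i j
  have h : 2 * Real.pi / 2 = Real.pi := by ring
  fin_cases i <;> fin_cases j <;> simp [expXi, h]

/-- Vanishing Fourier coefficients are summable, so the Fourier series converges to `φ` at every
point. -/
theorem eq_zero_of_fourier_eq_zero {φ : ℝ → ℂ} (hφ : Continuous φ)
    (hper : Function.Periodic φ (2 * Real.pi))
    (h : ∀ k : ℤ, ∫ θ in (0 : ℝ)..2 * Real.pi, Complex.exp (-(Complex.I * k * θ)) * φ θ = 0)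
    (θ : ℝ) : φ θ = 0 := by
  have : Fact (0 < 2 * Real.pi) := ⟨Real.two_pi_pos⟩
  let f : C(AddCircle (2 * Real.pi), ℂ) := ⟨hper.lift, continuous_coinduced_dom.2 hφ⟩
  have hf : ∀ x : ℝ, f (x : AddCircle (2 * Real.pi)) = φ x := fun x => hper.lift_coe x
  have hc : ∀ k : ℤ, fourierCoeff f k = 0 := by
    intro k
    rw [fourierCoeff_eq_intervalIntegral f k 0, zero_add]
    have h2 : (∫ x in (0 : ℝ)..2 * Real.pi, fourier (-k) (x : AddCircle (2 * Real.pi)) •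
        f (x : AddCircle (2 * Real.pi))) = 0 := by
      rw [← h k]
      congr 1
      funext x
      rw [fourier_coe_apply, hf, smul_eq_mul]
      congr 2
      push_cast
      have : (Real.pi : ℂ) ≠ 0 := Complex.ofReal_ne_zero.2 Real.pi_ne_zero
      field_simp
    rw [h2, smul_zero]
  have hs := has_pointwise_sum_fourier_series_of_summable (f := f)
    (by rw [funext hc]; exact summable_zero) (θ : AddCircle _)
  simp only [hc, zero_smul] at hs
  rw [← hf]
  exact hs.unique hasSum_zero

namespace UnitaryRep

variable {V : Type*} [NormedAddCommGroup V] [InnerProductSpace ℂ V] (π : UnitaryRep V)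

theorem act_neg_one (v : V) : π.act (-1) v = v := by
  have h : (QuotientGroup.mk (-1) : PSL(2, ℝ)) = 1 := by
    refine (QuotientGroup.eq_one_iff _).2 ?_
    rw [Subgroup.mem_center_iff]
    intro g
    simp
  have h2 : π.act (-1) = 1 := by
    unfold act
    exact (congrArg π.toHom h).trans π.toHom.map_one
  rw [h2]; rfl

theorem act_expXi_add (s t : ℝ) (v : V) :
    π.act (expXi (s + t)) v = π.act (expXi s) (π.act (expXi t) v) := by
  rw [expXi_add, act_mul]

theorem act_expXi_periodic (v : V) :
    Function.Periodic (fun θ => π.act (expXi θ) v) (2 * Real.pi) := fun θ => by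
  simp only [act_expXi_add, expXi_two_pi, act_neg_one]

theorem continuous_act_expXi (v : V) : Continuous (fun θ => π.act (expXi θ) v) :=
  (π.continuous_act v).comp isSmoothMap_expXi.continuous

/-- The space `V_k` of vectors of `K`-type `k`. -/
def kSpace (k : ℤ) : Submodule ℂ V where
  carrier := {v | ∀ θ : ℝ, π.act (expXi θ) v = Complex.exp (Complex.I * k * θ) • v}
  zero_mem' := by simp
  add_mem' := by
    intro a b ha hb θ
    rw [map_add, ha, hb, smul_add]
  smul_mem' := by
    intro c a ha θ
    rw [map_smul, ha, smul_comm]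

theorem mem_kTypes_of_mem_kSpace {k : ℤ} {v : V} (hv : v ∈ π.kSpace k) (h0 : v ≠ 0) :
    k ∈ π.kTypes := ⟨v, h0, hv⟩

/-- The rotation with parameter `π / (l - k)` preserves the inner product and at the same time
multiplies it by `e^{iπ} = -1`. -/
theorem inner_eq_zero_of_kSpace {k l : ℤ} (hkl : k ≠ l) {v w : V} (hv : v ∈ π.kSpace k)
    (hw : w ∈ π.kSpace l) : inner ℂ v w = 0 := by
  have hlk : ((l : ℝ) - k) ≠ 0 := sub_ne_zero.2 (by exact_mod_cast hkl.symm)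
  have h1 := (π.act (expXi (Real.pi / (l - k)))).inner_map_map v w
  rw [hv, hw, inner_smul_left, inner_smul_right, ← mul_assoc, ← Complex.exp_conj,
    ← Complex.exp_add] at h1
  have h2 : (conj (Complex.I * k * ((Real.pi / (l - k) : ℝ) : ℂ)) +
      Complex.I * l * ((Real.pi / (l - k) : ℝ) : ℂ)) = Real.pi * Complex.I := by
    have hlk' : ((l : ℂ) - k) ≠ 0 := sub_ne_zero.2 (by exact_mod_cast hkl.symm)
    simp only [map_mul, Complex.conj_I, Complex.conj_ofReal, map_intCast]
    push_cast
    field_simp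
    ring
  rw [h2, Complex.exp_pi_mul_I] at h1
  have h3 : (2 : ℂ) * inner ℂ v w = 0 := by linear_combination -h1
  simpa using h3

/-- The projection onto `V_k`. -/
def kProj (k : ℤ) (v : V) : V :=
  (2 * Real.pi : ℝ)⁻¹ • ∫ θ in (0 : ℝ)..2 * Real.pi,
    Complex.exp (-(Complex.I * k * θ)) • π.act (expXi θ) v

theorem norm_exp_neg_I_mul (k : ℤ) (θ : ℝ) : ‖Complex.exp (-(Complex.I * k * θ))‖ = 1 := by
  rw [Complex.norm_exp]
  simp

theorem continuous_kProj_integrand (k : ℤ) (v : V) :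
    Continuous fun θ : ℝ => Complex.exp (-(Complex.I * k * θ)) • π.act (expXi θ) v :=
  (by fun_prop : Continuous fun θ : ℝ => Complex.exp (-(Complex.I * k * θ))).smul
    (π.continuous_act_expXi v)

theorem kProj_sub (k : ℤ) (v w : V) : π.kProj k (v - w) = π.kProj k v - π.kProj k w := by
  unfold kProj
  rw [← smul_sub, ← intervalIntegral.integral_sub
    ((π.continuous_kProj_integrand k v).intervalIntegrable _ _)
    ((π.continuous_kProj_integrand k w).intervalIntegrable _ _)]
  simp only [map_sub, smul_sub]

theorem norm_kProj_le (k : ℤ) (v : V) : ‖π.kProj k v‖ ≤ ‖v‖ := by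
  unfold kProj
  rw [norm_smul, norm_inv, Real.norm_of_nonneg Real.two_pi_pos.le]
  have h := intervalIntegral.norm_integral_le_of_norm_le_const (a := (0 : ℝ)) (b := 2 * Real.pi)
    (f := fun θ : ℝ => Complex.exp (-(Complex.I * k * θ)) • π.act (expXi θ) v) (C := ‖v‖)
    (fun θ _ => by rw [norm_smul, norm_exp_neg_I_mul, one_mul, LinearIsometryEquiv.norm_map])
  rw [sub_zero, abs_of_pos Real.two_pi_pos] at h
  rw [inv_mul_le_iff₀ Real.two_pi_pos]
  linarith

variable [CompleteSpace V]

theorem kProj_of_mem {k : ℤ} {v : V} (hv : v ∈ π.kSpace k) : π.kProj k v = v := by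
  unfold kProj
  have h : (fun θ : ℝ => Complex.exp (-(Complex.I * k * θ)) • π.act (expXi θ) v) = fun _ => v := by
    funext θ
    rw [hv, smul_smul, ← Complex.exp_add, neg_add_cancel, Complex.exp_zero, one_smul]
  rw [h, intervalIntegral.integral_const, sub_zero, smul_smul,
    inv_mul_cancel₀ Real.two_pi_pos.ne', one_smul]

theorem kProj_mem (k : ℤ) (v : V) : π.kProj k v ∈ π.kSpace k := by
  intro α
  let f : ℝ → V := fun θ => Complex.exp (-(Complex.I * k * θ)) • π.act (expXi θ) v
  have hper : Function.Periodic f (2 * Real.pi) := by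
    intro θ
    have h1 := π.act_expXi_periodic v θ
    simp only at h1
    simp only [f]
    rw [h1]
    congr 1
    rw [Complex.exp_eq_exp_iff_exists_int]
    exact ⟨-k, by push_cast; ring⟩
  have h1 : π.act (expXi α) (∫ θ in (0 : ℝ)..2 * Real.pi, f θ) =
      ∫ θ in (0 : ℝ)..2 * Real.pi, π.act (expXi α) (f θ) :=
    (((π.act (expXi α)).toContinuousLinearEquiv : V →L[ℂ] V).intervalIntegral_comp_comm
      ((π.continuous_kProj_integrand k v).intervalIntegrable _ _)).symm
  have h2 : ∀ θ, π.act (expXi α) (f θ) = Complex.exp (Complex.I * k * α) • f (θ + α) := by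
    intro θ
    simp only [f]
    rw [map_smul, smul_smul, ← Complex.exp_add, add_comm θ α, act_expXi_add]
    congr 2
    push_cast
    ring
  have h3 : ∫ θ in (0 : ℝ)..2 * Real.pi, f (θ + α) = ∫ θ in (0 : ℝ)..2 * Real.pi, f θ := by
    rw [intervalIntegral.integral_comp_add_right f α, zero_add, add_comm,
      hper.intervalIntegral_add_eq α 0, zero_add]
  change π.act (expXi α) ((2 * Real.pi : ℝ)⁻¹ • ∫ θ in (0 : ℝ)..2 * Real.pi, f θ) =
    Complex.exp (Complex.I * k * α) • ((2 * Real.pi : ℝ)⁻¹ • ∫ θ in (0 : ℝ)..2 * Real.pi, f θ)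
  have h4 : ∀ w : V, π.act (expXi α) ((2 * Real.pi : ℝ)⁻¹ • w) =
      (2 * Real.pi : ℝ)⁻¹ • π.act (expXi α) w := fun w =>
    ((π.act (expXi α)).toContinuousLinearEquiv.toContinuousLinearMap.restrictScalars ℝ).map_smul _ w
  rw [h4, h1]
  simp only [h2]
  rw [intervalIntegral.integral_smul, h3, smul_comm]

/-- The average over a period is rewritten as an integral over `ℝ` in which the discontinuous
indicator sits in the locally integrable factor `u`, and a cutoff makes the smooth factor compactly
supported. -/
theorem kProj_smooth (k : ℤ) {v : V} (hv : v ∈ π.smoothVectors) :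
    π.kProj k v ∈ π.smoothVectors := by
  refine (π.smoothVectors.restrictScalars ℝ).smul_mem _ ?_
  intro n γ hγ
  -- The cutoff is `1` up to distance `7`, which exceeds `2π`.
  let χ : ContDiffBump (0 : ℝ) := ⟨7, 8, by norm_num, by norm_num⟩
  let u : ℝ → ℂ := (Ioc 0 (2 * Real.pi)).indicator fun θ => Complex.exp (-(Complex.I * k * θ))
  have hu : LocallyIntegrable u volume := by
    refine LocallyIntegrable.indicator ?_ measurableSet_Ioc
    exact (by fun_prop : Continuous fun θ : ℝ => Complex.exp (-(Complex.I * k * θ))).locallyIntegrable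
  have h1 : ∀ p, π.act (γ p) (∫ θ in (0 : ℝ)..2 * Real.pi,
      Complex.exp (-(Complex.I * k * θ)) • π.act (expXi θ) v) =
      ∫ θ, u θ • (χ θ • π.act (γ p * expXi θ) v) := by
    intro p
    have h2 := ((π.act (γ p)).toContinuousLinearEquiv : V →L[ℂ] V).intervalIntegral_comp_comm
      ((π.continuous_kProj_integrand k v).intervalIntegrable (μ := volume) 0 (2 * Real.pi))
    refine h2.symm.trans ?_
    rw [intervalIntegral.integral_of_le Real.two_pi_pos.le, ← integral_indicator measurableSet_Ioc]
    congr 1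
    funext θ
    simp only [u]
    by_cases hθ : θ ∈ Ioc 0 (2 * Real.pi)
    · have h3 : χ θ = 1 := by
        apply χ.one_of_mem_closedBall
        rw [mem_closedBall_zero_iff, Real.norm_of_nonneg hθ.1.le]
        have := Real.pi_lt_d2
        change θ ≤ 7
        linarith [hθ.2]
      rw [indicator_of_mem hθ, indicator_of_mem hθ, h3, one_smul, act_mul]
      exact map_smul (π.act (γ p)) _ _
    · rw [indicator_of_notMem hθ, indicator_of_notMem hθ, zero_smul]
  simp only [h1]
  refine contDiff_integral_of_compactly_supported (ContinuousLinearMap.lsmul ℝ ℂ)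
    (g := fun p θ => χ θ • π.act (γ p * expXi θ) v) hu ?_ ?_
  · refine (χ.contDiff.comp contDiff_snd).smul ?_
    -- Smoothness of `v` is tested with the rotation angle as an additional parameter, in coordinate
    -- `0`.
    have h := hv (n + 1) (fun q => γ (fun i => q i.succ) * expXi (q 0))
      ((hγ.comp (contDiff_pi.2 fun i => contDiff_apply ℝ ℝ i.succ)).mul
        (isSmoothMap_expXi.comp (contDiff_apply ℝ ℝ (0 : Fin (n + 1)))))
    have h2 : ContDiff ℝ ∞ (fun q : (Fin n → ℝ) × ℝ => (Fin.cons q.2 q.1 : Fin (n + 1) → ℝ)) := by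
      refine contDiff_pi.2 fun i => ?_
      refine Fin.cases ?_ (fun j => ?_) i
      · simpa using contDiff_snd
      · simpa [Function.comp_def] using (contDiff_apply ℝ ℝ j).comp contDiff_fst
    simpa [Function.comp_def] using h.comp h2
  · intro p₀
    refine ⟨Metric.closedBall 0 8, isCompact_closedBall _ _, univ, Filter.univ_mem,
      fun p _ θ hθ => ?_⟩
    rw [χ.zero_of_le_dist (by simpa using (le_of_lt (by simpa using hθ) : 8 ≤ |θ|)), zero_smul]

/-- Project a smooth approximation of `v` to K-type `k`: the projection fixes `v`, does not increase
norms and preserves smoothness. -/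
theorem exists_smooth_near {k : ℤ} {v : V} (hv : v ∈ π.kSpace k) {ε : ℝ} (hε : 0 < ε) :
    ∃ w ∈ π.smoothVectors, w ∈ π.kSpace k ∧ ‖w - v‖ < ε := by
  obtain ⟨w, hw, hd⟩ := Metric.mem_closure_iff.1 (π.dense_smoothVectors v) ε hε
  refine ⟨π.kProj k w, π.kProj_smooth k hw, π.kProj_mem k w, ?_⟩
  rw [← π.kProj_of_mem hv, ← kProj_sub]
  refine (π.norm_kProj_le k _).trans_lt ?_
  rwa [← dist_eq_norm, dist_comm]

/-- The finite sums of smooth vectors of some `K`-type. -/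
def kFinite : Submodule ℂ π.smoothVectors := ⨆ k, (π.kSpace k).comap π.smoothVectors.subtype

/-- By approximation `v` is orthogonal to each `V_k`, so all Fourier coefficients of `θ ↦ ⟪v, π(exp
θΞ) v⟫` vanish. This function is therefore zero, and its value at `0` is `‖v‖²`. -/
theorem kFinite_orthogonal_eq_bot {v : V}
    (hv : ∀ w : π.smoothVectors, w ∈ π.kFinite → inner ℂ v (w : V) = 0) : v = 0 := by
  have h1 : ∀ k, ∀ w ∈ π.kSpace k, inner ℂ v w = 0 := by
    intro k w hw
    by_contra hne
    have hpos : 0 < ‖inner ℂ v w‖ := norm_pos_iff.2 hne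
    have hv0 : 0 < ‖v‖ := by
      rw [norm_pos_iff]; rintro rfl; simp at hne
    obtain ⟨w', hs, hk, hd⟩ := π.exists_smooth_near hw (div_pos hpos hv0)
    have h0 : inner ℂ v w' = 0 :=
      hv ⟨w', hs⟩ (Submodule.mem_iSup_of_mem k (by simpa using hk))
    have h2 : inner ℂ v w = - inner ℂ v (w' - w) := by rw [inner_sub_right, h0]; ring
    have h3 : ‖inner ℂ v w‖ ≤ ‖v‖ * ‖w' - w‖ := by
      rw [h2, norm_neg]; exact norm_inner_le_norm _ _
    rw [lt_div_iff₀ hv0] at hd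
    linarith
  have h2 := eq_zero_of_fourier_eq_zero (φ := fun θ => inner ℂ v (π.act (expXi θ) v))
    (continuous_const.inner (π.continuous_act_expXi v))
    (fun θ => by have := π.act_expXi_periodic v θ; simp only at this; simp only [this]) (fun k => by
      have h3 := h1 k _ (π.kProj_mem k v)
      unfold kProj at h3
      rw [← Complex.coe_smul, inner_smul_right] at h3
      have h4 := (mul_eq_zero.1 h3).resolve_left
        (Complex.ofReal_ne_zero.2 (inv_ne_zero Real.two_pi_pos.ne'))
      rw [← h4]
      have h5 := (innerSL ℂ v).intervalIntegral_comp_comm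
        ((π.continuous_kProj_integrand k v).intervalIntegrable (μ := volume) 0 (2 * Real.pi))
      refine Eq.trans ?_ h5
      simp only [innerSL_apply_apply, inner_smul_right]) 0
  have h3 : expXi 0 = 1 := oneParameter_zero expXi_add
  simpa [h3, act_one] using h2

theorem dense_kFinite : Dense ((π.kFinite.map π.smoothVectors.subtype : Submodule ℂ V) : Set V) := by
  rw [Submodule.dense_iff_topologicalClosure_eq_top, Submodule.topologicalClosure_eq_top_iff,
    Submodule.eq_bot_iff]
  intro v hv
  refine π.kFinite_orthogonal_eq_bot fun w hw => ?_
  exact Submodule.inner_left_of_mem_orthogonal (Submodule.mem_map_of_mem hw) hv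

end UnitaryRep

end KineticBM

/-! ### Spherical functions and rotation invariant vectors -/

namespace KineticBM

open Set

/-- The sum of the squares of the entries of a matrix. -/
def sumSq (g : SL(2, ℝ)) : ℝ := g.1 0 0 ^ 2 + g.1 0 1 ^ 2 + g.1 1 0 ^ 2 + g.1 1 1 ^ 2

theorem exists_polar (x y : ℝ) :
    ∃ ρ u : ℝ, 0 ≤ ρ ∧ ρ ^ 2 = x ^ 2 + y ^ 2 ∧ x = ρ * Real.cos u ∧ y = ρ * Real.sin u := by
  refine ⟨‖(⟨x, y⟩ : ℂ)‖, Complex.arg ⟨x, y⟩, norm_nonneg _, ?_, ?_, ?_⟩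
  · rw [Complex.sq_norm, Complex.normSq_mk]; ring
  · rw [Complex.norm_mul_cos_arg]
  · rw [Complex.norm_mul_sin_arg]

/-- Rotations on either side preserve the sum of squares, so the radial parameter can be read off
from the entries of the matrix. -/
theorem sumSq_kak (α r β : ℝ) : sumSq (expXi α * expH r * expXi β) = 2 * Real.cosh r := by
  unfold sumSq
  simp only [Matrix.SpecialLinearGroup.coe_mul, Matrix.mul_apply, Fin.sum_univ_two]
  simp only [expXi, expH, Matrix.of_apply, Matrix.cons_val', Matrix.cons_val_zero,
    Matrix.cons_val_one, Matrix.cons_val_fin_one]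
  have h1 := Real.sin_sq_add_cos_sq (α / 2)
  have h2 := Real.sin_sq_add_cos_sq (β / 2)
  have hE : Real.exp r = Real.exp (r / 2) ^ 2 := by rw [← Real.exp_nat_mul]; congr 1; push_cast; ring
  have hE' : Real.exp (-r) = Real.exp (-(r / 2)) ^ 2 := by
    rw [← Real.exp_nat_mul]; congr 1; push_cast; ring
  rw [Real.cosh_eq, hE, hE']
  set E := Real.exp (r / 2)
  set E' := Real.exp (-(r / 2))
  rw [← sub_eq_zero]
  have hs : Real.sin (α / 2) ^ 2 = 1 - Real.cos (α / 2) ^ 2 := by linarith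
  have hs2 : Real.sin (β / 2) ^ 2 = 1 - Real.cos (β / 2) ^ 2 := by linarith
  ring_nf
  have e1 : Real.sin (α * (1 / 2)) ^ 2 = 1 - Real.cos (α * (1 / 2)) ^ 2 := by
    linarith [Real.sin_sq_add_cos_sq (α * (1 / 2))]
  have e2 : Real.sin (β * (1 / 2)) ^ 2 = 1 - Real.cos (β * (1 / 2)) ^ 2 := by
    linarith [Real.sin_sq_add_cos_sq (β * (1 / 2))]
  rw [e1, e2]
  ring

/-- Split `g` into its conformal and anticonformal parts, of lengths `P` and `Q`. The determinant
gives `(P/2)² - (Q/2)² = 1`, so `P/2` and `Q/2` are `cosh (r/2)` and `sinh (r/2)`; the arguments `u`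
and `w` of the two parts are `(β + α)/2` and `(β - α)/2`. -/
theorem exists_kak (g : SL(2, ℝ)) :
    ∃ α r β : ℝ, 0 ≤ r ∧ g = expXi α * expH r * expXi β := by
  have hdet := g.2
  rw [Matrix.det_fin_two] at hdet
  obtain ⟨P, u, hP0, hP, hPx, hPy⟩ := exists_polar (g.1 0 0 + g.1 1 1) (g.1 0 1 - g.1 1 0)
  obtain ⟨Q, w, hQ0, hQ, hQx, hQy⟩ := exists_polar (g.1 0 0 - g.1 1 1) (g.1 0 1 + g.1 1 0)
  have hPQ : (P / 2) ^ 2 - (Q / 2) ^ 2 = 1 := by nlinarith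
  have hP1 : 1 ≤ P / 2 := by nlinarith [sq_nonneg (Q / 2)]
  have hc : Real.cosh (Real.arcosh (P / 2)) = P / 2 := Real.cosh_arcosh hP1
  have hs : Real.sinh (Real.arcosh (P / 2)) = Q / 2 := by
    rw [Real.sinh_arcosh hP1, show (P / 2) ^ 2 - 1 = (Q / 2) ^ 2 by linarith]
    exact Real.sqrt_sq (by positivity)
  refine ⟨u - w, 2 * Real.arcosh (P / 2), u + w, by
    have := Real.arcosh_nonneg hP1; positivity, ?_⟩
  have hr : 2 * Real.arcosh (P / 2) / 2 = Real.arcosh (P / 2) := by ring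
  have hE : Real.exp (Real.arcosh (P / 2)) = P / 2 + Q / 2 := by
    rw [← Real.cosh_add_sinh, hc, hs]
  have hE' : Real.exp (-Real.arcosh (P / 2)) = P / 2 - Q / 2 := by
    rw [← Real.cosh_sub_sinh, hc, hs]
  have hu : u = (u - w) / 2 + (u + w) / 2 := by ring
  have hw : w = (u + w) / 2 - (u - w) / 2 := by ring
  rw [hu, Real.cos_add] at hPx
  rw [hu, Real.sin_add] at hPy
  rw [hw, Real.cos_sub] at hQx
  rw [hw, Real.sin_sub] at hQy
  have key : ∀ i j, g.1 i j = (expXi (u - w) * expH (2 * Real.arcosh (P / 2)) *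
      expXi (u + w)).1 i j := by
    intro i j
    simp only [Matrix.SpecialLinearGroup.coe_mul, Matrix.mul_apply, Fin.sum_univ_two]
    simp only [expXi, expH, Matrix.of_apply, Matrix.cons_val', Matrix.cons_val_zero,
      Matrix.cons_val_one, Matrix.cons_val_fin_one, hr, hE, hE']
    ring_nf at hPx hPy hQx hQy
    fin_cases i <;> fin_cases j <;> simp <;> ring_nf <;> linarith
  exact Subtype.ext (Matrix.ext key)

namespace UnitaryRep

variable {V : Type*} [NormedAddCommGroup V] [InnerProductSpace ℂ V] (π : UnitaryRep V)

theorem act_expXi_of_mem_zero {e : V} (he : e ∈ π.kSpace 0) (θ : ℝ) : π.act (expXi θ) e = e := by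
  simpa using he θ

theorem inner_act_expXi_mul {e' : V} (he' : e' ∈ π.kSpace 0) (θ : ℝ) (g : SL(2, ℝ)) (v : V) :
    inner ℂ e' (π.act (expXi θ * g) v) = inner ℂ e' (π.act g v) := by
  have h := (π.act (expXi θ)).inner_map_map e' (π.act g v)
  rwa [π.act_expXi_of_mem_zero he', ← act_mul] at h

theorem inner_lieDerSq {c : ℝ → SL(2, ℝ)} (hc : IsSmoothMap c) (w : V) (v : π.smoothVectors) :
    inner ℂ w (π.lieDerSq c hc v) =
      deriv (deriv fun s => inner ℂ w (π.act (c s) (v : V))) 0 := by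
  have h1 := (π.contDiff_orbit hc v).differentiable (by simp)
  have h2 := (contDiff_infty_iff_deriv.1 (π.contDiff_orbit hc v)).2.differentiable (by simp)
  have hd : ∀ f : ℝ → V, Differentiable ℝ f →
      deriv (fun s => inner ℂ w (f s)) = fun s => inner ℂ w (deriv f s) := by
    intro f hf
    funext s
    have := (hasDerivAt_const s w).inner ℂ (hf s).hasDerivAt
    simpa using this.deriv
  rw [hd _ h1, hd _ h2]
  rfl

section Spherical

variable {e e' : V} (he : e ∈ π.kSpace 0) (hs : e ∈ π.smoothVectors) (he' : e' ∈ π.kSpace 0)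

/-- The restriction of the matrix coefficient `⟪e', π(g) e⟫` to the diagonal subgroup. -/
def spherical (e e' : V) (t : ℝ) : ℂ := inner ℂ e' (π.act (expH t) e)

include he he' in
theorem inner_act_eq_spherical (g : SL(2, ℝ)) :
    inner ℂ e' (π.act g e) = π.spherical e e' (Real.arcosh (sumSq g / 2)) := by
  obtain ⟨α, r, β, hr, rfl⟩ := exists_kak g
  rw [sumSq_kak, mul_div_cancel_left₀ _ (two_ne_zero' ℝ), Real.arcosh_cosh hr, mul_assoc,
    π.inner_act_expXi_mul he', act_mul, π.act_expXi_of_mem_zero he, spherical]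

include hs in
theorem contDiff_spherical : ContDiff ℝ ∞ (π.spherical e e') :=
  contDiff_const.inner ℂ (π.contDiff_orbit isSmoothMap_expH ⟨e, hs⟩)

include he he' in
theorem spherical_neg (t : ℝ) : π.spherical e e' (-t) = π.spherical e e' t := by
  have h : sumSq (expH (-t)) = sumSq (expH t) := by
    simp [sumSq, expH, neg_div]; ring
  change inner ℂ e' (π.act (expH (-t)) e) = inner ℂ e' (π.act (expH t) e)
  rw [π.inner_act_eq_spherical he he', π.inner_act_eq_spherical he he', h]

include he he' hs in
-- The radial part of the Casimir relation, taken at `π(exp tH) e` and paired with `e'`. The `Ξ²`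
-- term vanishes because `e'` is rotation invariant, `H²` gives the second derivative, and `B²`
-- gives the first order term.
theorem spherical_ode {lam : ℝ} (hlam : π.HasCasimir lam) {t : ℝ} (ht : 0 < t) :
    deriv (deriv (π.spherical e e')) t +
      ((Real.cosh t / Real.sinh t : ℝ) : ℂ) * deriv (π.spherical e e') t +
      (lam / 4 : ℝ) * π.spherical e e' t = 0 := by
  set Φ := π.spherical e e' with hΦ
  let w : π.smoothVectors := ⟨π.act (expH t) e, π.act_smooth (expH t) ⟨e, hs⟩⟩
  have hcas := congrArg (fun z => inner ℂ e' z) (hlam w)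
  simp only [inner_sub_right, inner_smul_right] at hcas
  have hX : inner ℂ e' (π.xiSq w) = 0 := by
    rw [xiSq, inner_lieDerSq]
    have : (fun s => inner ℂ e' (π.act (expXi s) (w : V))) = fun _ => inner ℂ e' (w : V) := by
      funext s
      have := π.inner_act_expXi_mul he' s 1 (w : V)
      rwa [mul_one, act_one] at this
    rw [this]; simp
  have hH : inner ℂ e' (π.hSq w) = deriv (deriv Φ) t := by
    rw [hSq, inner_lieDerSq]
    have h1 : (fun s => inner ℂ e' (π.act (expH s) (w : V))) = fun s => Φ (s + t) := by
      funext s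
      simp only [w, hΦ, spherical]
      rw [← act_mul, ← expH_add]
    have h2 : (deriv fun s => Φ (s + t)) = fun s => deriv Φ (s + t) :=
      funext fun s => deriv_comp_add_const Φ t s
    rw [h1, h2, deriv_comp_add_const, zero_add]
  have hB : inner ℂ e' (π.bSq w) = ((Real.cosh t / Real.sinh t : ℝ) : ℂ) * deriv Φ t := by
    rw [bSq, inner_lieDerSq]
    -- The radial part of `exp(sB) exp(tH)` is given by the hyperbolic Pythagorean theorem.
    have h1 : (fun s => inner ℂ e' (π.act (expB s) (w : V))) =
        fun s => Φ (Real.arcosh (Real.cosh s * Real.cosh t)) := by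
      funext s
      simp only [w]
      rw [← act_mul, π.inner_act_eq_spherical he he']
      congr 2
      unfold sumSq
      simp only [Matrix.SpecialLinearGroup.coe_mul, Matrix.mul_apply, Fin.sum_univ_two]
      simp only [expB, expH, Matrix.of_apply, Matrix.cons_val', Matrix.cons_val_zero,
        Matrix.cons_val_one, Matrix.cons_val_fin_one]
      have hs2 : Real.cosh s = Real.cosh (s / 2) ^ 2 + Real.sinh (s / 2) ^ 2 := by
        rw [← Real.cosh_two_mul]; congr 1; ring
      have ht2 : Real.cosh t = (Real.exp (t / 2) ^ 2 + Real.exp (-(t / 2)) ^ 2) / 2 := by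
        rw [Real.cosh_eq, ← Real.exp_nat_mul, ← Real.exp_nat_mul]
        congr 3 <;> (push_cast; ring)
      rw [hs2, ht2]
      ring
    rw [h1]
    have hgt : ∀ s, 1 < Real.cosh s * Real.cosh t := fun s => by
      have h1 := Real.one_le_cosh s
      have h2 : 1 < Real.cosh t := Real.one_lt_cosh.2 ht.ne'
      nlinarith
    have hΦd : Differentiable ℝ Φ := (π.contDiff_spherical hs).differentiable (by simp)
    have hΦc : Continuous (deriv Φ) :=
      ((contDiff_infty_iff_deriv.1 (π.contDiff_spherical hs)).2).continuous
    let q : ℝ → ℂ := fun s =>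
      ((Real.cosh t * (√((Real.cosh s * Real.cosh t) ^ 2 - 1))⁻¹ : ℝ) : ℂ) *
        deriv Φ (Real.arcosh (Real.cosh s * Real.cosh t))
    have h2 : (deriv fun s => Φ (Real.arcosh (Real.cosh s * Real.cosh t))) =
        fun s => (Real.sinh s : ℂ) * q s := by
      funext s
      have hr : HasDerivAt (fun s => Real.arcosh (Real.cosh s * Real.cosh t))
          ((√((Real.cosh s * Real.cosh t) ^ 2 - 1))⁻¹ * (Real.sinh s * Real.cosh t)) s :=
        HasDerivAt.comp (h₂ := Real.arcosh) s (Real.hasDerivAt_arcosh (hgt s))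
          ((Real.hasDerivAt_cosh s).mul_const _)
      have h3 := (hΦd _).hasDerivAt.scomp s hr
      refine (h3.deriv).trans ?_
      simp only [q, Complex.real_smul]
      push_cast
      ring
    have hq : ContinuousAt q 0 := by
      have hc1 : Continuous fun s => Real.cosh s * Real.cosh t := by fun_prop
      refine ContinuousAt.mul ?_ ?_
      · refine Complex.continuous_ofReal.continuousAt.comp (ContinuousAt.mul continuousAt_const
          (ContinuousAt.inv₀ (by fun_prop) ?_))
        have := hgt 0
        exact (Real.sqrt_pos.2 (by nlinarith)).ne'
      · exact hΦc.continuousAt.comp (ContinuousAt.comp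
          (g := Real.arcosh) (Real.differentiableAt_arcosh (hgt 0)).continuousAt hc1.continuousAt)
    -- Since `sinh` vanishes at `0`, continuity of `q` there is enough for the derivative of the
    -- product.
    have h4 : HasDerivAt (fun s : ℝ => (Real.sinh s : ℂ) * q s) (q 0) 0 := by
      have hsinh : HasDerivAt (fun s : ℝ => (Real.sinh s : ℂ)) 1 0 := by
        have := (Real.hasDerivAt_sinh 0).ofReal_comp
        simpa using this
      rw [hasDerivAt_iff_tendsto_slope] at hsinh ⊢
      have h5 : slope (fun s : ℝ => (Real.sinh s : ℂ) * q s) 0 =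
          fun s => slope (fun s : ℝ => (Real.sinh s : ℂ)) 0 s * q s := by
        funext s
        simp only [slope, vsub_eq_sub, Real.sinh_zero, Complex.ofReal_zero, zero_mul, sub_zero,
          Complex.real_smul]
        ring
      rw [h5]
      simpa using hsinh.mul (hq.tendsto.mono_left nhdsWithin_le_nhds)
    rw [h2, h4.deriv]
    simp only [q, Real.cosh_zero, one_mul]
    have h6 : √(Real.cosh t ^ 2 - 1) = Real.sinh t := by
      rw [← Real.sinh_arcosh (Real.one_le_cosh t), Real.arcosh_cosh ht.le]
    rw [h6, Real.arcosh_cosh ht.le, div_eq_mul_inv]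
  rw [hX, hH, hB] at hcas
  have hw : inner ℂ e' (w : V) = Φ t := rfl
  rw [hw] at hcas
  push_cast at hcas ⊢
  linear_combination (-1 / 4 : ℂ) * hcas

include he he' hs in
-- Energy estimate: by the differential equation `E = |Φ'|² + (λ/4) |Φ|²` has derivative `-2 coth t
-- |Φ'|² ≤ 0`. It starts at `0`, because `Φ` is even and `Φ(0) = ⟪e', e⟫ = 0`, and it controls `Φ`
-- because `λ > 0`.
theorem spherical_eq_zero {lam : ℝ} (hlam : π.HasCasimir lam) (hpos : 0 < lam)
    (horth : inner ℂ e' e = 0) {t : ℝ} (ht : 0 ≤ t) : π.spherical e e' t = 0 := by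
  set Φ := π.spherical e e' with hΦ
  have hΦs : ContDiff ℝ ∞ Φ := π.contDiff_spherical hs
  have hΦd : Differentiable ℝ Φ := hΦs.differentiable (by simp)
  have hΦd2 : Differentiable ℝ (deriv Φ) :=
    (contDiff_infty_iff_deriv.1 hΦs).2.differentiable (by simp)
  have h0 : Φ 0 = 0 := by
    simp only [hΦ, spherical, oneParameter_zero expH_add, act_one, horth]
  have h0' : deriv Φ 0 = 0 := by
    have h1 : (fun t => Φ (-t)) = Φ := funext (π.spherical_neg he he')
    have h2 := deriv_comp_neg Φ 0
    rw [h1, neg_zero] at h2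
    have h3 : (2 : ℂ) * deriv Φ 0 = 0 := by linear_combination h2
    simpa using h3
  let E : ℝ → ℝ := fun t => ‖deriv Φ t‖ ^ 2 + lam / 4 * ‖Φ t‖ ^ 2
  have hE : ∀ t, HasDerivAt E (2 * inner ℝ (deriv Φ t) (deriv (deriv Φ) t) +
      lam / 4 * (2 * inner ℝ (Φ t) (deriv Φ t))) t := fun t =>
    (hΦd2 t).hasDerivAt.norm_sq.add ((hΦd t).hasDerivAt.norm_sq.const_mul _)
  have hanti : AntitoneOn E (Ici 0) := by
    refine antitoneOn_of_deriv_nonpos (convex_Ici 0)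
      (fun t _ => (hE t).continuousAt.continuousWithinAt)
      (fun t _ => (hE t).differentiableAt.differentiableWithinAt) fun t ht => ?_
    rw [interior_Ici] at ht
    have ht : 0 < t := ht
    rw [(hE t).deriv]
    have hode := π.spherical_ode he hs he' hlam ht
    rw [← hΦ] at hode
    have h2 : deriv (deriv Φ) t = -((Real.cosh t / Real.sinh t) • deriv Φ t) -
        (lam / 4) • Φ t := by
      rw [Complex.real_smul, Complex.real_smul]
      linear_combination hode
    rw [h2, inner_sub_right, inner_neg_right, inner_smul_right, inner_smul_right,
      real_inner_self_eq_norm_sq, real_inner_comm]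
    have h3 : 0 ≤ Real.cosh t / Real.sinh t :=
      div_nonneg (Real.cosh_pos t).le (Real.sinh_pos_iff.2 ht).le
    nlinarith [mul_nonneg h3 (sq_nonneg ‖deriv Φ t‖)]
  have h1 := hanti (mem_Ici.2 le_rfl) (mem_Ici.2 ht) ht
  simp only [E, h0, h0', norm_zero] at h1
  have h2 : ‖Φ t‖ ^ 2 ≤ 0 := by nlinarith [sq_nonneg ‖deriv Φ t‖, sq_nonneg ‖Φ t‖]
  have h3 : ‖Φ t‖ = 0 := by nlinarith [norm_nonneg (Φ t)]
  exact norm_eq_zero.1 h3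

include he he' hs in
-- By the decomposition `g = k a k'` all coefficients `⟪e', π(g) e⟫` vanish. The vectors with this
-- property form a closed invariant subspace containing `e ≠ 0`, hence containing `e'`; evaluate at
-- `g = 1`.
theorem eq_zero_of_inner_eq_zero (hirr : π.IsIrreducible) {lam : ℝ} (hlam : π.HasCasimir lam)
    (hpos : 0 < lam) (hne : e ≠ 0) (horth : inner ℂ e' e = 0) : e' = 0 := by
  have hall : ∀ g, inner ℂ e' (π.act g e) = 0 := by
    intro g
    obtain ⟨α, r, β, hr, hg⟩ := exists_kak g
    rw [hg, mul_assoc, π.inner_act_expXi_mul he', act_mul, π.act_expXi_of_mem_zero he]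
    exact π.spherical_eq_zero he hs he' hlam hpos horth hr
  let W : Submodule ℂ V :=
    { carrier := {v | ∀ g : SL(2, ℝ), inner ℂ e' (π.act g v) = 0}
      zero_mem' := by simp
      add_mem' := by
        intro a b ha hb g
        rw [map_add, inner_add_right, ha, hb, add_zero]
      smul_mem' := by
        intro c a ha g
        rw [map_smul, inner_smul_right, ha, mul_zero] }
  have hclosed : IsClosed (W : Set V) := by
    have : (W : Set V) = ⋂ g : SL(2, ℝ), {v | inner ℂ e' (π.act g v) = 0} := by
      ext v
      rw [Set.mem_iInter]
      rfl
    rw [this]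
    exact isClosed_iInter fun g => isClosed_eq
      (continuous_const.inner (π.act g).continuous) continuous_const
  have hinv : ∀ g : PSL(2, ℝ), ∀ v ∈ W, π.toHom g v ∈ W := by
    intro g v hv
    obtain ⟨g, rfl⟩ := QuotientGroup.mk_surjective g
    intro h
    change inner ℂ e' (π.act h (π.act g v)) = 0
    rw [← act_mul]
    exact hv _
  rcases hirr.2 W hclosed hinv with h | h
  · have : e ∈ W := hall
    rw [h, Submodule.mem_bot] at this
    exact absurd this hne
  · have : e' ∈ W := h ▸ Submodule.mem_top
    have := this 1
    rwa [act_one, inner_self_eq_zero] at this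

end Spherical

theorem xiSq_of_mem {k : ℤ} (v : π.smoothVectors) (hv : (v : V) ∈ π.kSpace k) :
    -π.xiSq v = ((k : ℂ) ^ 2) • (v : V) := by
  have h1 : (fun t : ℝ => π.act (expXi t) (v : V)) =
      fun t : ℝ => Complex.exp (Complex.I * k * t) • (v : V) := funext hv
  have hexp : ∀ (z : V) (t : ℝ), HasDerivAt (fun t : ℝ => Complex.exp (Complex.I * k * t) • z)
      (Complex.exp (Complex.I * k * t) • (Complex.I * k) • z) t := by
    intro z t
    have h2 : HasDerivAt (fun t : ℝ => Complex.exp (Complex.I * k * t))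
        (Complex.exp (Complex.I * k * t) * (Complex.I * k)) t := by
      have := (((hasDerivAt_id (t : ℂ)).const_mul (Complex.I * k)).cexp).comp_ofReal
      simpa using this
    simpa [smul_smul] using h2.smul_const z
  have h2 : π.xiSq v = deriv (deriv fun t : ℝ => π.act (expXi t) (v : V)) 0 := rfl
  rw [h2, h1, funext fun t => (hexp (v : V) t).deriv, (hexp _ 0).deriv, smul_smul, smul_smul,
    ← neg_smul]
  congr 1
  simp only [Complex.ofReal_zero, mul_zero, Complex.exp_zero]
  linear_combination (-(k : ℂ) ^ 2) * Complex.I_sq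

/-- A rotation fixing `e` conjugates `H` to `-B`. Thus `‖H e‖ = ‖B e‖`, and each square is half of
the value given by the Casimir relation. -/
theorem norm_sq_hDer_of_mem_zero {lam : ℝ} (hlam : π.HasCasimir lam) (e : π.smoothVectors)
    (he : (e : V) ∈ π.kSpace 0) : ‖π.hDer e‖ ^ 2 = lam / 8 * ‖(e : V)‖ ^ 2 := by
  have h1 : ∀ t, expB (-t) = expXi (Real.pi / 2) * expH t * expXi (-(Real.pi / 2)) := by
    intro t
    have h2 : Real.pi / 2 / 2 = Real.pi / 4 := by ring
    have h3 : (√2 / 2) * (√2 / 2) = 1 / 2 := by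
      have := Real.mul_self_sqrt (show (0 : ℝ) ≤ 2 by norm_num)
      linarith
    refine Subtype.ext (Matrix.ext fun i j => ?_)
    simp only [Matrix.SpecialLinearGroup.coe_mul, Matrix.mul_apply, Fin.sum_univ_two]
    simp only [expXi, expH, expB, Matrix.of_apply, Matrix.cons_val', Matrix.cons_val_zero,
      Matrix.cons_val_one, Matrix.cons_val_fin_one, neg_div, h2, Real.cos_neg, Real.sin_neg,
      Real.cos_pi_div_four, Real.sin_pi_div_four, Real.cosh_neg, Real.sinh_neg]
    rw [Real.cosh_eq, Real.sinh_eq]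
    fin_cases i <;> fin_cases j <;> simp
    · linear_combination (-(Real.exp (t / 2) + Real.exp (-(t / 2)))) * h3
    · linear_combination (Real.exp (t / 2) - Real.exp (-(t / 2))) * h3
    · linear_combination (Real.exp (t / 2) - Real.exp (-(t / 2))) * h3
    · linear_combination (-(Real.exp (t / 2) + Real.exp (-(t / 2)))) * h3
  have h2 : HasDerivAt (fun t => π.act (expB (-t)) (e : V))
      (π.act (expXi (Real.pi / 2)) (π.hDer e)) 0 := by
    simp only [h1, act_mul, π.act_expXi_of_mem_zero he]
    exact (((π.act (expXi (Real.pi / 2))).toContinuousLinearEquiv : V →L[ℂ] V).restrictScalars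
      ℝ).hasFDerivAt.comp_hasDerivAt 0 (π.hasDerivAt_lieDer_zero isSmoothMap_expH e)
  have h3 : HasDerivAt (fun t => π.act (expB (-t)) (e : V))
      (-(π.lieDer expB isSmoothMap_expB e)) 0 := by
    have := HasDerivAt.scomp (0 : ℝ) (by simpa using π.hasDerivAt_lieDer_zero isSmoothMap_expB e)
      (hasDerivAt_neg (0 : ℝ))
    simpa [Function.comp_def] using this
  have h4 : ‖π.lieDer expB isSmoothMap_expB e‖ = ‖π.hDer e‖ := by
    rw [← norm_neg, ← h2.unique h3, LinearIsometryEquiv.norm_map]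
  have h5 := π.norm_sq_hDer_add lam hlam e
  rw [π.xiSq_of_mem e he, h4] at h5
  simp only [Int.cast_zero, ne_eq, OfNat.ofNat_ne_zero, not_false_eq_true, zero_pow, zero_smul,
    inner_zero_left, zero_add] at h5
  have h6 : ‖π.hDer e‖ ^ 2 + ‖π.hDer e‖ ^ 2 = lam / 4 * ‖(e : V)‖ ^ 2 := by exact_mod_cast h5
  linarith

/-- A rotation fixing `e` and `e'` conjugates `H` to `-H`, so the inner product equals its own
negative. -/
theorem inner_hDer_of_mem_zero (e e' : π.smoothVectors) (he : (e : V) ∈ π.kSpace 0)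
    (he' : (e' : V) ∈ π.kSpace 0) : inner ℂ (e' : V) (π.hDer e) = 0 := by
  have h1 : ∀ t, expH (-t) = expXi Real.pi * expH t * expXi (-Real.pi) := by
    intro t
    refine Subtype.ext (Matrix.ext fun i j => ?_)
    simp only [Matrix.SpecialLinearGroup.coe_mul, Matrix.mul_apply, Fin.sum_univ_two]
    simp only [expXi, expH, Matrix.of_apply, Matrix.cons_val', Matrix.cons_val_zero,
      Matrix.cons_val_one, Matrix.cons_val_fin_one, neg_div, Real.cos_neg, Real.sin_neg,
      Real.cos_pi_div_two, Real.sin_pi_div_two]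
    fin_cases i <;> fin_cases j <;> simp
  have h2 : HasDerivAt (fun t => π.act (expH (-t)) (e : V))
      (π.act (expXi Real.pi) (π.hDer e)) 0 := by
    simp only [h1, act_mul, π.act_expXi_of_mem_zero he]
    exact (((π.act (expXi Real.pi)).toContinuousLinearEquiv : V →L[ℂ] V).restrictScalars
      ℝ).hasFDerivAt.comp_hasDerivAt 0 (π.hasDerivAt_lieDer_zero isSmoothMap_expH e)
  have h3 : HasDerivAt (fun t => π.act (expH (-t)) (e : V)) (-(π.hDer e)) 0 := by
    have := HasDerivAt.scomp (0 : ℝ) (by simpa using π.hasDerivAt_lieDer_zero isSmoothMap_expH e)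
      (hasDerivAt_neg (0 : ℝ))
    simpa [Function.comp_def, hDer] using this
  have h4 := (π.act (expXi Real.pi)).inner_map_map (e' : V) (π.hDer e)
  rw [π.act_expXi_of_mem_zero he', h2.unique h3, inner_neg_right] at h4
  have h5 : (2 : ℂ) * inner ℂ (e' : V) (π.hDer e) = 0 := by linear_combination -h4
  simpa using h5

/-- In an irreducible representation with positive Casimir eigenvalue and a rotation invariant
vector, the rotation invariant vectors are the multiples of a smooth unit vector. -/
theorem exists_unit_kSpace_zero [CompleteSpace V] (hirr : π.IsIrreducible) {lam : ℝ}
    (hlam : π.HasCasimir lam) (hpos : 0 < lam) (h0 : (0 : ℤ) ∈ π.kTypes) :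
    ∃ e : π.smoothVectors, ‖(e : V)‖ = 1 ∧ (e : V) ∈ π.kSpace 0 ∧
      ∀ v ∈ π.kSpace 0, inner ℂ (e : V) v • (e : V) = v := by
  obtain ⟨v, hv0, hv⟩ := h0
  obtain ⟨w, hws, hwk, hwv⟩ := π.exists_smooth_near (k := 0) hv (norm_pos_iff.2 hv0)
  have hw0 : w ≠ 0 := by
    rintro rfl
    simp at hwv
  have hn : (‖w‖ : ℂ) ≠ 0 := Complex.ofReal_ne_zero.2 (norm_ne_zero_iff.2 hw0)
  have he1 : ‖(‖w‖ : ℂ)⁻¹ • w‖ = 1 := by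
    rw [norm_smul, norm_inv, Complex.norm_real, norm_norm,
      inv_mul_cancel₀ (norm_ne_zero_iff.2 hw0)]
  have hes : (‖w‖ : ℂ)⁻¹ • w ∈ π.smoothVectors := Submodule.smul_mem _ _ hws
  have hek : (‖w‖ : ℂ)⁻¹ • w ∈ π.kSpace 0 := Submodule.smul_mem _ _ hwk
  set e := (‖w‖ : ℂ)⁻¹ • w
  refine ⟨⟨e, hes⟩, he1, hek, fun v hv => ?_⟩
  have hz : v - inner ℂ e v • e ∈ π.kSpace 0 :=
    Submodule.sub_mem _ hv (Submodule.smul_mem _ _ hek)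
  have h := π.eq_zero_of_inner_eq_zero hek hes hz hirr hlam hpos
    (norm_ne_zero_iff.1 (by rw [he1]; exact one_ne_zero)) (by
      rw [inner_sub_left, inner_smul_left, inner_self_eq_norm_sq_to_K, he1, inner_conj_symm]
      simp)
  exact (sub_eq_zero.1 h).symm

end UnitaryRep

end KineticBM

/-! ### Resolvents of unbounded operators -/

namespace KineticBM

open Set

section Resolvents

variable {V : Type*} [NormedAddCommGroup V] [InnerProductSpace ℂ V]

/-- The graph of a partially defined operator: `u` is in the domain and `T u = w`. -/
def Maps (T : V →ₗ.[ℂ] V) (u w : V) : Prop := ∃ h : u ∈ T.domain, T ⟨u, h⟩ = w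

section Maps

variable {T : V →ₗ.[ℂ] V}

theorem Maps.add {u w u' w' : V} (h : Maps T u w) (h' : Maps T u' w') :
    Maps T (u + u') (w + w') := by
  obtain ⟨a, rfl⟩ := h
  obtain ⟨b, rfl⟩ := h'
  exact ⟨T.domain.add_mem a b, T.map_add ⟨u, a⟩ ⟨u', b⟩⟩

theorem Maps.smul {u w : V} (h : Maps T u w) (c : ℂ) : Maps T (c • u) (c • w) := by
  obtain ⟨a, rfl⟩ := h
  exact ⟨T.domain.smul_mem c a, T.map_smul c ⟨u, a⟩⟩

theorem Maps.sub {u w u' w' : V} (h : Maps T u w) (h' : Maps T u' w') :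
    Maps T (u - u') (w - w') := by
  have := h.add (h'.smul (-1))
  simpa [sub_eq_add_neg] using this

theorem isResolventAt_iff {ζ : ℂ} {R : V →L[ℂ] V} : IsResolventAt T ζ R ↔
    (∀ w, Maps T (R w) (w + ζ • R w)) ∧ ∀ u w, Maps T u w → R (w - ζ • u) = u := by
  constructor
  · rintro ⟨h1, h2⟩
    refine ⟨fun w => ?_, ?_⟩
    · obtain ⟨h, hw⟩ := h1 w
      exact ⟨h, sub_eq_iff_eq_add.1 hw⟩
    · rintro u w ⟨h, rfl⟩
      exact h2 ⟨u, h⟩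
  · rintro ⟨h1, h2⟩
    refine ⟨fun w => ?_, fun u => h2 u _ ⟨u.2, rfl⟩⟩
    obtain ⟨h, hw⟩ := h1 w
    exact ⟨h, by rw [hw]; simp⟩

theorem maps_adjoint_iff [CompleteSpace V] {L : V →ₗ.[ℂ] V} (hL : Dense (L.domain : Set V))
    {u w : V} : Maps L† u w ↔ ∀ v : L.domain, inner ℂ w (v : V) = inner ℂ u (L v) := by
  constructor
  · rintro ⟨h, rfl⟩ v
    exact LinearPMap.adjoint_isFormalAdjoint hL ⟨u, h⟩ v
  · intro h
    have hu : u ∈ L†.domain := LinearPMap.mem_adjoint_domain_of_exists u ⟨w, h⟩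
    exact ⟨hu, LinearPMap.adjoint_apply_eq hL ⟨u, hu⟩ h⟩

end Maps

variable {T : V →ₗ.[ℂ] V}

theorem IsResolventAt.maps {ζ : ℂ} {R : V →L[ℂ] V} (h : IsResolventAt T ζ R) (w : V) :
    Maps T (R w) (w + ζ • R w) := (isResolventAt_iff.1 h).1 w

theorem IsResolventAt.apply_of_maps {ζ : ℂ} {R : V →L[ℂ] V} (h : IsResolventAt T ζ R) {u w : V}
    (huw : Maps T u w) : R (w - ζ • u) = u := (isResolventAt_iff.1 h).2 u w huw

theorem IsResolventAt.unique {ζ : ℂ} {R R' : V →L[ℂ] V} (h : IsResolventAt T ζ R)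
    (h' : IsResolventAt T ζ R') : R = R' := by
  ext w
  have := h'.apply_of_maps (h.maps w)
  rw [add_sub_cancel_right] at this
  exact this.symm

theorem IsResolventAt.opResolvent_eq {ζ : ℂ} {R : V →L[ℂ] V} (h : IsResolventAt T ζ R) :
    opResolvent T ζ = R := by
  have hex : ∃ R : V →L[ℂ] V, IsResolventAt T ζ R := ⟨R, h⟩
  rw [opResolvent, dif_pos hex]
  exact hex.choose_spec.unique h

theorem IsResolventAt.notMem_opSpectrum {ζ : ℂ} {R : V →L[ℂ] V} (h : IsResolventAt T ζ R) :
    ζ ∉ opSpectrum T := fun hn => hn ⟨R, h⟩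

theorem isResolventAt_opResolvent {ζ : ℂ} (h : ζ ∉ opSpectrum T) :
    IsResolventAt T ζ (opResolvent T ζ) := by
  obtain ⟨R, hR⟩ := not_not.1 h
  rwa [hR.opResolvent_eq]

theorem IsResolventAt.sub_eq {ζ ξ : ℂ} {R R' : V →L[ℂ] V} (h : IsResolventAt T ζ R)
    (h' : IsResolventAt T ξ R') : R - R' = (ζ - ξ) • R.comp R' := by
  ext w
  have h1 := h.apply_of_maps (h'.maps w)
  have h2 : w + ξ • R' w - ζ • R' w = w - (ζ - ξ) • R' w := by module
  rw [h2, map_sub, map_smul] at h1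
  simp only [sub_apply, smul_apply, ContinuousLinearMap.comp_apply]
  rw [sub_eq_iff_eq_add] at h1 ⊢
  rw [h1, add_comm]

theorem IsResolventAt.comm {ζ ξ : ℂ} {R R' : V →L[ℂ] V} (h : IsResolventAt T ζ R)
    (h' : IsResolventAt T ξ R') : R.comp R' = R'.comp R := by
  by_cases hne : ζ = ξ
  · subst hne
    rw [h.unique h']
  · have h1 := h.sub_eq h'
    have h2 := h'.sub_eq h
    have h3 : (ζ - ξ) • R.comp R' = (ζ - ξ) • R'.comp R := by
      rw [← h1, ← neg_sub R' R, h2, ← neg_smul, neg_sub]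
    exact smul_right_injective _ (sub_ne_zero.2 hne) h3

/-- The first resolvent identity, used twice: the smallness condition first yields `‖R ξ‖ ≤ 2 ‖R
ζ‖`, which then removes `‖R ξ‖` from the bound. -/
theorem opResolvent_sub_norm_le {ζ ξ : ℂ} (hζ : ζ ∉ opSpectrum T) (hξ : ξ ∉ opSpectrum T)
    (hd : ‖ξ - ζ‖ * ‖opResolvent T ζ‖ ≤ 1 / 2) :
    ‖opResolvent T ξ - opResolvent T ζ‖ ≤ ‖ξ - ζ‖ * (2 * ‖opResolvent T ζ‖ ^ 2) := by
  have h := (isResolventAt_opResolvent hξ).sub_eq (isResolventAt_opResolvent hζ)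
  have h1 : ‖opResolvent T ξ - opResolvent T ζ‖ ≤
      ‖ξ - ζ‖ * (‖opResolvent T ξ‖ * ‖opResolvent T ζ‖) := by
    rw [h, norm_smul]
    exact mul_le_mul_of_nonneg_left (ContinuousLinearMap.opNorm_comp_le _ _) (norm_nonneg _)
  have h2 : ‖opResolvent T ξ‖ ≤ 2 * ‖opResolvent T ζ‖ := by
    have h3 : ‖opResolvent T ξ‖ ≤ ‖opResolvent T ξ - opResolvent T ζ‖ + ‖opResolvent T ζ‖ := by
      simpa using norm_add_le (opResolvent T ξ - opResolvent T ζ) (opResolvent T ζ)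
    nlinarith [norm_nonneg (opResolvent T ξ)]
  refine h1.trans (mul_le_mul_of_nonneg_left ?_ (norm_nonneg _))
  nlinarith [norm_nonneg (opResolvent T ζ)]

theorem continuousOn_opResolvent : ContinuousOn (opResolvent T) (opSpectrum T)ᶜ := by
  intro ζ hζ
  rw [ContinuousWithinAt, tendsto_iff_norm_sub_tendsto_zero]
  have h1 : Filter.Tendsto (fun ξ => ‖ξ - ζ‖ * (2 * ‖opResolvent T ζ‖ ^ 2))
      (𝓝[(opSpectrum T)ᶜ] ζ) (𝓝 0) := by
    have : Continuous fun ξ => ‖ξ - ζ‖ * (2 * ‖opResolvent T ζ‖ ^ 2) := by fun_prop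
    simpa using (this.tendsto ζ).mono_left nhdsWithin_le_nhds
  have h2 : ∀ᶠ ξ in 𝓝[(opSpectrum T)ᶜ] ζ, ‖ξ - ζ‖ * ‖opResolvent T ζ‖ ≤ 1 / 2 := by
    have : Continuous fun ξ => ‖ξ - ζ‖ * ‖opResolvent T ζ‖ := by fun_prop
    have h3 := this.tendsto ζ
    simp only [sub_self, norm_zero, zero_mul] at h3
    exact ((h3.eventually (ge_mem_nhds (by norm_num))).filter_mono nhdsWithin_le_nhds)
  refine squeeze_zero' (Filter.Eventually.of_forall fun _ => norm_nonneg _) ?_ h1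
  filter_upwards [h2, self_mem_nhdsWithin] with ξ h3 h4
  exact opResolvent_sub_norm_le hζ h4 h3

/-- The difference quotient is `R ξ ∘ R ζ` by the resolvent identity. Derivatives are taken within
the resolvent set, so that its openness plays no role. -/
theorem hasDerivWithinAt_opResolvent {ζ : ℂ} (hζ : ζ ∉ opSpectrum T) :
    HasDerivWithinAt (opResolvent T) ((opResolvent T ζ).comp (opResolvent T ζ))
      (opSpectrum T)ᶜ ζ := by
  rw [hasDerivWithinAt_iff_tendsto_slope]
  have h1 : Filter.Tendsto (fun ξ => (opResolvent T ξ).comp (opResolvent T ζ))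
      (𝓝[(opSpectrum T)ᶜ \ {ζ}] ζ) (𝓝 ((opResolvent T ζ).comp (opResolvent T ζ))) := by
    have h2 : Filter.Tendsto (opResolvent T) (𝓝[(opSpectrum T)ᶜ \ {ζ}] ζ) (𝓝 (opResolvent T ζ)) :=
      (continuousOn_opResolvent ζ hζ).mono_left (nhdsWithin_mono _ sdiff_subset)
    exact (((ContinuousLinearMap.compL ℂ V V V).flip (opResolvent T ζ)).continuous.tendsto _).comp h2
  refine h1.congr' ?_
  filter_upwards [self_mem_nhdsWithin] with ξ hξ
  have hne : ξ - ζ ≠ 0 := sub_ne_zero.2 hξ.2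
  rw [slope_def_module, (isResolventAt_opResolvent hξ.1).sub_eq (isResolventAt_opResolvent hζ),
    smul_smul, inv_mul_cancel₀ hne, one_smul]

theorem differentiableOn_opResolvent {U : Set ℂ} (hUT : U ⊆ (opSpectrum T)ᶜ) :
    DifferentiableOn ℂ (opResolvent T) U := fun _ hζ =>
  ((hasDerivWithinAt_opResolvent (hUT hζ)).differentiableWithinAt).mono hUT

end Resolvents

/-! ### Construction of resolvents by density and lower bounds -/

section Construction

variable {V : Type*} [NormedAddCommGroup V] [InnerProductSpace ℂ V]

/-- Let `w` be orthogonal to the range of `A + B`. Then `‖w‖ ≤ ‖A v - w‖ + ‖B v‖` for all `v`, hence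
`(1 - q) ‖w‖ ≤ (1 + q) ‖A v - w‖`, which fails when `A v` is close enough to `w ≠ 0`. -/
theorem denseRange_add {E : Type*} [AddCommGroup E] [Module ℂ E] [CompleteSpace V]
    {A B : E →ₗ[ℂ] V} {q : ℝ} (hq0 : 0 ≤ q) (hq : q < 1) (hAB : ∀ v, ‖B v‖ ≤ q * ‖A v‖) (hA : DenseRange A) :
    DenseRange (A + B) := by
  have h0 : Dense ((LinearMap.range (A + B) : Submodule ℂ V) : Set V) := by
    rw [Submodule.dense_iff_topologicalClosure_eq_top, Submodule.topologicalClosure_eq_top_iff,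
      Submodule.eq_bot_iff]
    intro w hw
    by_contra hne
    have hwpos : 0 < ‖w‖ := norm_pos_iff.2 hne
    have hq' : 0 < 1 - q := by linarith
    obtain ⟨v, hv⟩ := hA.exists_dist_lt w (show 0 < (1 - q) * ‖w‖ / 2 by positivity)
    rw [dist_comm, dist_eq_norm] at hv
    have horth : inner ℂ w ((A + B) v) = 0 :=
      Submodule.inner_left_of_mem_orthogonal (LinearMap.mem_range_self _ v) hw
    have h1 : inner ℂ w w = - inner ℂ w (A v - w) - inner ℂ w (B v) := by
      rw [LinearMap.add_apply, inner_add_right] at horth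
      rw [inner_sub_right]
      linear_combination horth
    have h2 : ‖w‖ ^ 2 ≤ ‖w‖ * ‖A v - w‖ + ‖w‖ * ‖B v‖ := by
      have h3 : ‖inner ℂ w w‖ = ‖w‖ ^ 2 := by
        rw [inner_self_eq_norm_sq_to_K]; simp
      rw [← h3, h1]
      refine (norm_sub_le _ _).trans (add_le_add ?_ (norm_inner_le_norm _ _))
      rw [norm_neg]
      exact norm_inner_le_norm _ _
    have h4 : ‖w‖ ≤ ‖A v - w‖ + ‖B v‖ := by nlinarith
    have h5 : ‖A v‖ ≤ ‖A v - w‖ + ‖w‖ := by simpa using norm_add_le (A v - w) w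
    have h6 := hAB v
    nlinarith [norm_nonneg (A v - w)]
  have h1 : ((LinearMap.range (A + B) : Submodule ℂ V) : Set V) = range (A + B) :=
    LinearMap.coe_range _
  rwa [h1] at h0

/-- A bounded inverse on `V` of a linear map which is bounded below and has dense range. -/
theorem exists_bounded_inverse {E : Type*} [AddCommGroup E] [Module ℂ E] [CompleteSpace V]
    (f : E →ₗ[ℂ] V) (ι : E →ₗ[ℂ] V) (hι : Function.Injective ι) {m : ℝ} (hm : 0 < m)
    (hf : ∀ v, m * ‖ι v‖ ≤ ‖f v‖) (hd : DenseRange f) :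
    ∃ R : V →L[ℂ] V, (∀ v, R (f v) = ι v) ∧
      ∀ m' : ℝ, 0 < m' → (∀ v, m' * ‖ι v‖ ≤ ‖f v‖) → ‖R‖ ≤ 1 / m' := by
  have hinj : Function.Injective f := by
    rw [injective_iff_map_eq_zero]
    intro v hv
    have h := hf v
    rw [hv, norm_zero] at h
    have h2 : ‖ι v‖ ≤ 0 := by nlinarith [norm_nonneg (ι v)]
    exact (map_eq_zero_iff ι hι).1 (norm_le_zero_iff.1 h2)
  let g0 : LinearMap.range f →ₗ[ℂ] V := ι ∘ₗ (LinearEquiv.ofInjective f hinj).symm.toLinearMap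
  have hg0 : ∀ v, g0 ⟨f v, LinearMap.mem_range_self f v⟩ = ι v := by
    intro v
    have : (⟨f v, LinearMap.mem_range_self f v⟩ : LinearMap.range f) =
        LinearEquiv.ofInjective f hinj v := rfl
    simp only [g0, LinearMap.comp_apply, LinearEquiv.coe_coe, this, LinearEquiv.symm_apply_apply]
  let g : LinearMap.range f →L[ℂ] V := g0.mkContinuous (1 / m) (by
    rintro ⟨_, v, rfl⟩
    rw [hg0]
    have := hf v
    rw [Submodule.coe_norm, div_mul_eq_mul_div, one_mul, le_div_iff₀ hm, mul_comm]
    exact this)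
  have hdense : DenseRange (LinearMap.range f).subtypeL := by
    have h1 : range ((LinearMap.range f).subtypeL) = range f := by
      rw [Submodule.coe_subtypeL, Submodule.coe_subtype, Subtype.range_coe]
      exact LinearMap.coe_range _
    rw [DenseRange, h1]
    exact hd
  let R : V →L[ℂ] V := g.extend (LinearMap.range f).subtypeL
  have hR : ∀ v, R (f v) = ι v := by
    intro v
    have := ContinuousLinearMap.extend_eq g hdense
      isUniformEmbedding_subtype_val.isUniformInducing ⟨f v, LinearMap.mem_range_self f v⟩
    exact this.trans (hg0 v)
  refine ⟨R, hR, fun m' hm' h => ?_⟩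
  refine ContinuousLinearMap.opNorm_le_bound _ (by positivity) fun w => ?_
  refine hd.induction_on (p := fun w => ‖R w‖ ≤ 1 / m' * ‖w‖) w
    (isClosed_le R.continuous.norm (continuous_const.mul continuous_norm)) fun v => ?_
  rw [hR, div_mul_eq_mul_div, one_mul, le_div_iff₀ hm', mul_comm]
  exact h v

/-- Existence of the resolvent of the adjoint of `L'`, for a formally adjoint pair `L`, `L'` on `S`
for which `L - ζ` is bounded below on `F` and `L - ζ`, `L' - conj ζ` have dense range on `F`. -/
theorem exists_isResolventAt_adjoint [CompleteSpace V] {S : Submodule ℂ V} (hS : Dense (S : Set V))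
    {L L' : S →ₗ[ℂ] V} (hadj : ∀ u v : S, inner ℂ (L u) (v : V) = inner ℂ (u : V) (L' v))
    (F : Submodule ℂ S) {ζ : ℂ} {m : ℝ} (hm : 0 < m)
    (hbound : ∀ v : S, v ∈ F → m * ‖(v : V)‖ ≤ ‖L v - ζ • (v : V)‖)
    (hd : DenseRange fun v : F => L v - ζ • ((v : S) : V))
    (hd' : DenseRange fun v : F => L' v - conj ζ • ((v : S) : V)) :
    ∃ R : V →L[ℂ] V, IsResolventAt (LinearPMap.mk S L')† ζ R ∧
      (∀ v : S, v ∈ F → R (L v - ζ • (v : V)) = v) ∧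
      ∀ m' : ℝ, 0 < m' → (∀ v : S, v ∈ F → m' * ‖(v : V)‖ ≤ ‖L v - ζ • (v : V)‖) →
        ‖R‖ ≤ 1 / m' := by
  let ι : F →ₗ[ℂ] V := S.subtype ∘ₗ F.subtype
  let f : F →ₗ[ℂ] V := (L ∘ₗ F.subtype) - ζ • ι
  obtain ⟨R, hR, hRn⟩ := exists_bounded_inverse f ι
    (S.injective_subtype.comp F.injective_subtype) hm (fun v => hbound v v.2) hd
  have hS' : Dense ((LinearPMap.mk S L').domain : Set V) := hS
  -- On vectors `L u - ζ u` this is formal adjointness; both sides are continuous, so density of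
  -- these vectors suffices.
  have h1 : ∀ w' : V, Maps (LinearPMap.mk S L')† (R w') (w' + ζ • R w') := by
    intro w'
    refine (maps_adjoint_iff hS').2 fun v => ?_
    change inner ℂ (w' + ζ • R w') ((v : S) : V) = inner ℂ (R w') (L' v)
    refine hd.induction_on
      (p := fun w => inner ℂ (w + ζ • R w) ((v : S) : V) = inner ℂ (R w) (L' v)) w'
      (isClosed_eq (by fun_prop) (by fun_prop)) fun u => ?_
    have h1 : R (L u - ζ • ((u : S) : V)) = ((u : S) : V) := hR u
    rw [h1, sub_add_cancel, hadj]
  have h2 : ∀ u w : V, Maps (LinearPMap.mk S L')† u w → R (w - ζ • u) = u := by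
    intro u w huw
    have h2 := (h1 (w - ζ • u)).sub huw
    have h3 := (maps_adjoint_iff hS').1 h2
    -- Uniqueness: an element of the kernel of the adjoint minus `ζ` is orthogonal to the dense
    -- range of `L' - conj ζ`.
    have h4 : ∀ v : F, inner ℂ (R (w - ζ • u) - u) (L' v - conj ζ • ((v : S) : V)) = 0 := by
      intro v
      have h5 := h3 v
      change inner ℂ (w - ζ • u + ζ • R (w - ζ • u) - w) ((v : S) : V) =
        inner ℂ (R (w - ζ • u) - u) (L' v) at h5
      rw [show w - ζ • u + ζ • R (w - ζ • u) - w = ζ • (R (w - ζ • u) - u) by module,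
        inner_smul_left] at h5
      rw [inner_sub_right, inner_smul_right, ← h5, sub_self]
    have h6 : inner ℂ (R (w - ζ • u) - u) (R (w - ζ • u) - u) = 0 :=
      hd'.induction_on (p := fun z => inner ℂ (R (w - ζ • u) - u) z = 0) _
        (isClosed_eq (by fun_prop) continuous_const) h4
    exact sub_eq_zero.1 (inner_self_eq_zero.1 h6)
  exact ⟨R, isResolventAt_iff.2 ⟨h1, h2⟩, fun v hv => hR ⟨v, hv⟩,
    fun m' hm' h => hRn m' hm' fun v => h v v.2⟩

end Construction

end KineticBM

/-! ### The Hille–Yosida theorem -/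

namespace KineticBM

section HilleYosida

open Set Filter

variable {V : Type*} [NormedAddCommGroup V] [InnerProductSpace ℂ V] [CompleteSpace V]

theorem hasDerivAt_exp_smul_apply (B : V →L[ℂ] V) (u : V) (t : ℝ) :
    HasDerivAt (fun t : ℝ => NormedSpace.exp (t • B) u) (NormedSpace.exp (t • B) (B u)) t := by
  have h := hasDerivAt_exp_smul_const (𝕂 := ℝ) B t
  exact ((ContinuousLinearMap.apply ℂ V u).restrictScalars ℝ).hasFDerivAt.comp_hasDerivAt t h

theorem exp_smul_apply_comm {B C : V →L[ℂ] V} (h : Commute B C) (t : ℝ) (u : V) :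
    NormedSpace.exp (t • B) (C u) = C (NormedSpace.exp (t • B) u) := by
  have h1 : Commute (NormedSpace.exp (t • B)) C := (((h.symm).smul_right t).exp_right).symm
  exact DFunLike.congr_fun h1.eq u

theorem norm_exp_smul_apply_le {B : V →L[ℂ] V} (hB : ∀ v, (inner ℂ v (B v)).re ≤ 0) {t : ℝ}
    (ht : 0 ≤ t) (u : V) : ‖NormedSpace.exp (t • B) u‖ ≤ ‖u‖ := by
  have hd : ∀ t : ℝ, HasDerivAt (fun t : ℝ => ‖NormedSpace.exp (t • B) u‖ ^ 2)
      (2 * (inner ℂ (NormedSpace.exp (t • B) u) (B (NormedSpace.exp (t • B) u))).re) t := by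
    intro t
    have h := (hasDerivAt_exp_smul_apply B u t)
    rw [exp_smul_apply_comm (Commute.refl B)] at h
    let _ : InnerProductSpace ℝ V := InnerProductSpace.complexToReal
    have h2 := h.norm_sq
    exact h2
  have hanti : AntitoneOn (fun t : ℝ => ‖NormedSpace.exp (t • B) u‖ ^ 2) (Ici 0) := by
    refine antitoneOn_of_deriv_nonpos (convex_Ici 0)
      (fun t _ => (hd t).continuousAt.continuousWithinAt)
      (fun t _ => (hd t).differentiableAt.differentiableWithinAt) fun t _ => ?_
    rw [(hd t).deriv]
    linarith [hB (NormedSpace.exp (t • B) u)]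
  have h := hanti (mem_Ici.2 le_rfl) (mem_Ici.2 ht) ht
  simp only [zero_smul, NormedSpace.exp_zero, one_apply_eq_self] at h
  exact (sq_le_sq₀ (norm_nonneg _) (norm_nonneg _)).1 h

/-- Differentiate `s ↦ exp(sB) exp((t - s)C) u` between `0` and `t`; both exponentials are
contractions. -/
theorem norm_exp_smul_sub_le {B C : V →L[ℂ] V} (hBC : Commute B C)
    (hB : ∀ v, (inner ℂ v (B v)).re ≤ 0) (hC : ∀ v, (inner ℂ v (C v)).re ≤ 0) {t : ℝ}
    (ht : 0 ≤ t) (u : V) :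
    ‖NormedSpace.exp (t • B) u - NormedSpace.exp (t • C) u‖ ≤ t * ‖B u - C u‖ := by
  have hd : ∀ s : ℝ, HasDerivAt
      (fun s : ℝ => NormedSpace.exp (s • B) (NormedSpace.exp ((t - s) • C) u))
      (NormedSpace.exp (s • B) (NormedSpace.exp ((t - s) • C) (B u - C u))) s := by
    intro s
    have h1 := hasDerivAt_exp_smul_const (𝕂 := ℝ) B s
    have h2 : HasDerivAt (fun s : ℝ => NormedSpace.exp ((t - s) • C) u)
        (-(NormedSpace.exp ((t - s) • C) (C u))) s := by
      have := (hasDerivAt_exp_smul_apply C u (t - s)).scomp s ((hasDerivAt_id s).const_sub t)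
      simpa [Function.comp_def] using this
    have h3 := (((ContinuousLinearMap.restrictScalarsL ℂ V V ℝ ℝ) : _ →L[ℝ]
      _).hasFDerivAt.comp_hasDerivAt s h1).clm_apply h2
    refine h3.congr_deriv ?_
    change NormedSpace.exp (s • B) (B (NormedSpace.exp ((t - s) • C) u)) +
      NormedSpace.exp (s • B) (-(NormedSpace.exp ((t - s) • C) (C u))) = _
    rw [← map_add, map_sub]
    rw [exp_smul_apply_comm hBC.symm, ← sub_eq_add_neg]
  have h := norm_image_sub_le_of_norm_deriv_le_segment' (a := 0) (b := t) (C := ‖B u - C u‖)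
    (fun s _ => (hd s).hasDerivWithinAt) (fun s hs => by
      refine (norm_exp_smul_apply_le hB hs.1 _).trans (norm_exp_smul_apply_le hC ?_ _)
      linarith [hs.2]) t ⟨ht, le_rfl⟩
  simp only [sub_self, zero_smul, NormedSpace.exp_zero, one_apply_eq_self, sub_zero] at h
  linarith

omit [CompleteSpace V] in
theorem cauchySeq_of_dense {A : ℕ → V →L[ℂ] V} (hA : ∀ n u, ‖A n u‖ ≤ ‖u‖) {D : Set V}
    (hD : Dense D) (h : ∀ u ∈ D, CauchySeq fun n => A n u) (u : V) : CauchySeq fun n => A n u := by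
  rw [Metric.cauchySeq_iff']
  intro ε hε
  obtain ⟨u', hu', hd⟩ := hD.exists_dist_lt u (show 0 < ε / 3 by positivity)
  obtain ⟨N, hN⟩ := Metric.cauchySeq_iff'.1 (h u' hu') (ε / 3) (by positivity)
  have h1 : ∀ n, dist (A n u) (A n u') ≤ dist u u' := fun n => by
    rw [dist_eq_norm, ← map_sub, dist_eq_norm]
    exact hA n _
  refine ⟨N, fun n hn => ?_⟩
  have h2 := dist_triangle4 (A n u) (A n u') (A N u') (A N u)
  have h3 := h1 N
  rw [dist_comm (A N u)] at h3
  linarith [hN n hn, h1 n]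

/-- The Hille–Yosida theorem on a Hilbert space: `-T` generates a contraction semigroup if `T` is
densely defined and `‖(T + a)⁻¹‖ ≤ 1 / a` for `a ≥ 1`. -/
theorem exists_isContractionSemigroup {T : V →ₗ.[ℂ] V} (hT : Dense (T.domain : Set V))
    (hres : ∀ a : ℝ, 1 ≤ a → ∃ R : V →L[ℂ] V, IsResolventAt T (-(a : ℂ)) R ∧ ‖R‖ ≤ 1 / a) :
    ∃ S, IsContractionSemigroup T S := by
  let a : ℕ → ℝ := fun n => n + 1
  have ha : ∀ n, 0 < a n := fun n => by positivity
  have hat : Tendsto a atTop atTop := tendsto_atTop_add_const_right _ _ tendsto_natCast_atTop_atTop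
  have ha1 : ∀ n, 1 ≤ a n := fun n => le_add_of_nonneg_left (Nat.cast_nonneg n)
  choose R hR hRn using fun n => hres (a n) (ha1 n)
  have hRle : ∀ n v, ‖R n v‖ ≤ 1 / a n * ‖v‖ := fun n v =>
    ((R n).le_opNorm v).trans (mul_le_mul_of_nonneg_right (hRn n) (norm_nonneg v))
  -- The Yosida approximations of `-T`: bounded, dissipative, commuting, and convergent to `-T` on
  -- its domain.
  let B : ℕ → V →L[ℂ] V := fun n => ((a n : ℂ) ^ 2) • R n - (a n : ℂ) • (1 : V →L[ℂ] V)
  have hBapp : ∀ n v, B n v = ((a n : ℂ) ^ 2) • R n v - (a n : ℂ) • v := fun n v => rfl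
  have hBcomm : ∀ n m, Commute (B n) (B m) := by
    intro n m
    have h : Commute (R n) (R m) := (hR n).comm (hR m)
    exact (((h.smul_left _).smul_right _).sub_right (((Commute.one_right _).smul_right _))).sub_left
      ((Commute.one_left _).smul_left _)
  have hBdiss : ∀ n v, (inner ℂ v (B n v)).re ≤ 0 := by
    intro n v
    rw [hBapp, inner_sub_right, inner_smul_right, inner_smul_right, inner_self_eq_norm_sq_to_K]
    have h1 : (inner ℂ v (R n v)).re ≤ 1 / a n * ‖v‖ ^ 2 := by
      refine (Complex.re_le_norm _).trans ((norm_inner_le_norm _ _).trans ?_)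
      have := mul_le_mul_of_nonneg_left (hRle n v) (norm_nonneg v)
      linarith
    have h2 : (((a n : ℂ) ^ 2) * inner ℂ v (R n v) - (a n : ℂ) * ((‖v‖ : ℝ) : ℂ) ^ 2).re =
        a n ^ 2 * (inner ℂ v (R n v)).re - a n * ‖v‖ ^ 2 := by
      rw [Complex.sub_re, ← Complex.ofReal_pow, ← Complex.ofReal_pow, Complex.re_ofReal_mul,
        Complex.re_ofReal_mul, Complex.ofReal_re]
    have h3 : a n ^ 2 * (1 / a n * ‖v‖ ^ 2) = a n * ‖v‖ ^ 2 := by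
      have := (ha n).ne'
      field_simp
    refine h2.le.trans ?_
    nlinarith [mul_le_mul_of_nonneg_left h1 (sq_nonneg (a n))]
  have hBmaps : ∀ n u w, Maps T u w → B n u = -((a n : ℂ) • R n w) := by
    intro n u w h
    have h1 := (hR n).apply_of_maps h
    rw [neg_smul, sub_neg_eq_add, map_add, map_smul] at h1
    rw [hBapp, eq_sub_of_add_eq h1]
    module
  have hBle : ∀ n u w, Maps T u w → ‖B n u‖ ≤ ‖w‖ := by
    intro n u w h
    rw [hBmaps n u w h, norm_neg, norm_smul, Complex.norm_real, Real.norm_of_nonneg (ha n).le]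
    have := mul_le_mul_of_nonneg_left (hRle n w) (ha n).le
    have h3 : a n * (1 / a n * ‖w‖) = ‖w‖ := by
      have := (ha n).ne'
      field_simp
    linarith
  -- On the domain `a R w' - w' = -R (T w')` has norm at most `‖T w'‖ / a`; the operators `a R` are
  -- contractions, so density gives all `w`.
  have hJ : ∀ w, Tendsto (fun n => (a n : ℂ) • R n w) atTop (𝓝 w) := by
    intro w
    rw [Metric.tendsto_atTop]
    intro ε hε
    obtain ⟨w', hw', hd⟩ := hT.exists_dist_lt w (show 0 < ε / 3 by positivity)
    set z := T ⟨w', hw'⟩ with hz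
    have hmaps : Maps T w' z := ⟨hw', rfl⟩
    have h1 : Tendsto (fun n => 1 / a n * ‖z‖) atTop (𝓝 0) := by
      have := (tendsto_inv_atTop_zero.comp hat).mul_const ‖z‖
      simpa using this
    obtain ⟨N, hN⟩ := (h1.eventually (gt_mem_nhds (show 0 < ε / 3 by positivity))).exists_forall_of_atTop
    refine ⟨N, fun n hn => ?_⟩
    have h2 : (a n : ℂ) • R n w' - w' = - R n z := by
      have h3 := (hR n).apply_of_maps hmaps
      rw [neg_smul, sub_neg_eq_add, map_add, map_smul] at h3
      nth_rewrite 2 [← h3]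
      abel
    have h4 : ‖(a n : ℂ) • R n (w - w')‖ ≤ ‖w - w'‖ := by
      rw [norm_smul, Complex.norm_real, Real.norm_of_nonneg (ha n).le]
      have := mul_le_mul_of_nonneg_left (hRle n (w - w')) (ha n).le
      have h3 : a n * (1 / a n * ‖w - w'‖) = ‖w - w'‖ := by
        have := (ha n).ne'
        field_simp
      linarith
    have h5 : (a n : ℂ) • R n w - w =
        (a n : ℂ) • R n (w - w') + ((a n : ℂ) • R n w' - w') - (w - w') := by
      rw [map_sub, smul_sub]; abel
    rw [dist_eq_norm] at hd ⊢
    rw [h5, h2]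
    have h6 : ‖-R n z‖ < ε / 3 := by
      rw [norm_neg]
      exact (hRle n z).trans_lt (hN n hn)
    have h7 := norm_sub_le ((a n : ℂ) • R n (w - w') + -R n z) (w - w')
    have h8 := norm_add_le ((a n : ℂ) • R n (w - w')) (-R n z)
    linarith
  have hBt : ∀ u w, Maps T u w → Tendsto (fun n => B n u) atTop (𝓝 (-w)) := by
    intro u w h
    simp only [hBmaps _ u w h]
    exact (hJ w).neg
  let E : ℕ → ℝ → V →L[ℂ] V := fun n t => NormedSpace.exp (t • B n)
  have hEle : ∀ n t, 0 ≤ t → ∀ u, ‖E n t u‖ ≤ ‖u‖ := fun n t ht u =>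
    norm_exp_smul_apply_le (hBdiss n) ht u
  have hElip : ∀ n s t, 0 ≤ s → s ≤ t → ∀ u w, Maps T u w → ‖E n t u - E n s u‖ ≤ (t - s) * ‖w‖ := by
    intro n s t hs hst u w h
    have := norm_image_sub_le_of_norm_deriv_le_segment' (a := s) (b := t) (C := ‖w‖)
      (f := fun t => E n t u)
      (fun r _ => (hasDerivAt_exp_smul_apply (B n) u r).hasDerivWithinAt) (fun r hr =>
        (norm_exp_smul_apply_le (hBdiss n) (hs.trans hr.1) _).trans (hBle n u w h)) t ⟨hst, le_rfl⟩
    linarith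
  have hEadd : ∀ n s t, E n (s + t) = (E n s).comp (E n t) := by
    intro n s t
    let _ : NormedAlgebra ℚ (V →L[ℂ] V) := NormedAlgebra.restrictScalars ℚ ℝ _
    change NormedSpace.exp ((s + t) • B n) = NormedSpace.exp (s • B n) * NormedSpace.exp (t • B n)
    rw [add_smul, NormedSpace.exp_add_of_commute (((Commute.refl (B n)).smul_left s).smul_right t)]
  have hlim : ∀ t : ℝ, 0 ≤ t → ∀ u, ∃ v, Tendsto (fun n => E n t u) atTop (𝓝 v) := by
    intro t ht u
    refine cauchySeq_tendsto_of_complete (cauchySeq_of_dense (fun n => hEle n t ht) hT ?_ u)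
    intro u hu
    have hc := (hBt u _ ⟨hu, rfl⟩).cauchySeq
    rw [Metric.cauchySeq_iff] at hc ⊢
    intro ε hε
    obtain ⟨N, hN⟩ := hc (ε / (t + 1)) (by positivity)
    refine ⟨N, fun m hm n hn => ?_⟩
    have h1 := norm_exp_smul_sub_le (hBcomm m n) (hBdiss m) (hBdiss n) ht u
    have h2 := hN m hm n hn
    rw [dist_eq_norm, lt_div_iff₀ (by positivity)] at h2
    rw [dist_eq_norm]
    refine h1.trans_lt ?_
    nlinarith [norm_nonneg (B m u - B n u)]
  choose! Slim hSlim using hlim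
  have hSle : ∀ t, 0 ≤ t → ∀ u, ‖Slim t u‖ ≤ ‖u‖ := fun t ht u =>
    le_of_tendsto (hSlim t ht u).norm (Eventually.of_forall fun n => hEle n t ht u)
  -- For negative `t` the value at time `0` is taken.
  let S : ℝ → V →L[ℂ] V := fun t => LinearMap.mkContinuous
    { toFun := fun u => Slim (max t 0) u
      map_add' := fun u v => tendsto_nhds_unique (hSlim _ (le_max_right _ _) (u + v)) (by
        simpa only [map_add] using
          (hSlim _ (le_max_right _ _) u).add (hSlim _ (le_max_right _ _) v))
      map_smul' := fun c u => tendsto_nhds_unique (hSlim _ (le_max_right _ _) (c • u)) (by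
        simpa only [map_smul, RingHom.id_apply] using (hSlim _ (le_max_right _ _) u).const_smul c) } 1
    (fun u => by rw [one_mul]; exact hSle _ (le_max_right _ _) u)
  have hS : ∀ t, 0 ≤ t → ∀ u, Tendsto (fun n => E n t u) atTop (𝓝 (S t u)) := by
    intro t ht u
    have := hSlim t ht u
    have h2 : S t u = Slim (max t 0) u := rfl
    rwa [h2, max_eq_left ht]
  have hSle' : ∀ t, 0 ≤ t → ∀ u, ‖S t u‖ ≤ ‖u‖ := fun t ht u =>
    le_of_tendsto (hS t ht u).norm (Eventually.of_forall fun n => hEle n t ht u)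
  have hSlip : ∀ s t, 0 ≤ s → s ≤ t → ∀ u w, Maps T u w → ‖S t u - S s u‖ ≤ (t - s) * ‖w‖ :=
    fun s t hs hst u w h => le_of_tendsto ((hS t (hs.trans hst) u).sub (hS s hs u)).norm
      (Eventually.of_forall fun n => hElip n s t hs hst u w h)
  have hS0 : S 0 = 1 := by
    ext u
    refine tendsto_nhds_unique (hS 0 le_rfl u) ?_
    simp only [E, zero_smul, NormedSpace.exp_zero]
    exact tendsto_const_nhds
  have hgen : ∀ u w, Maps T u w →
      Tendsto (fun t : ℝ => ((t⁻¹ : ℝ) : ℂ) • (S t u - u)) (𝓝[>] 0) (𝓝 (-w)) := by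
    intro u w huw
    rw [Metric.tendsto_nhds]
    intro ε hε
    obtain ⟨w', hw', hd⟩ := hT.exists_dist_lt w (show 0 < ε / 4 by positivity)
    set z := T ⟨w', hw'⟩ with hz
    have hmaps : Maps T w' z := ⟨hw', rfl⟩
    rw [dist_eq_norm] at hd
    have hδ : 0 < ε / (4 * (‖z‖ + 1)) := by positivity
    filter_upwards [Ioo_mem_nhdsGT hδ] with t ht
    have ht0 : 0 < t := ht.1
    -- Mean value inequality for `r ↦ E n r u + r w`. As `w` need not lie in the domain, it is
    -- replaced by a nearby `w'` that does, for which `E n r w' - w'` is of size `r ‖z‖`.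
    have h1 : ∀ n, ‖E n t u - u + t • w‖ ≤ (‖B n u + w‖ + (2 * ‖w - w'‖ + t * ‖z‖)) * t := by
      intro n
      have := norm_image_sub_le_of_norm_deriv_le_segment' (a := 0) (b := t)
        (C := ‖B n u + w‖ + (2 * ‖w - w'‖ + t * ‖z‖))
        (f := fun t => E n t u + t • w) (f' := fun r => E n r (B n u) + w)
        (fun r _ => by
          have := (hasDerivAt_exp_smul_apply (B n) u r).add ((hasDerivAt_id r).smul_const w)
          rw [one_smul] at this
          exact this.hasDerivWithinAt) (fun r hr => by
          have e1 : E n r (B n u) + w = E n r (B n u + w) - (E n r (w - w') +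
              (E n r w' - E n 0 w') - (w - w')) := by
            have : E n 0 w' = w' := by simp [E]
            rw [this, map_add, map_sub]; abel
          rw [e1]
          have e2 := hElip n 0 r le_rfl hr.1 w' z hmaps
          have e3 := hEle n r hr.1 (B n u + w)
          have e4 := hEle n r hr.1 (w - w')
          have e5 := norm_sub_le (E n r (B n u + w)) (E n r (w - w') +
              (E n r w' - E n 0 w') - (w - w'))
          have e6 := norm_sub_le (E n r (w - w') + (E n r w' - E n 0 w')) (w - w')
          have e7 := norm_add_le (E n r (w - w')) (E n r w' - E n 0 w')
          have e8 : (r - 0) * ‖z‖ ≤ t * ‖z‖ :=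
            mul_le_mul_of_nonneg_right (by linarith [hr.2]) (norm_nonneg z)
          linarith) t ⟨ht0.le, le_rfl⟩
      have e0 : E n 0 u = u := by simp [E]
      simp only [e0, zero_smul, add_zero, sub_zero] at this
      rwa [show E n t u - u + t • w = E n t u + t • w - u by abel]
    have h2 : ‖S t u - u + t • w‖ ≤ (0 + (2 * ‖w - w'‖ + t * ‖z‖)) * t := by
      refine le_of_tendsto_of_tendsto' (((hS t ht0.le u).sub_const u).add_const (t • w)).norm ?_ h1
      refine Tendsto.mul_const _ (Tendsto.add_const _ ?_)
      have := ((hBt u w huw).add_const w).norm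
      simpa using this
    rw [dist_eq_norm]
    have h3 : ((t⁻¹ : ℝ) : ℂ) • (S t u - u) - -w = ((t⁻¹ : ℝ) : ℂ) • (S t u - u + t • w) := by
      rw [smul_add, Complex.coe_smul, Complex.coe_smul, smul_smul, inv_mul_cancel₀ ht0.ne', one_smul,
        sub_neg_eq_add]
    rw [h3, norm_smul, Complex.norm_real, norm_inv, Real.norm_of_nonneg ht0.le,
      inv_mul_lt_iff₀ ht0]
    refine h2.trans_lt ?_
    have h4 : t * ‖z‖ < ε / 4 := by
      have := ht.2
      rw [lt_div_iff₀ (by positivity)] at this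
      nlinarith [norm_nonneg z]
    nlinarith
  refine ⟨S, hS0, ?_, ?_, ?_, ?_⟩
  · intro s t hs ht
    ext u
    refine tendsto_nhds_unique (hS (s + t) (add_nonneg hs ht) u) ?_
    have h1 : Tendsto (fun n => E n s (E n t u - S t u)) atTop (𝓝 0) := by
      refine squeeze_zero_norm (fun n => hEle n s hs _) ?_
      have := ((hS t ht u).sub_const (S t u)).norm
      simpa using this
    have h2 := h1.add (hS s hs (S t u))
    rw [zero_add] at h2
    refine h2.congr fun n => ?_
    rw [hEadd, map_sub, sub_add_cancel]
    rfl
  · intro t ht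
    exact ContinuousLinearMap.opNorm_le_bound _ zero_le_one fun u => by
      rw [one_mul]; exact hSle' t ht u
  · intro u
    refine continuousOn_of_uniform_approx_of_continuousOn fun U hU => ?_
    obtain ⟨ε, hε, hεU⟩ := Metric.mem_uniformity_dist.1 hU
    obtain ⟨u', hu', hd⟩ := hT.exists_dist_lt u hε
    have hmaps : Maps T u' (T ⟨u', hu'⟩) := ⟨hu', rfl⟩
    refine ⟨fun t => S t u', ?_, fun t ht => hεU ?_⟩
    · have hL : LipschitzOnWith (Real.toNNReal ‖T ⟨u', hu'⟩‖) (fun t => S t u') (Ici 0) := by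
        refine LipschitzOnWith.of_dist_le_mul fun s hs t ht => ?_
        rw [Real.coe_toNNReal _ (norm_nonneg _), dist_eq_norm, Real.dist_eq]
        rcases le_total s t with h | h
        · rw [norm_sub_rev, abs_sub_comm, abs_of_nonneg (sub_nonneg.2 h), mul_comm]
          exact hSlip s t hs h _ _ hmaps
        · rw [abs_of_nonneg (sub_nonneg.2 h), mul_comm]
          exact hSlip t s ht h _ _ hmaps
      exact hL.continuousOn
    · rw [dist_eq_norm, ← map_sub]
      rw [dist_eq_norm] at hd
      exact (hSle' t ht _).trans_lt hd
  · intro u w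
    -- Conversely, let `v = (T + 1)⁻¹ (w + u)`. The difference quotients of the semigroup at `u - v`
    -- tend to `u - v` itself, and contractivity makes its inner product with this limit
    -- nonpositive; so `u = v`.
    refine ⟨fun h => ?_, hgen u w⟩
    obtain ⟨R₁, hR₁, -⟩ := hres 1 le_rfl
    set v := R₁ (w + u) with hv
    have hvm : Maps T v (w + u - v) := by
      have := hR₁.maps (w + u)
      rw [← hv] at this
      simpa [sub_eq_add_neg] using this
    have h1 := h.sub (hgen v _ hvm)
    have h2 : Tendsto (fun t : ℝ => ((t⁻¹ : ℝ) : ℂ) • (S t (u - v) - (u - v))) (𝓝[>] 0)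
        (𝓝 (u - v)) := by
      have e1 : -w - -(w + u - v) = u - v := by abel
      rw [e1] at h1
      refine h1.congr fun t => ?_
      rw [← smul_sub, map_sub]
      congr 1
      abel
    have h3 : ‖u - v‖ ^ 2 ≤ 0 := by
      have h4 : Tendsto (fun t : ℝ => (inner ℂ (u - v)
          (((t⁻¹ : ℝ) : ℂ) • (S t (u - v) - (u - v)))).re) (𝓝[>] 0)
          (𝓝 ((inner ℂ (u - v) (u - v)).re)) :=
        (Complex.continuous_re.tendsto _).comp (tendsto_const_nhds.inner h2)
      have h5 : (inner ℂ (u - v) (u - v)).re = ‖u - v‖ ^ 2 := by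
        rw [inner_self_eq_norm_sq_to_K]
        change ((‖u - v‖ : ℂ) ^ 2).re = _
        rw [← Complex.ofReal_pow, Complex.ofReal_re]
      rw [h5] at h4
      refine le_of_tendsto h4 ?_
      filter_upwards [self_mem_nhdsWithin] with t ht
      have ht : 0 < t := ht
      rw [inner_smul_right, Complex.re_ofReal_mul, inner_sub_right, Complex.sub_re, h5]
      refine mul_nonpos_of_nonneg_of_nonpos (inv_nonneg.2 ht.le) ?_
      have h6 : (inner ℂ (u - v) (S t (u - v))).re ≤ ‖u - v‖ * ‖u - v‖ :=
        (Complex.re_le_norm _).trans ((norm_inner_le_norm _ _).trans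
          (mul_le_mul_of_nonneg_left (hSle' t ht.le _) (norm_nonneg _)))
      nlinarith
    have h4 : u - v = 0 := by
      have : ‖u - v‖ = 0 := by nlinarith [norm_nonneg (u - v)]
      exact norm_eq_zero.1 this
    have h5 : u = v := sub_eq_zero.1 h4
    have h6 : w + u - v = w := by rw [← h5]; abel
    rw [h6, ← h5] at hvm
    exact hvm

omit [CompleteSpace V] in
theorem isContractionSemigroup_expNeg {T : V →ₗ.[ℂ] V} (h : ∃ S, IsContractionSemigroup T S) :
    IsContractionSemigroup T (expNeg T) := by
  rw [expNeg, dif_pos h]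
  exact h.choose_spec

end HilleYosida

end KineticBM

/-! ### Contour shifts and Laplace inversion -/

namespace KineticBM

section Inversion

open Set Filter MeasureTheory

/-- Cauchy's theorem on rectangles of height `2r`; the decay makes the horizontal sides disappear as
`r → ∞`. -/
theorem integral_vertical_eq_of_strip {E : Type*} [NormedAddCommGroup E] [NormedSpace ℂ E]
    [CompleteSpace E] {f : ℂ → E} {a b : ℝ} (hab : a ≤ b)
    (hc : ContinuousOn f {z | a ≤ z.re ∧ z.re ≤ b})
    (hd : DifferentiableOn ℂ f {z | a < z.re ∧ z.re < b})
    {φ : ℝ → ℝ} (hφ : Tendsto φ atTop (𝓝 0))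
    (hdecay : ∀ᶠ r in atTop, ∀ z : ℂ, a ≤ z.re → z.re ≤ b → |z.im| = r → ‖f z‖ ≤ φ r)
    (ha : Integrable fun y : ℝ => f (a + y * Complex.I))
    (hb : Integrable fun y : ℝ => f (b + y * Complex.I)) :
    ∫ y : ℝ, f (a + y * Complex.I) = ∫ y : ℝ, f (b + y * Complex.I) := by
  have hrect : ∀ r : ℝ, Complex.I • (∫ y in (-r)..r, f (b + y * Complex.I)) -
      Complex.I • (∫ y in (-r)..r, f (a + y * Complex.I)) =
      (∫ x in a..b, f (x + r * Complex.I)) - ∫ x in a..b, f (x + (-r : ℝ) * Complex.I) := by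
    intro r
    have h := Complex.integral_boundary_rect_eq_zero_of_continuousOn_of_differentiableOn f
      (⟨a, -r⟩ : ℂ) (⟨b, r⟩ : ℂ) (hc.mono fun z hz => by
        have := hz.1
        simp only [mem_preimage, uIcc_of_le hab] at this
        exact this) (hd.mono fun z hz => by
        have := hz.1
        simp only [mem_preimage, min_eq_left hab, max_eq_right hab] at this
        exact this)
    simp only at h
    rw [← sub_eq_zero, ← h]
    abel
  have hzero : Tendsto (fun r : ℝ => (∫ x in a..b, f (x + r * Complex.I)) -
      ∫ x in a..b, f (x + (-r : ℝ) * Complex.I)) atTop (𝓝 0) := by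
    have h1 : Tendsto (fun r => φ r * |b - a| + φ r * |b - a|) atTop (𝓝 0) := by
      simpa using (hφ.mul_const |b - a|).add (hφ.mul_const |b - a|)
    refine squeeze_zero_norm' ?_ h1
    filter_upwards [hdecay, eventually_ge_atTop 0] with r hr hr0
    refine (norm_sub_le _ _).trans (add_le_add ?_ ?_)
    · refine intervalIntegral.norm_integral_le_of_norm_le_const fun x hx => ?_
      rw [uIoc_of_le hab] at hx
      exact hr _ (by simpa using hx.1.le) (by simpa using hx.2) (by simpa using hr0)
    · refine intervalIntegral.norm_integral_le_of_norm_le_const fun x hx => ?_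
      rw [uIoc_of_le hab] at hx
      exact hr _ (by simpa using hx.1.le) (by simpa using hx.2) (by simpa using hr0)
  have hlim := ((intervalIntegral_tendsto_integral hb tendsto_neg_atTop_atBot tendsto_id).const_smul
    Complex.I).sub ((intervalIntegral_tendsto_integral ha tendsto_neg_atTop_atBot
      tendsto_id).const_smul Complex.I)
  have h2 := tendsto_nhds_unique hlim (hzero.congr fun r => (hrect r).symm)
  rw [← smul_sub] at h2
  exact (sub_eq_zero.1 ((smul_eq_zero.1 h2).resolve_left Complex.I_ne_zero)).symm

theorem integrable_inv_sq_add_sq {δ : ℝ} (hδ : 0 < δ) : Integrable fun y : ℝ => (δ ^ 2 + y ^ 2)⁻¹ := by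
  have h := (integrable_inv_one_add_sq.comp_mul_left' (inv_ne_zero hδ.ne')).const_mul ((δ ^ 2)⁻¹)
  refine h.congr (Eventually.of_forall fun y => ?_)
  have : δ ≠ 0 := hδ.ne'
  simp only
  rw [← mul_inv]
  congr 1
  field_simp

theorem integral_inv_sq_add_sq {δ : ℝ} (hδ : 0 < δ) :
    ∫ y : ℝ, (δ ^ 2 + y ^ 2)⁻¹ = Real.pi / δ := by
  have h : (fun y : ℝ => (δ ^ 2 + y ^ 2)⁻¹) = fun y => (δ ^ 2)⁻¹ * (1 + (δ⁻¹ * y) ^ 2)⁻¹ := by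
    funext y
    have : δ ≠ 0 := hδ.ne'
    rw [← mul_inv]
    congr 1
    field_simp
  rw [h, integral_const_mul, Measure.integral_comp_mul_left (fun y : ℝ => (1 + y ^ 2)⁻¹),
    integral_univ_inv_one_add_sq, inv_inv, abs_of_pos hδ, smul_eq_mul]
  field_simp

theorem norm_sq_line (c y : ℝ) : ‖(c : ℂ) + y * Complex.I‖ ^ 2 = c ^ 2 + y ^ 2 := by
  rw [Complex.sq_norm, Complex.normSq_add_mul_I]

/-- `∫ e^{-ζt} (ζ - μ)^{-2} dζ` over a vertical line to the right of `μ` vanishes for `t > 0`. -/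
theorem integral_exp_mul_inv_sq_eq_zero {μ : ℂ} {c t : ℝ} (hμ : μ.re < c) (ht : 0 < t) :
    Integrable (fun y : ℝ => Complex.exp (-((c : ℂ) + y * Complex.I) * t) *
      (((c : ℂ) + y * Complex.I - μ) ^ 2)⁻¹) ∧
    ∫ y : ℝ, Complex.exp (-((c : ℂ) + y * Complex.I) * t) *
      (((c : ℂ) + y * Complex.I - μ) ^ 2)⁻¹ = 0 := by
  let f : ℂ → ℂ := fun z => Complex.exp (-z * t) * ((z - μ) ^ 2)⁻¹
  set δ := c - μ.re with hδ
  have hδ0 : 0 < δ := by linarith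
  have hne : ∀ z : ℂ, c ≤ z.re → z - μ ≠ 0 := by
    intro z hz h0
    have := congrArg Complex.re h0
    simp only [Complex.sub_re, Complex.zero_re] at this
    linarith
  have hnorm : ∀ z : ℂ, c ≤ z.re → ‖f z‖ ≤ Real.exp (-z.re * t) * (δ ^ 2 + (z.im - μ.im) ^ 2)⁻¹ := by
    intro z hz
    simp only [f]
    rw [norm_mul, Complex.norm_exp, norm_inv, norm_pow, Complex.sq_norm, Complex.normSq_apply]
    have h1 : (-z * (t : ℂ)).re = -z.re * t := by simp
    rw [h1]
    refine mul_le_mul_of_nonneg_left (inv_anti₀ (by positivity) ?_) (Real.exp_pos _).le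
    simp only [Complex.sub_re, Complex.sub_im]
    nlinarith
  have hg : Integrable fun y : ℝ => (δ ^ 2 + (y - μ.im) ^ 2)⁻¹ :=
    (integrable_inv_sq_add_sq hδ0).comp_sub_right μ.im
  have hline : ∀ b : ℝ, c ≤ b → ∀ y : ℝ, ‖f (b + y * Complex.I)‖ ≤
      Real.exp (-b * t) * (δ ^ 2 + (y - μ.im) ^ 2)⁻¹ := fun b hb y => by
    simpa using hnorm (b + y * Complex.I) (by simpa using hb)
  have hcont : ∀ b : ℝ, c ≤ b → Continuous fun y : ℝ => f (b + y * Complex.I) := by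
    intro b hb
    refine Continuous.mul (by fun_prop) (Continuous.inv₀ (by fun_prop) fun y => ?_)
    exact pow_ne_zero 2 (hne _ (by simpa using hb))
  have hint : ∀ b : ℝ, c ≤ b → Integrable fun y : ℝ => f (b + y * Complex.I) := fun b hb =>
    (hg.const_mul _).mono' (hcont b hb).aestronglyMeasurable (Eventually.of_forall (hline b hb))
  have hdiff : ∀ z : ℂ, c ≤ z.re → DifferentiableAt ℂ f z := by
    intro z hz
    refine DifferentiableAt.mul (by fun_prop) (DifferentiableAt.inv (by fun_prop) ?_)
    exact pow_ne_zero 2 (hne z hz)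
  have hshift : ∀ b : ℝ, c ≤ b →
      ∫ y : ℝ, f (c + y * Complex.I) = ∫ y : ℝ, f (b + y * Complex.I) := by
    intro b hb
    refine integral_vertical_eq_of_strip hb
      (fun z hz => (hdiff z hz.1).continuousAt.continuousWithinAt)
      (fun z hz => (hdiff z hz.1.le).differentiableWithinAt)
      (φ := fun r => Real.exp (-c * t) * ((r - |μ.im|) ^ 2)⁻¹) ?_ ?_ (hint c le_rfl) (hint b hb)
    · have h1 : Tendsto (fun r : ℝ => (r - |μ.im|) ^ 2) atTop atTop :=
        (tendsto_pow_atTop two_ne_zero).comp (tendsto_atTop_add_const_right _ (-|μ.im|) tendsto_id)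
      simpa using (tendsto_inv_atTop_zero.comp h1).const_mul (Real.exp (-c * t))
    · filter_upwards [eventually_gt_atTop |μ.im|] with r hr z hz _ hzr
      refine (hnorm z hz).trans (mul_le_mul ?_ ?_ (by positivity) (Real.exp_pos _).le)
      · exact Real.exp_le_exp.2 (by nlinarith)
      · refine inv_anti₀ (by have := sub_pos.2 hr; positivity) ?_
        have h1 : r - |μ.im| ≤ |z.im - μ.im| := by
          rw [← hzr]; exact abs_sub_abs_le_abs_sub _ _
        have h2 : (r - |μ.im|) ^ 2 ≤ |z.im - μ.im| ^ 2 :=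
          pow_le_pow_left₀ (sub_pos.2 hr).le h1 2
        rw [sq_abs] at h2
        nlinarith [sq_nonneg δ]
  refine ⟨hint c le_rfl, ?_⟩
  change ∫ y : ℝ, f (c + y * Complex.I) = 0
  -- Moving the line to `Re ζ = b` does not change the integral and brings in the factor `e^{-bt}`,
  -- which tends to `0`.
  have hbound : ∀ᶠ b in atTop, ‖∫ y : ℝ, f (c + y * Complex.I)‖ ≤
      Real.exp (-b * t) * ∫ y : ℝ, (δ ^ 2 + (y - μ.im) ^ 2)⁻¹ := by
    filter_upwards [eventually_ge_atTop c] with b hb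
    rw [hshift b hb, ← integral_const_mul]
    exact norm_integral_le_of_norm_le (hg.const_mul _) (Eventually.of_forall (hline b hb))
  have hlim : Tendsto (fun b : ℝ => Real.exp (-b * t) * ∫ y : ℝ, (δ ^ 2 + (y - μ.im) ^ 2)⁻¹) atTop
      (𝓝 0) := by
    have h1 : Tendsto (fun b : ℝ => Real.exp (-b * t)) atTop (𝓝 0) :=
      Real.tendsto_exp_atBot.comp (by
        simpa only [neg_mul, Function.comp_def, id] using tendsto_neg_atTop_atBot.comp (tendsto_id.atTop_mul_const ht))
    simpa using h1.mul_const (∫ y : ℝ, (δ ^ 2 + (y - μ.im) ^ 2)⁻¹)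
  exact norm_le_zero_iff.1 (ge_of_tendsto hlim hbound)

variable {V : Type*} [NormedAddCommGroup V] [InnerProductSpace ℂ V]
  {T : V →ₗ.[ℂ] V} {S : ℝ → V →L[ℂ] V}

namespace IsContractionSemigroup

theorem norm_apply_le (hS : IsContractionSemigroup T S) {t : ℝ} (ht : 0 ≤ t) (u : V) :
    ‖S t u‖ ≤ ‖u‖ := by
  have := (S t).le_of_opNorm_le (hS.contraction t ht) u
  rwa [one_mul] at this

theorem hasDerivWithinAt (hS : IsContractionSemigroup T S) {u w : V} (h : Maps T u w) {t : ℝ}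
    (ht : 0 ≤ t) : HasDerivWithinAt (fun t => S t u) (-(S t w)) (Ioi t) t := by
  rw [hasDerivWithinAt_iff_tendsto_slope' self_notMem_Ioi]
  have h1 : Tendsto (fun r : ℝ => r - t) (𝓝[>] t) (𝓝[>] 0) := by
    refine tendsto_nhdsWithin_of_tendsto_nhds_of_eventually_within _ ?_ ?_
    · have : Tendsto (fun r : ℝ => r - t) (𝓝 t) (𝓝 (t - t)) := (continuous_sub_right t).tendsto t
      rw [sub_self] at this
      exact this.mono_left nhdsWithin_le_nhds
    · filter_upwards [self_mem_nhdsWithin] with r hr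
      exact sub_pos.2 (mem_Ioi.1 hr)
  have h2 := ((S t).continuous.tendsto _).comp (((hS.generator u w).2 h).comp h1)
  rw [map_neg] at h2
  refine h2.congr' ?_
  filter_upwards [self_mem_nhdsWithin] with r hr
  have hr' : 0 ≤ r - t := (sub_pos.2 (mem_Ioi.1 hr)).le
  have h3 : S r u = S t (S (r - t) u) := by
    have := hS.map_add t (r - t) ht hr'
    rw [add_sub_cancel] at this
    rw [this]; rfl
  rw [slope_def_module, h3, ← map_sub, Function.comp_apply, Function.comp_apply, map_smul,
    Complex.coe_smul]

/-- The function `r ↦ e^{μr} S(r) u` has right derivative zero, hence is constant. -/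
theorem apply_eigenvector (hS : IsContractionSemigroup T S) {u : V} {μ : ℂ}
    (h : Maps T u (μ • u)) {t : ℝ} (ht : 0 ≤ t) : S t u = Complex.exp (-μ * t) • u := by
  have hexp : ∀ r : ℝ, HasDerivAt (fun r : ℝ => Complex.exp (μ * r)) (Complex.exp (μ * r) * μ) r := by
    intro r
    have := (((hasDerivAt_id (r : ℂ)).const_mul μ).cexp).comp_ofReal
    simpa using this
  have h1 := constant_of_has_deriv_right_zero (f := fun r : ℝ => Complex.exp (μ * r) • S r u)
    (a := 0) (b := t)
    ((by fun_prop : Continuous fun r : ℝ => Complex.exp (μ * r)).continuousOn.smul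
      ((hS.strongly_continuous u).mono Icc_subset_Ici_self)) (fun r hr => by
      have h2 := ((hexp r).hasDerivWithinAt (s := Ioi r)).smul (hS.hasDerivWithinAt h hr.1)
      have h3 := h2.Ici_of_Ioi
      refine h3.congr_deriv ?_
      rw [map_smul]
      module) t ⟨ht, le_rfl⟩
  simp only [Complex.ofReal_zero, mul_zero, Complex.exp_zero, one_smul, hS.map_zero,
    one_apply_eq_self] at h1
  have h2 := congrArg (fun v => Complex.exp (-μ * t) • v) h1
  simp only [smul_smul] at h2
  rwa [← Complex.exp_add, neg_mul, neg_add_cancel, Complex.exp_zero, one_smul, ← neg_mul] at h2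

variable [CompleteSpace V]

omit [CompleteSpace V] in
theorem integrableOn_laplace (hS : IsContractionSemigroup T S) {ζ : ℂ} (hζ : ζ.re < 0) (u : V) :
    IntegrableOn (fun t : ℝ => ((t : ℂ) * Complex.exp (ζ * t)) • S t u) (Ioi 0) := by
  have h1 := (integrableOn_rpow_mul_exp_neg_mul_rpow (p := 1) (s := 1) (b := -ζ.re) (by norm_num)
    one_pos (by linarith)).mul_const ‖u‖
  refine Integrable.mono' h1 ?_ ?_
  · refine ContinuousOn.aestronglyMeasurable ?_ measurableSet_Ioi
    exact (by fun_prop : Continuous fun t : ℝ =>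
      (t : ℂ) * Complex.exp (ζ * t)).continuousOn.smul
      ((hS.strongly_continuous u).mono Ioi_subset_Ici_self)
  · filter_upwards [ae_restrict_mem measurableSet_Ioi] with t ht
    have ht : 0 < t := ht
    rw [norm_smul, norm_mul, Complex.norm_real, Real.norm_of_nonneg ht.le, Complex.norm_exp]
    simp only [Real.rpow_one, neg_neg, Complex.mul_re, Complex.ofReal_re, Complex.ofReal_im,
      mul_zero, sub_zero]
    exact mul_le_mul_of_nonneg_left (hS.norm_apply_le ht.le u) (by positivity)

/-- The square of the resolvent is the Laplace transform of `t S(t)`. -/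
theorem integral_laplace (hS : IsContractionSemigroup T S) {ζ : ℂ} (hζ : ζ.re < 0)
    {R : V →L[ℂ] V} (hR : IsResolventAt T ζ R) (u : V) :
    ∫ t in Ioi (0 : ℝ), ((t : ℂ) * Complex.exp (ζ * t)) • S t u = R (R u) := by
  have hexp : ∀ r : ℝ, HasDerivAt (fun r : ℝ => Complex.exp (ζ * r)) (Complex.exp (ζ * r) * ζ) r := by
    intro r
    have := (((hasDerivAt_id (r : ℂ)).const_mul ζ).cexp).comp_ofReal
    simpa using this
  have hid : ∀ r : ℝ, HasDerivAt (fun r : ℝ => (r : ℂ)) 1 r := fun r =>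
    (hasDerivAt_id (r : ℂ)).comp_ofReal
  -- An antiderivative of the negative of the integrand, equal to `R (R u)` at `0` and tending to
  -- `0` at infinity.
  let f : ℝ → V := fun t => ((t : ℂ) * Complex.exp (ζ * t)) • S t (R u) +
    Complex.exp (ζ * t) • S t (R (R u))
  have hfc : ContinuousOn f (Ici 0) := by
    refine ContinuousOn.add ?_ ?_
    · exact (by fun_prop : Continuous fun t : ℝ =>
        (t : ℂ) * Complex.exp (ζ * t)).continuousOn.smul (hS.strongly_continuous _)
    · exact (by fun_prop : Continuous fun t : ℝ => Complex.exp (ζ * t)).continuousOn.smul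
        (hS.strongly_continuous _)
  have hfd : ∀ t : ℝ, 0 ≤ t → HasDerivWithinAt f
      (-(((t : ℂ) * Complex.exp (ζ * t)) • S t u)) (Ioi t) t := by
    intro t ht
    have h1 := (((hid t).mul (hexp t)).hasDerivWithinAt (s := Ioi t)).smul
      (hS.hasDerivWithinAt (hR.maps u) ht)
    have h2 := ((hexp t).hasDerivWithinAt (s := Ioi t)).smul
      (hS.hasDerivWithinAt (hR.maps (R u)) ht)
    refine (h1.add h2).congr_deriv ?_
    simp only [_root_.map_add, map_smul, Pi.mul_apply]
    module
  have hint := hS.integrableOn_laplace hζ u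
  have hlim0 : Tendsto f atTop (𝓝 0) := by
    have e1 : Tendsto (fun t : ℝ => t * Real.exp (ζ.re * t)) atTop (𝓝 0) := by
      simpa using tendsto_rpow_mul_exp_neg_mul_atTop_nhds_zero 1 (-ζ.re) (by linarith)
    have e2 : Tendsto (fun t : ℝ => Real.exp (ζ.re * t)) atTop (𝓝 0) :=
      Real.tendsto_exp_atBot.comp (tendsto_id.const_mul_atTop_of_neg hζ)
    have e3 : Tendsto (fun t : ℝ => t * Real.exp (ζ.re * t) * ‖R u‖ +
        Real.exp (ζ.re * t) * ‖R (R u)‖) atTop (𝓝 0) := by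
      simpa using (e1.mul_const ‖R u‖).add (e2.mul_const ‖R (R u)‖)
    refine squeeze_zero_norm' ?_ e3
    filter_upwards [eventually_ge_atTop 0] with t ht
    refine (norm_add_le _ _).trans (add_le_add ?_ ?_)
    · rw [norm_smul, norm_mul, Complex.norm_real, Real.norm_of_nonneg ht, Complex.norm_exp]
      simp only [Complex.mul_re, Complex.ofReal_re, Complex.ofReal_im,
        mul_zero, sub_zero]
      exact mul_le_mul_of_nonneg_left (hS.norm_apply_le ht _) (by positivity)
    · rw [norm_smul, Complex.norm_exp]
      simp only [Complex.mul_re, Complex.ofReal_re, Complex.ofReal_im, mul_zero, sub_zero]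
      exact mul_le_mul_of_nonneg_left (hS.norm_apply_le ht _) (by positivity)
  have hf0 : f 0 = R (R u) := by simp [f, hS.map_zero]
  have h3 : ∀ N : ℝ, 0 ≤ N → ∫ t in (0 : ℝ)..N, ((t : ℂ) * Complex.exp (ζ * t)) • S t u =
      R (R u) - f N := by
    intro N hN
    have hi : IntervalIntegrable (fun t : ℝ => ((t : ℂ) * Complex.exp (ζ * t)) • S t u) volume 0 N :=
      (intervalIntegrable_iff_integrableOn_Ioc_of_le hN).2 (hint.mono_set Ioc_subset_Ioi_self)
    have h4 := intervalIntegral.integral_eq_sub_of_hasDeriv_right (f := f)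
      (f' := fun t : ℝ => -(((t : ℂ) * Complex.exp (ζ * t)) • S t u)) (a := 0) (b := N)
      (hfc.mono (by rw [uIcc_of_le hN]; exact Icc_subset_Ici_self))
      (fun t ht => hfd t (by rw [min_eq_left hN] at ht; exact ht.1.le)) hi.neg
    rw [intervalIntegral.integral_neg, hf0] at h4
    rw [← neg_sub (f N), ← h4, neg_neg]
  have h5 := intervalIntegral_tendsto_integral_Ioi 0 hint tendsto_id
  have h6 : Tendsto (fun N => R (R u) - f N) atTop (𝓝 (R (R u) - 0)) :=
    tendsto_const_nhds.sub hlim0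
  rw [sub_zero] at h6
  refine tendsto_nhds_unique h5 (h6.congr' ?_)
  filter_upwards [eventually_ge_atTop 0] with N hN
  exact (h3 N hN).symm

/-- The semigroup as inverse Laplace transform of the square of the resolvent. -/
theorem apply_eq_integral (hS : IsContractionSemigroup T S) {c : ℝ} (hc : c < 0)
    {R : ℝ → V →L[ℂ] V} (hR : ∀ y : ℝ, IsResolventAt T ((c : ℂ) + y * Complex.I) (R y)) (u : V)
    (hint : Integrable fun y => R y (R y u)) {t : ℝ} (ht : 0 < t) :
    ((2 * Real.pi * t : ℝ) : ℂ) • S t u =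
      ∫ y : ℝ, Complex.exp (-((c : ℂ) + y * Complex.I) * t) • R y (R y u) := by
  -- The function `t e^{ct} S(t) u`, extended by zero to `t ≤ 0`. The factor `t` makes it continuous
  -- at `0`, so Fourier inversion holds pointwise; its Fourier transform at `ξ` is the squared
  -- resolvent at `c - 2πiξ`.
  let f : ℝ → V := fun t => (((max t 0 : ℝ) : ℂ) * Complex.exp (c * t)) • S (max t 0) u
  have hfc : Continuous f := by
    refine Continuous.smul (by fun_prop) ?_
    exact (hS.strongly_continuous u).comp_continuous (by fun_prop) fun t => le_max_right t 0
  have hf_pos : ∀ t : ℝ, 0 < t → f t = ((t : ℂ) * Complex.exp (c * t)) • S t u := by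
    intro t ht
    simp only [f, max_eq_left ht.le]
  have hf_neg : ∀ t : ℝ, t ≤ 0 → f t = 0 := by
    intro t ht
    simp only [f, max_eq_right ht, Complex.ofReal_zero, zero_mul, zero_smul]
  have hfi : Integrable f := by
    have h1 := hS.integrableOn_laplace (ζ := c) (by simpa using hc) u
    have h2 := h1.integrable_indicator measurableSet_Ioi
    refine h2.congr (Eventually.of_forall fun t => ?_)
    by_cases ht : 0 < t
    · rw [indicator_of_mem (by exact ht), hf_pos t ht]
    · rw [indicator_of_notMem (by exact ht), hf_neg t (not_lt.1 ht)]
  have hF : ∀ ξ : ℝ, FourierTransform.fourier f ξ =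
      R (-(2 * Real.pi) * ξ) (R (-(2 * Real.pi) * ξ) u) := by
    intro ξ
    rw [Real.fourier_real_eq_integral_exp_smul, ← hS.integral_laplace (by simpa using hc) (hR _) u,
      ← integral_indicator measurableSet_Ioi]
    congr 1
    funext t
    by_cases ht : 0 < t
    · rw [indicator_of_mem (by exact ht), hf_pos t ht, smul_smul, ← mul_assoc,
        mul_comm (Complex.exp _), mul_assoc, ← Complex.exp_add]
      congr 3
      push_cast
      ring
    · rw [indicator_of_notMem (by exact ht), hf_neg t (not_lt.1 ht), smul_zero]
  have hFi : Integrable (FourierTransform.fourier f) := by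
    rw [funext hF]
    exact hint.comp_mul_left' (by simp [Real.pi_ne_zero])
  have hinv := congrFun (hfc.fourierInv_fourier_eq hfi hFi) t
  rw [Real.fourierInv_eq', funext hF, hf_pos t ht] at hinv
  have hsub := Measure.integral_comp_mul_left
    (fun y : ℝ => Complex.exp (-(y * Complex.I * t)) • R y (R y u)) (-(2 * Real.pi))
  have h1 : (∫ ξ : ℝ, Complex.exp (↑(2 * Real.pi * inner ℝ ξ t) * Complex.I) •
      R (-(2 * Real.pi) * ξ) (R (-(2 * Real.pi) * ξ) u)) =
      ∫ ξ : ℝ, Complex.exp (-(((-(2 * Real.pi) * ξ : ℝ) : ℂ) * Complex.I * t)) •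
      R (-(2 * Real.pi) * ξ) (R (-(2 * Real.pi) * ξ) u) := by
    congr 1
    funext ξ
    congr 2
    simp only [RCLike.inner_apply, conj_trivial]
    push_cast
    ring
  rw [h1, hsub, inv_neg, abs_neg, abs_of_pos (inv_pos.2 Real.two_pi_pos)] at hinv
  have h2 : (∫ y : ℝ, Complex.exp (-((c : ℂ) + y * Complex.I) * t) • R y (R y u)) =
      Complex.exp (-(c * t)) •
        ∫ y : ℝ, Complex.exp (-(y * Complex.I * t)) • R y (R y u) := by
    rw [← integral_smul]
    congr 1
    funext y
    rw [smul_smul, ← Complex.exp_add]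
    congr 2
    ring
  rw [h2]
  rw [inv_smul_eq_iff₀ Real.two_pi_pos.ne'] at hinv
  rw [hinv, ← Complex.coe_smul, smul_smul, smul_smul]
  congr 1
  have h3 : Complex.exp (-(c * t)) * Complex.exp (c * t) = 1 := by
    rw [← Complex.exp_add, neg_add_cancel, Complex.exp_zero]
  push_cast
  linear_combination (-(2 * Real.pi * t : ℂ)) * h3

end IsContractionSemigroup

end Inversion

end KineticBM

/-! ### Expansion of the semigroup along Re ζ = 1/2 -/

namespace KineticBM

section Expansion

open Set Filter MeasureTheory

variable {V : Type*} [NormedAddCommGroup V] [InnerProductSpace ℂ V] {T : V →ₗ.[ℂ] V}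

theorem continuous_opResolvent_line {c : ℝ}
    (h : ∀ y : ℝ, (c : ℂ) + y * Complex.I ∉ opSpectrum T) :
    Continuous fun y : ℝ => opResolvent T ((c : ℂ) + y * Complex.I) :=
  continuousOn_opResolvent.comp_continuous (by fun_prop) h

theorem integrable_opResolvent_sq {c : ℝ} (h : ∀ y : ℝ, (c : ℂ) + y * Complex.I ∉ opSpectrum T)
    {K δ : ℝ} (hδ : 0 < δ)
    (hK : ∀ y : ℝ, ‖opResolvent T ((c : ℂ) + y * Complex.I)‖ ^ 2 ≤ K * (δ ^ 2 + y ^ 2)⁻¹)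
    {g : ℝ → ℂ} (hg : Continuous g) {M : ℝ} (hgM : ∀ y, ‖g y‖ ≤ M) (u : V) :
    Integrable fun y : ℝ => g y • opResolvent T ((c : ℂ) + y * Complex.I)
      (opResolvent T ((c : ℂ) + y * Complex.I) u) := by
  have hc := continuous_opResolvent_line h
  refine Integrable.mono' (((integrable_inv_sq_add_sq hδ).const_mul K).const_mul (M * ‖u‖))
    (hg.smul (hc.clm_apply (hc.clm_apply continuous_const))).aestronglyMeasurable
    (Eventually.of_forall fun y => ?_)
  set R := opResolvent T ((c : ℂ) + y * Complex.I)
  have h1 : ‖R (R u)‖ ≤ ‖R‖ ^ 2 * ‖u‖ := by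
    have := (R.le_opNorm (R u)).trans (mul_le_mul_of_nonneg_left (R.le_opNorm u) (norm_nonneg R))
    linarith
  have hM : 0 ≤ M := (norm_nonneg _).trans (hgM y)
  calc ‖g y • R (R u)‖ = ‖g y‖ * ‖R (R u)‖ := norm_smul _ _
    _ ≤ M * (‖R‖ ^ 2 * ‖u‖) := mul_le_mul (hgM y) h1 (norm_nonneg _) hM
    _ ≤ M * ((K * (δ ^ 2 + y ^ 2)⁻¹) * ‖u‖) := by
        have := hK y
        gcongr
    _ = M * ‖u‖ * (K * (δ ^ 2 + y ^ 2)⁻¹) := by ring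

theorem norm_exp_line (c t y : ℝ) :
    ‖Complex.exp (-((c : ℂ) + y * Complex.I) * t)‖ = Real.exp (-c * t) := by
  rw [Complex.norm_exp]
  simp

variable [CompleteSpace V]

/-- Expansion of a contraction semigroup whose resolvent has, in a half plane `Re ζ ≤ 1/2`, at most
one pole with residue `-P`; `N` is the holomorphic part of the resolvent. -/
theorem semigroup_expansion {S : ℝ → V →L[ℂ] V} (hS : IsContractionSemigroup T S) {C : ℝ}
    (hres : ∀ ζ : ℂ, ζ.re ≤ 1 / 2 → 1 / 2 ≤ ‖ζ‖ →
      ζ ∉ opSpectrum T ∧ ‖opResolvent T ζ‖ ≤ C / ‖ζ‖)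
    {P : V →L[ℂ] V} {μ : ℂ} (hμ : ‖μ‖ < 1 / 2) (hP : ∀ u, Maps T (P u) (μ • P u))
    {N : ℂ → V →L[ℂ] V} (hNc : ContinuousOn N {z | z.re ≤ 1 / 2})
    (hNd : DifferentiableOn ℂ N {z | z.re < 1 / 2})
    (hN : ∀ ζ : ℂ, ζ.re ≤ 1 / 2 → 1 / 2 ≤ ‖ζ‖ → ∀ u,
      N ζ (N ζ u) = opResolvent T ζ (opResolvent T ζ (u - P u))) (u : V) {t : ℝ} (ht : 0 < t) :
    Integrable (lineIntegrand T t u) ∧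
      S t u = Complex.exp (-μ * t) • P u +
        ((1 / (t : ℂ)) * (1 / (2 * (Real.pi : ℂ) * Complex.I))) • lineIntegral T t u := by
  have hnormline : ∀ c y : ℝ, c = 1 / 2 ∨ c = -(1 / 2) → 1 / 2 ≤ ‖(c : ℂ) + y * Complex.I‖ := by
    intro c y hc
    have h1 := norm_sq_line c y
    have h2 : c ^ 2 = (1 / 2) ^ 2 := by rcases hc with rfl | rfl <;> norm_num
    have h3 : (1 / 2 : ℝ) ^ 2 ≤ ‖(c : ℂ) + y * Complex.I‖ ^ 2 := by nlinarith [sq_nonneg y]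
    exact (sq_le_sq₀ (by norm_num) (norm_nonneg _)).1 h3
  have hline : ∀ c : ℝ, c = 1 / 2 ∨ c = -(1 / 2) → ∀ y : ℝ,
      (c : ℂ) + y * Complex.I ∉ opSpectrum T ∧
      ‖opResolvent T ((c : ℂ) + y * Complex.I)‖ ^ 2 ≤ C ^ 2 * ((1 / 2) ^ 2 + y ^ 2)⁻¹ := by
    intro c hc y
    have hre : ((c : ℂ) + y * Complex.I).re ≤ 1 / 2 := by
      rcases hc with rfl | rfl
      · simp
      · simp
    obtain ⟨h1, h2⟩ := hres _ hre (hnormline c y hc)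
    refine ⟨h1, (pow_le_pow_left₀ (norm_nonneg _) h2 2).trans (le_of_eq ?_)⟩
    rw [div_pow, norm_sq_line, div_eq_mul_inv]
    rcases hc with rfl | rfl <;> norm_num
  have hexpc : ∀ c : ℝ, Continuous fun y : ℝ => Complex.exp (-((c : ℂ) + y * Complex.I) * t) :=
    fun c => by fun_prop
  have hint : ∀ c : ℝ, c = 1 / 2 ∨ c = -(1 / 2) → ∀ v : V, Integrable fun y : ℝ =>
      Complex.exp (-((c : ℂ) + y * Complex.I) * t) • opResolvent T ((c : ℂ) + y * Complex.I)
        (opResolvent T ((c : ℂ) + y * Complex.I) v) := fun c hc v =>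
    integrable_opResolvent_sq (fun y => (hline c hc y).1) (by norm_num) (fun y => (hline c hc y).2)
      (hexpc c) (fun y => (norm_exp_line c t y).le) v
  have hhalf : ((1 / 2 : ℝ) : ℂ) = 1 / 2 := by push_cast; ring
  have hint2 : ∀ v, Integrable (lineIntegrand T t v) := by
    intro v
    have := hint (1 / 2) (Or.inl rfl) v
    rwa [hhalf] at this
  refine ⟨hint2 u, ?_⟩
  set u' := u - P u with hu'
  have hre_neg : ((-(1 / 2) : ℝ) : ℝ) < 0 := by norm_num
  -- Laplace inversion requires `Re ζ < 0`. The line `Re ζ = -1/2` stays outside the open disc of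
  -- radius `1/2`, so the resolvent bound is available on it.
  have hrep := hS.apply_eq_integral (c := -(1 / 2)) hre_neg
    (R := fun y => opResolvent T (((-(1 / 2) : ℝ) : ℂ) + y * Complex.I))
    (fun y => isResolventAt_opResolvent (hline _ (Or.inr rfl) y).1) u' (by
      have := integrable_opResolvent_sq (fun y => (hline _ (Or.inr rfl) y).1) (by norm_num)
        (fun y => (hline _ (Or.inr rfl) y).2) (g := fun _ => 1) continuous_const (M := 1)
        (fun _ => by simp) u'
      simpa using this) ht
  -- Outside the disc this is the integrand for `u'`; inside it continues holomorphically across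
  -- `μ`.
  let G : ℂ → V := fun z => Complex.exp (-z * t) • N z (N z u)
  have hGline : ∀ c : ℝ, c = 1 / 2 ∨ c = -(1 / 2) → ∀ y : ℝ, G (c + y * Complex.I) =
      Complex.exp (-((c : ℂ) + y * Complex.I) * t) • opResolvent T ((c : ℂ) + y * Complex.I)
        (opResolvent T ((c : ℂ) + y * Complex.I) u') := by
    intro c hc y
    have hre : ((c : ℂ) + y * Complex.I).re ≤ 1 / 2 := by
      rcases hc with rfl | rfl
      · simp
      · simp
    simp only [G]
    rw [hN _ hre (hnormline c y hc)]
  have hshift : ∫ y : ℝ, G (((-(1 / 2) : ℝ) : ℂ) + y * Complex.I) =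
      ∫ y : ℝ, G (((1 / 2 : ℝ) : ℂ) + y * Complex.I) := by
    refine integral_vertical_eq_of_strip (by norm_num) ?_ ?_
      (φ := fun r => Real.exp (1 / 2 * t) * (C ^ 2 * ‖u'‖) * (r ^ 2)⁻¹) ?_ ?_ ?_ ?_
    · have hNc' : ContinuousOn N {z | -(1 / 2) ≤ z.re ∧ z.re ≤ 1 / 2} :=
        hNc.mono fun z hz => hz.2
      exact (by fun_prop : Continuous fun z : ℂ => Complex.exp (-z * t)).continuousOn.smul
        (hNc'.clm_apply (hNc'.clm_apply continuousOn_const))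
    · have hNd' : DifferentiableOn ℂ N {z | -(1 / 2) < z.re ∧ z.re < 1 / 2} :=
        hNd.mono fun z hz => hz.2
      exact (by fun_prop : Differentiable ℂ fun z : ℂ => Complex.exp (-z * t)).differentiableOn.smul
        (hNd'.clm_apply (hNd'.clm_apply (differentiableOn_const _)))
    · simpa using (tendsto_inv_atTop_zero.comp (tendsto_pow_atTop (α := ℝ) two_ne_zero)).const_mul
        (Real.exp (1 / 2 * t) * (C ^ 2 * ‖u'‖))
    · filter_upwards [eventually_ge_atTop 1] with r hr z hz1 hz2 hzr
      have hzn : r ≤ ‖z‖ := by rw [← hzr]; exact Complex.abs_im_le_norm z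
      obtain ⟨-, h2⟩ := hres z hz2 (by linarith)
      simp only [G]
      rw [hN z hz2 (by linarith), norm_smul, Complex.norm_exp, mul_assoc]
      have hre : (-z * (t : ℂ)).re = -z.re * t := by simp
      rw [hre]
      refine mul_le_mul (Real.exp_le_exp.2 (by nlinarith)) ?_ (norm_nonneg _) (Real.exp_pos _).le
      set R := opResolvent T z
      have h3 : ‖R (R u')‖ ≤ ‖R‖ ^ 2 * ‖u'‖ := by
        have := (R.le_opNorm (R u')).trans
          (mul_le_mul_of_nonneg_left (R.le_opNorm u') (norm_nonneg R))
        linarith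
      have h4 : ‖R‖ ^ 2 ≤ C ^ 2 * (r ^ 2)⁻¹ := by
        refine (pow_le_pow_left₀ (norm_nonneg _) h2 2).trans ?_
        rw [div_pow, div_eq_mul_inv]
        refine mul_le_mul_of_nonneg_left (inv_anti₀ (by positivity) ?_) (sq_nonneg C)
        exact pow_le_pow_left₀ (by linarith) hzn 2
      calc ‖R (R u')‖ ≤ ‖R‖ ^ 2 * ‖u'‖ := h3
        _ ≤ C ^ 2 * (r ^ 2)⁻¹ * ‖u'‖ := mul_le_mul_of_nonneg_right h4 (norm_nonneg _)
        _ = C ^ 2 * ‖u'‖ * (r ^ 2)⁻¹ := by ring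
    · exact (hint _ (Or.inr rfl) u').congr (Eventually.of_forall fun y =>
        (hGline _ (Or.inr rfl) y).symm)
    · exact (hint _ (Or.inl rfl) u').congr (Eventually.of_forall fun y =>
        (hGline _ (Or.inl rfl) y).symm)
  have hrep2 : ((2 * Real.pi * t : ℝ) : ℂ) • S t u' = ∫ y : ℝ, lineIntegrand T t u' y := by
    rw [hrep, ← funext (hGline _ (Or.inr rfl)), hshift, funext (hGline _ (Or.inl rfl)), hhalf]
    rfl
  have hPline : ∀ y : ℝ, lineIntegrand T t (P u) y =
      (Complex.exp (-(((1 / 2 : ℝ) : ℂ) + y * Complex.I) * t) *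
        ((((1 / 2 : ℝ) : ℂ) + y * Complex.I - μ) ^ 2)⁻¹) • P u := by
    intro y
    rw [hhalf]
    set ζ : ℂ := 1 / 2 + y * Complex.I with hζ
    have hsp : ζ ∉ opSpectrum T := by
      have := (hline _ (Or.inl rfl) y).1
      rwa [hhalf] at this
    have hne : μ - ζ ≠ 0 := by
      intro h0
      have h1 : ‖μ‖ = ‖ζ‖ := by rw [sub_eq_zero.1 h0]
      have h2 := hnormline _ y (Or.inl rfl)
      rw [hhalf] at h2
      linarith
    have hR := (isResolventAt_opResolvent hsp).apply_of_maps (hP u)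
    rw [← sub_smul, map_smul] at hR
    have hR' : opResolvent T ζ (P u) = (μ - ζ)⁻¹ • P u := by
      rw [eq_inv_smul_iff₀ hne]; exact hR
    simp only [lineIntegrand]
    rw [← hζ, hR', map_smul, hR', smul_smul, smul_smul]
    congr 1
    rw [mul_assoc, ← mul_inv, ← neg_sub ζ μ, neg_mul_neg, sq]
  have hμre : μ.re < 1 / 2 := (Complex.re_le_norm μ).trans_lt hμ
  -- On `P u` the resolvent is `(μ - ζ)⁻¹`, and the resulting scalar integral vanishes because `μ`
  -- lies to the left of the line. Hence `u'` and `u` have the same line integral.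
  have hPzero : ∫ y : ℝ, lineIntegrand T t (P u) y = 0 := by
    rw [funext hPline, integral_smul_const, (integral_exp_mul_inv_sq_eq_zero hμre ht).2, zero_smul]
  have hadd : ∫ y : ℝ, lineIntegrand T t u y = ((2 * Real.pi * t : ℝ) : ℂ) • S t u' := by
    rw [hrep2, ← add_zero (∫ y : ℝ, lineIntegrand T t u' y), ← hPzero,
      ← integral_add (hint2 _) (hint2 _)]
    congr 1
    funext y
    simp only [lineIntegrand, hu', map_sub, smul_sub, sub_add_cancel]
  have hfin : S t u = S t (P u) + S t u' := by rw [← map_add, hu', add_sub_cancel]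
  have h1 : (1 / (t : ℂ)) * (1 / (2 * (Real.pi : ℂ) * Complex.I)) * Complex.I *
      ((2 * Real.pi * t : ℝ) : ℂ) = 1 := by
    have h2 : (t : ℂ) ≠ 0 := Complex.ofReal_ne_zero.2 ht.ne'
    have h3 : (Real.pi : ℂ) ≠ 0 := Complex.ofReal_ne_zero.2 Real.pi_ne_zero
    push_cast
    field_simp
  rw [hfin, hS.apply_eigenvector (hP u) ht.le, lineIntegral, hadd, smul_smul, smul_smul, h1,
    one_smul]

omit [CompleteSpace V] in
-- Since `∫ dy / (δ² + y²) = π/δ`, the constant is `(1 / (2πt)) · 4 · π/δ`.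
theorem norm_lineIntegral_le {δ : ℝ} (hδ : 0 < δ)
    (hK : ∀ y : ℝ, ‖opResolvent T ((1 / 2 : ℂ) + y * Complex.I)‖ ^ 2 ≤ 4 * (δ ^ 2 + y ^ 2)⁻¹)
    (u : V) {t : ℝ} (ht : 0 < t) :
    ‖((1 / (t : ℂ)) * (1 / (2 * (Real.pi : ℂ) * Complex.I))) • lineIntegral T t u‖ ≤
      2 / (t * δ) * Real.exp (-t / 2) * ‖u‖ := by
  have h1 : ‖∫ y : ℝ, lineIntegrand T t u y‖ ≤
      ∫ y : ℝ, Real.exp (-t / 2) * (4 * ‖u‖) * (δ ^ 2 + y ^ 2)⁻¹ := by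
    refine norm_integral_le_of_norm_le ((integrable_inv_sq_add_sq hδ).const_mul _)
      (Eventually.of_forall fun y => ?_)
    have h2 := norm_exp_line (1 / 2) t y
    have hhalf : ((1 / 2 : ℝ) : ℂ) = 1 / 2 := by push_cast; ring
    rw [hhalf, show -(1 / 2) * t = -t / 2 by ring] at h2
    rw [lineIntegrand, norm_smul, h2, mul_assoc]
    refine mul_le_mul_of_nonneg_left ?_ (Real.exp_pos _).le
    set R := opResolvent T ((1 / 2 : ℂ) + y * Complex.I) with hR
    have h3 : ‖R (R u)‖ ≤ ‖R‖ ^ 2 * ‖u‖ := by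
      have := (R.le_opNorm (R u)).trans
        (mul_le_mul_of_nonneg_left (R.le_opNorm u) (norm_nonneg R))
      linarith
    have := mul_le_mul_of_nonneg_right (hK y) (norm_nonneg u)
    linarith
  rw [integral_const_mul, integral_inv_sq_add_sq hδ] at h1
  rw [lineIntegral, norm_smul, norm_smul, Complex.norm_I, one_mul, norm_mul, norm_div, norm_div,
    norm_mul, norm_mul, norm_one, Complex.norm_I, Complex.norm_real, Complex.norm_real,
    Complex.norm_ofNat, Real.norm_of_nonneg ht.le, Real.norm_of_nonneg Real.pi_pos.le, mul_one]
  refine (mul_le_mul_of_nonneg_left h1 (by positivity)).trans (le_of_eq ?_)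
  have := Real.pi_ne_zero
  field_simp
  ring

end Expansion

end KineticBM

/-! ### Diagonal operators and relative bounds for H -/

namespace KineticBM

namespace UnitaryRep

variable {V : Type*} [NormedAddCommGroup V] [InnerProductSpace ℂ V] (π : UnitaryRep V)

theorem norm_sq_sum_of_mem_kSpace {g : ℤ → V} (hg : ∀ k, g k ∈ π.kSpace k) (s : Finset ℤ) :
    ‖∑ k ∈ s, g k‖ ^ 2 = ∑ k ∈ s, ‖g k‖ ^ 2 := by
  classical
  induction s using Finset.induction_on with
  | empty => simp
  | insert a s ha ih =>
    have h0 : inner ℂ (g a) (∑ k ∈ s, g k) = 0 := by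
      rw [inner_sum]
      refine Finset.sum_eq_zero fun k hk => π.inner_eq_zero_of_kSpace ?_ (hg a) (hg k)
      rintro rfl
      exact ha hk
    rw [Finset.sum_insert ha, Finset.sum_insert ha, ← ih, norm_add_sq (𝕜 := ℂ), h0]
    simp

/-- The operator `A` on smooth vectors acts on the vectors of `K`-type `k` as the scalar `d k`. -/
def IsDiagonal [CompleteSpace V] (A : π.smoothVectors →ₗ[ℂ] V) (d : ℤ → ℝ) : Prop :=
  ∀ (k : ℤ) (v : π.smoothVectors), (v : V) ∈ π.kSpace k → A v = (d k : ℂ) • (v : V)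

variable [CompleteSpace V]

omit [CompleteSpace V] in
theorem exists_sum_of_mem_kFinite {v : π.smoothVectors} (hv : v ∈ π.kFinite) :
    ∃ (s : Finset ℤ) (f : ℤ → π.smoothVectors), (∀ k, (f k : V) ∈ π.kSpace k) ∧
      v = ∑ k ∈ s, f k := by
  obtain ⟨f, hf, hsum⟩ := (Submodule.mem_iSup_iff_exists_finsupp _ _).1 hv
  exact ⟨f.support, f, hf, hsum.symm⟩

variable {π} {A : π.smoothVectors →ₗ[ℂ] V} {d : ℤ → ℝ}

namespace IsDiagonal

theorem sub_smul_apply (hA : π.IsDiagonal A d) (ζ : ℂ) {s : Finset ℤ} {f : ℤ → π.smoothVectors}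
    (hf : ∀ k, (f k : V) ∈ π.kSpace k) :
    A (∑ k ∈ s, f k) - ζ • ((∑ k ∈ s, f k : π.smoothVectors) : V) =
      ∑ k ∈ s, ((d k : ℂ) - ζ) • (f k : V) := by
  rw [map_sum, AddSubmonoidClass.coe_finsetSum, Finset.smul_sum, ← Finset.sum_sub_distrib]
  refine Finset.sum_congr rfl fun k _ => ?_
  rw [hA k _ (hf k), sub_smul]

theorem norm_sq_sub_smul (hA : π.IsDiagonal A d) (ζ : ℂ) {s : Finset ℤ}
    {f : ℤ → π.smoothVectors} (hf : ∀ k, (f k : V) ∈ π.kSpace k) :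
    ‖A (∑ k ∈ s, f k) - ζ • ((∑ k ∈ s, f k : π.smoothVectors) : V)‖ ^ 2 =
      ∑ k ∈ s, ‖(d k : ℂ) - ζ‖ ^ 2 * ‖(f k : V)‖ ^ 2 := by
  rw [hA.sub_smul_apply ζ hf, π.norm_sq_sum_of_mem_kSpace
    (g := fun k => ((d k : ℂ) - ζ) • (f k : V)) fun k => Submodule.smul_mem _ _ (hf k)]
  refine Finset.sum_congr rfl fun k _ => ?_
  rw [norm_smul, mul_pow]

theorem re_inner_eq (hA : π.IsDiagonal A d) {s : Finset ℤ}
    {f : ℤ → π.smoothVectors} (hf : ∀ k, (f k : V) ∈ π.kSpace k) :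
    (inner ℂ (A (∑ k ∈ s, f k)) ((∑ k ∈ s, f k : π.smoothVectors) : V)).re =
      ∑ k ∈ s, d k * ‖(f k : V)‖ ^ 2 := by
  have h := hA.sub_smul_apply 0 (s := s) hf
  rw [zero_smul, sub_zero] at h
  rw [h, AddSubmonoidClass.coe_finsetSum, sum_inner, Complex.re_sum]
  refine Finset.sum_congr rfl fun k hk => ?_
  rw [inner_sum, Finset.sum_eq_single_of_mem k hk]
  · rw [sub_zero, inner_smul_left, inner_self_eq_norm_sq_to_K, Complex.conj_ofReal]
    change ((d k : ℂ) * (‖(f k : V)‖ : ℂ) ^ 2).re = _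
    rw [← Complex.ofReal_pow, ← Complex.ofReal_mul, Complex.ofReal_re]
  · intro l _ hl
    rw [inner_smul_left, π.inner_eq_zero_of_kSpace hl.symm (hf k) (hf l), mul_zero]

theorem le_norm_sub_smul (hA : π.IsDiagonal A d) {ζ : ℂ} {m : ℝ} (hm : 0 ≤ m)
    (h : ∀ k ∈ π.kTypes, m ≤ ‖(d k : ℂ) - ζ‖) {v : π.smoothVectors} (hv : v ∈ π.kFinite) :
    m * ‖(v : V)‖ ≤ ‖A v - ζ • (v : V)‖ := by
  obtain ⟨s, f, hf, rfl⟩ := π.exists_sum_of_mem_kFinite hv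
  refine (sq_le_sq₀ (by positivity) (norm_nonneg _)).1 ?_
  rw [hA.norm_sq_sub_smul ζ hf, mul_pow, AddSubmonoidClass.coe_finsetSum,
    π.norm_sq_sum_of_mem_kSpace hf, Finset.mul_sum]
  refine Finset.sum_le_sum fun k _ => ?_
  by_cases h0 : (f k : V) = 0
  · simp [h0]
  · exact mul_le_mul_of_nonneg_right
      (pow_le_pow_left₀ hm (h k (π.mem_kTypes_of_mem_kSpace (hf k) h0)) 2) (sq_nonneg _)

/-- Each smooth vector of K-type `k` is the image of its multiple by `(d k - ζ)⁻¹`, and the span of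
such vectors is dense. -/
theorem denseRange_sub_smul (hA : π.IsDiagonal A d) {ζ : ℂ}
    (h : ∀ k ∈ π.kTypes, (d k : ℂ) - ζ ≠ 0) :
    DenseRange fun v : π.kFinite => A v - ζ • ((v : π.smoothVectors) : V) := by
  let F : π.kFinite →ₗ[ℂ] V := (A - ζ • π.smoothVectors.subtype) ∘ₗ π.kFinite.subtype
  have h1 : π.kFinite.map π.smoothVectors.subtype ≤ LinearMap.range F := by
    rw [Submodule.map_le_iff_le_comap]
    refine iSup_le fun k v hv => ?_
    have hv : (v : V) ∈ π.kSpace k := hv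
    change (v : V) ∈ LinearMap.range F
    by_cases h0 : (v : V) = 0
    · rw [h0]; exact zero_mem _
    · have hne := h k (π.mem_kTypes_of_mem_kSpace hv h0)
      have hw : ((d k : ℂ) - ζ)⁻¹ • v ∈ π.kFinite :=
        Submodule.smul_mem _ _ (Submodule.mem_iSup_of_mem k (by exact hv))
      refine ⟨⟨((d k : ℂ) - ζ)⁻¹ • v, hw⟩, ?_⟩
      change A (((d k : ℂ) - ζ)⁻¹ • v) - ζ • (((d k : ℂ) - ζ)⁻¹ • (v : V)) = v
      rw [map_smul, hA k v hv, smul_comm ζ, ← smul_sub, ← sub_smul, smul_smul, inv_mul_cancel₀ hne,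
        one_smul]
  exact π.dense_kFinite.mono fun v hv => h1 hv

end IsDiagonal

variable (π) in
theorem isDiagonal_neg_xiSq : π.IsDiagonal (-π.xiSq) (fun k => (k : ℝ) ^ 2) := by
  intro k v hv
  have := π.xiSq_of_mem v hv
  simpa using this

/-- Although `H` mixes K-types, the Casimir bound for `‖H v‖²` is a diagonal quadratic form. It can
therefore be compared with `‖A v - ζ v‖²` one K-type at a time. -/
theorem IsDiagonal.norm_hDer_le (hA : π.IsDiagonal A d) {lam : ℝ} (hlam : π.HasCasimir lam)
    {ζ : ℂ} {κ : ℝ} (hκ : 0 ≤ κ)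
    (h : ∀ k ∈ π.kTypes, (k : ℝ) ^ 2 + lam / 4 ≤ κ ^ 2 * ‖(d k : ℂ) - ζ‖ ^ 2)
    {v : π.smoothVectors} (hv : v ∈ π.kFinite) :
    ‖π.hDer v‖ ≤ κ * ‖A v - ζ • (v : V)‖ := by
  obtain ⟨s, f, hf, rfl⟩ := π.exists_sum_of_mem_kFinite hv
  refine (sq_le_sq₀ (norm_nonneg _) (by positivity)).1 ?_
  refine (π.norm_sq_hDer_le lam hlam _).trans ?_
  have h1 := (π.isDiagonal_neg_xiSq).re_inner_eq (s := s) hf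
  rw [LinearMap.neg_apply] at h1
  rw [h1, mul_pow, hA.norm_sq_sub_smul ζ hf, AddSubmonoidClass.coe_finsetSum,
    π.norm_sq_sum_of_mem_kSpace hf, Finset.mul_sum, Finset.mul_sum, ← Finset.sum_add_distrib]
  refine Finset.sum_le_sum fun k _ => ?_
  by_cases h0 : (f k : V) = 0
  · simp [h0]
  · have := mul_le_mul_of_nonneg_right (h k (π.mem_kTypes_of_mem_kSpace (hf k) h0))
      (sq_nonneg ‖(f k : V)‖)
    linarith

omit [CompleteSpace V] in
theorem inner_hDer_left (v w : π.smoothVectors) :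
    inner ℂ (π.hDer v) (w : V) = - inner ℂ (v : V) (π.hDer w) :=
  π.inner_lieDer_left isSmoothMap_expH expH_add v w

omit [CompleteSpace V] in
theorem re_inner_hDer_self (v : π.smoothVectors) : (inner ℂ (π.hDer v) (v : V)).re = 0 := by
  have h1 := congrArg Complex.re (inner_hDer_left v v)
  rw [Complex.neg_re, ← inner_conj_symm (v : V), Complex.conj_re] at h1
  linarith

omit [CompleteSpace V] in
theorem inner_neg_xiSq_symm (v w : π.smoothVectors) :
    inner ℂ ((-π.xiSq) v) (w : V) = inner ℂ (v : V) ((-π.xiSq) w) := by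
  rw [LinearMap.neg_apply, LinearMap.neg_apply, inner_neg_left, inner_neg_right]
  exact congrArg Neg.neg (π.inner_lieDerSq_symm isSmoothMap_expXi expXi_add v w)

/-- The resolvent of the closed operator given by `A + x H`, for a diagonal symmetric operator `A`
relative to which `x H` is small. -/
theorem IsDiagonal.exists_isResolventAt (hA : π.IsDiagonal A d)
    (hsymm : ∀ u v : π.smoothVectors, inner ℂ (A u) (v : V) = inner ℂ (u : V) (A v))
    {lam : ℝ} (hlam : π.HasCasimir lam) {x : ℝ} {ζ : ℂ} {κ m : ℝ} (hκ : 0 ≤ κ) (hxκ : |x| * κ < 1)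
    (hm : 0 < m) (hH : ∀ k ∈ π.kTypes, (k : ℝ) ^ 2 + lam / 4 ≤ κ ^ 2 * ‖(d k : ℂ) - ζ‖ ^ 2)
    (hd : ∀ k ∈ π.kTypes, m ≤ ‖(d k : ℂ) - ζ‖) :
    ∃ R : V →L[ℂ] V,
      IsResolventAt (LinearPMap.mk π.smoothVectors (A + (-(x : ℂ)) • π.hDer))† ζ R ∧
      ‖R‖ ≤ 1 / (m * (1 - |x| * κ)) ∧
      ∀ c : ℝ, (∀ k ∈ π.kTypes, c ≤ d k) → ζ.re < c → ‖R‖ ≤ 1 / (c - ζ.re) := by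
  have hconj : ∀ k, ‖(d k : ℂ) - conj ζ‖ = ‖(d k : ℂ) - ζ‖ := fun k => by
    rw [← Complex.norm_conj, map_sub, Complex.conj_conj, Complex.conj_ofReal]
  have hne : ∀ ξ : ℂ, (∀ k, ‖(d k : ℂ) - ξ‖ = ‖(d k : ℂ) - ζ‖) →
      ∀ k ∈ π.kTypes, (d k : ℂ) - ξ ≠ 0 := fun ξ hξ k hk => by
    rw [← norm_pos_iff, hξ]; exact hm.trans_le (hd k hk)
  -- Used for `(ζ, x)` and for `(conj ζ, -x)`: the formal adjoint of `A + x H` is `A - x H`.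
  have hdense : ∀ (ξ : ℂ) (y : ℝ), (∀ k, ‖(d k : ℂ) - ξ‖ = ‖(d k : ℂ) - ζ‖) → |y| * κ < 1 →
      DenseRange fun v : π.kFinite =>
        (A + (y : ℂ) • π.hDer) v - ξ • ((v : π.smoothVectors) : V) := by
    intro ξ y hξ hy
    have h1 := denseRange_add
      (A := (A - ξ • π.smoothVectors.subtype) ∘ₗ π.kFinite.subtype)
      (B := ((y : ℂ) • π.hDer) ∘ₗ π.kFinite.subtype) (mul_nonneg (abs_nonneg y) hκ) hy (fun v => by
        have h2 := hA.norm_hDer_le hlam (ζ := ξ) hκ (fun k hk => by rw [hξ]; exact hH k hk) v.2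
        change ‖(y : ℂ) • π.hDer v‖ ≤ |y| * κ * ‖A v - ξ • ((v : π.smoothVectors) : V)‖
        rw [norm_smul, Complex.norm_real, Real.norm_eq_abs, mul_assoc]
        exact mul_le_mul_of_nonneg_left h2 (abs_nonneg y)) (hA.denseRange_sub_smul (hne ξ hξ))
    refine (congrArg DenseRange (funext fun v => ?_)).mp h1
    change A v - ξ • ((v : π.smoothVectors) : V) + (y : ℂ) • π.hDer v =
      A v + (y : ℂ) • π.hDer v - ξ • ((v : π.smoothVectors) : V)
    abel
  have hpos : 0 < 1 - |x| * κ := by linarith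
  have hbound : ∀ v : π.smoothVectors, v ∈ π.kFinite →
      m * (1 - |x| * κ) * ‖(v : V)‖ ≤ ‖(A + (x : ℂ) • π.hDer) v - ζ • (v : V)‖ := by
    intro v hv
    have h1 := hA.le_norm_sub_smul hm.le hd hv
    have h2 := hA.norm_hDer_le hlam hκ hH hv
    have h3 : (A + (x : ℂ) • π.hDer) v - ζ • (v : V) =
        (A v - ζ • (v : V)) + (x : ℂ) • π.hDer v := by
      rw [LinearMap.add_apply, LinearMap.smul_apply]; abel
    have h4 : ‖(x : ℂ) • π.hDer v‖ ≤ |x| * κ * ‖A v - ζ • (v : V)‖ := by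
      rw [norm_smul, Complex.norm_real, Real.norm_eq_abs, mul_assoc]
      exact mul_le_mul_of_nonneg_left h2 (abs_nonneg x)
    rw [h3]
    have h5 := norm_sub_norm_le (A v - ζ • (v : V)) (-((x : ℂ) • π.hDer v))
    rw [norm_neg, sub_neg_eq_add] at h5
    nlinarith
  obtain ⟨R, hR, -, hRn⟩ := exists_isResolventAt_adjoint (L := A + (x : ℂ) • π.hDer)
    (L' := A + (-(x : ℂ)) • π.hDer) (π.dense_smoothVectors) (fun u v => by
      simp only [LinearMap.add_apply, LinearMap.smul_apply, inner_add_left, inner_add_right,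
        inner_smul_left, inner_smul_right, hsymm, inner_hDer_left, Complex.conj_ofReal]
      ring) π.kFinite (mul_pos hm hpos) hbound (hdense ζ x (fun _ => rfl) hxκ)
    (by
      have := hdense (conj ζ) (-x) hconj (by rwa [abs_neg])
      rwa [Complex.ofReal_neg] at this)
  refine ⟨R, hR, hRn _ (mul_pos hm hpos) hbound, fun c hc hζ => ?_⟩
  refine hRn _ (by linarith) fun v hv => ?_
  -- Skew-symmetry of `H` removes `x` from the real part of the quadratic form, which gives a bound
  -- independent of `x`.
  have h1 : (c - ζ.re) * ‖(v : V)‖ ^ 2 ≤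
      (inner ℂ ((A + (x : ℂ) • π.hDer) v - ζ • (v : V)) (v : V)).re := by
    have hA1 : c * ‖(v : V)‖ ^ 2 ≤ (inner ℂ (A v) (v : V)).re := by
      obtain ⟨s, f, hf, rfl⟩ := π.exists_sum_of_mem_kFinite hv
      rw [hA.re_inner_eq hf, AddSubmonoidClass.coe_finsetSum, π.norm_sq_sum_of_mem_kSpace hf,
        Finset.mul_sum]
      refine Finset.sum_le_sum fun k _ => ?_
      by_cases h0 : (f k : V) = 0
      · simp [h0]
      · exact mul_le_mul_of_nonneg_right (hc k (π.mem_kTypes_of_mem_kSpace (hf k) h0))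
          (sq_nonneg _)
    have h2 : (inner ℂ ((x : ℂ) • π.hDer v) (v : V)).re = 0 := by
      rw [inner_smul_left, Complex.conj_ofReal, Complex.re_ofReal_mul, re_inner_hDer_self, mul_zero]
    have h3 : (inner ℂ (ζ • (v : V)) (v : V)).re = ζ.re * ‖(v : V)‖ ^ 2 := by
      rw [inner_smul_left, inner_self_eq_norm_sq_to_K]
      change (conj ζ * (‖(v : V)‖ : ℂ) ^ 2).re = _
      rw [← Complex.ofReal_pow, Complex.re_mul_ofReal, Complex.conj_re]
    rw [inner_sub_left, LinearMap.add_apply, LinearMap.smul_apply, inner_add_left, Complex.sub_re,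
      Complex.add_re, h2, h3]
    linarith
  have h2 := h1.trans ((Complex.re_le_norm _).trans (norm_inner_le_norm _ _))
  by_cases h0 : ‖(v : V)‖ = 0
  · rw [h0, mul_zero]; exact norm_nonneg _
  · have hvpos : 0 < ‖(v : V)‖ := lt_of_le_of_ne (norm_nonneg _) (Ne.symm h0)
    nlinarith

theorem kineticOp_ofReal (x : ℝ) : π.kineticOp (x : ℂ) =
    (LinearPMap.mk π.smoothVectors (-π.xiSq + (-(x : ℂ)) • π.hDer))† := by
  rw [kineticOp, Complex.conj_ofReal]
  rfl

theorem maps_mk_adjoint_of_mem (hsymm : ∀ u v : π.smoothVectors,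
    inner ℂ (A u) (v : V) = inner ℂ (u : V) (A v)) (x : ℝ) (v : π.smoothVectors) :
    Maps (LinearPMap.mk π.smoothVectors (A + (-(x : ℂ)) • π.hDer))† v (A v + (x : ℂ) • π.hDer v) := by
  refine (maps_adjoint_iff (by exact π.dense_smoothVectors)).2 fun w => ?_
  change inner ℂ (A v + (x : ℂ) • π.hDer v) ((w : π.smoothVectors) : V) =
    inner ℂ (v : V) (A w + (-(x : ℂ)) • π.hDer w)
  simp only [inner_add_left, inner_add_right, inner_smul_left, inner_smul_right, hsymm,
    inner_hDer_left, Complex.conj_ofReal]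
  ring

theorem dense_kineticOp_domain (x : ℝ) : Dense ((π.kineticOp (x : ℂ)).domain : Set V) := by
  refine π.dense_smoothVectors.mono fun v hv => ?_
  rw [kineticOp_ofReal]
  exact (maps_mk_adjoint_of_mem inner_neg_xiSq_symm x ⟨v, hv⟩).choose

end UnitaryRep

end KineticBM

/-! ### Rank one perturbations of resolvents -/

namespace KineticBM

open Set Filter

section RankOne

variable {V : Type*} [NormedAddCommGroup V] [InnerProductSpace ℂ V] {T T₁ : V →ₗ.[ℂ] V} {e : V}
  {M ζ : ℂ} {R₁ : V →L[ℂ] V}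

/-- The Sherman–Morrison formula for `T = T₁ - M ⟪e, ·⟫ e`. -/
theorem IsResolventAt.of_rankOne
    (hT : ∀ u w, Maps T u w ↔ Maps T₁ u (w + (M * inner ℂ e u) • e)) (h : IsResolventAt T₁ ζ R₁)
    (hD : 1 - M * inner ℂ e (R₁ e) ≠ 0) :
    IsResolventAt T ζ (R₁ + (M / (1 - M * inner ℂ e (R₁ e))) •
      ((innerSL ℂ e).comp R₁).smulRight (R₁ e)) := by
  set D := 1 - M * inner ℂ e (R₁ e) with hDdef
  have hb : M * inner ℂ e (R₁ e) = 1 - D := by rw [hDdef]; ring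
  have happ : ∀ w, (R₁ + (M / D) • ((innerSL ℂ e).comp R₁).smulRight (R₁ e)) w =
      R₁ w + (M / D * inner ℂ e (R₁ w)) • R₁ e := fun w => by simp [smul_smul]
  refine isResolventAt_iff.2 ⟨fun w => ?_, fun u w huw => ?_⟩
  · refine (hT _ _).2 ?_
    have h1 := (h.maps w).add ((h.maps e).smul (M / D * inner ℂ e (R₁ w)))
    have h2 : M * inner ℂ e (R₁ w + (M / D * inner ℂ e (R₁ w)) • R₁ e) =
        M / D * inner ℂ e (R₁ w) := by
      rw [inner_add_right, inner_smul_right]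
      calc M * (inner ℂ e (R₁ w) + M / D * inner ℂ e (R₁ w) * inner ℂ e (R₁ e))
          = M * inner ℂ e (R₁ w) + M / D * inner ℂ e (R₁ w) * (M * inner ℂ e (R₁ e)) := by ring
        _ = M / D * inner ℂ e (R₁ w) := by rw [hb]; field_simp; ring
    rw [happ, h2]
    convert h1 using 1
    module
  · have h1 := h.apply_of_maps ((hT u w).1 huw)
    have h2 : w + (M * inner ℂ e u) • e - ζ • u = (w - ζ • u) + (M * inner ℂ e u) • e := by abel
    rw [h2, map_add, map_smul] at h1
    have h3 : inner ℂ e (R₁ (w - ζ • u)) = D * inner ℂ e u := by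
      have := congrArg (inner ℂ e) h1
      rw [inner_add_right, inner_smul_right] at this
      rw [hDdef]
      linear_combination this
    rw [happ, h3]
    refine Eq.trans ?_ h1
    congr 2
    field_simp

theorem IsResolventAt.maps_of_rankOne
    (hT : ∀ u w, Maps T u w ↔ Maps T₁ u (w + (M * inner ℂ e u) • e)) (h : IsResolventAt T₁ ζ R₁)
    (hD : 1 - M * inner ℂ e (R₁ e) = 0) : Maps T (R₁ e) (ζ • R₁ e) := by
  refine (hT _ _).2 ?_
  rw [← sub_eq_zero.1 hD, one_smul, add_comm]
  exact h.maps e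

theorem IsResolventAt.eq_smul_of_rankOne
    (hT : ∀ u w, Maps T u w ↔ Maps T₁ u (w + (M * inner ℂ e u) • e)) (h : IsResolventAt T₁ ζ R₁)
    {u : V} (hu : Maps T u (ζ • u)) : u = (M * inner ℂ e u) • R₁ e := by
  have h1 := h.apply_of_maps ((hT _ _).1 hu)
  rw [add_sub_cancel_left, map_smul] at h1
  exact h1.symm

end RankOne

/-! ### The Riesz projection at a simple pole -/

section SimplePole

variable {V : Type*} [NormedAddCommGroup V] [InnerProductSpace ℂ V] [CompleteSpace V]
  {T : V →ₗ.[ℂ] V} {μ : ℂ}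

omit [CompleteSpace V] in
theorem mem_opSpectrum_of_maps {u : V} (h0 : u ≠ 0) (hu : Maps T u (μ • u)) : μ ∈ opSpectrum T := by
  rintro ⟨R, hR⟩
  have := hR.apply_of_maps hu
  rw [sub_self, map_zero] at this
  exact h0 this.symm

/-- The Riesz projection at a simple pole `μ` of the resolvent, and the holomorphic part of the
resolvent. -/
theorem circleProjection_of_simplePole (hμ : ‖μ‖ < 1 / 2)
    (hρ : ∀ ζ : ℂ, ζ.re ≤ 1 / 2 → ζ ≠ μ → ζ ∉ opSpectrum T) {C : ℝ}
    (hC : ∀ ζ : ℂ, ‖ζ‖ < 1 / 2 → ζ ≠ μ → ‖ζ - μ‖ * ‖opResolvent T ζ‖ ≤ C) :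
    CircleIntegrable (opResolvent T) 0 (1 / 2) ∧
      (∀ u, Maps T (circleProjection T u) (μ • circleProjection T u)) ∧
      (∀ u, Maps T u (μ • u) → circleProjection T u = u) ∧
      ∃ N : ℂ → V →L[ℂ] V, ContinuousOn N {z | z.re ≤ 1 / 2} ∧
        DifferentiableOn ℂ N {z | z.re < 1 / 2} ∧
        ∀ ζ : ℂ, ζ.re ≤ 1 / 2 → 1 / 2 ≤ ‖ζ‖ → ∀ u,
          N ζ (N ζ u) = opResolvent T ζ (opResolvent T ζ (u - circleProjection T u)) := by
  have hre : ∀ ζ : ℂ, ‖ζ‖ ≤ 1 / 2 → ζ.re ≤ 1 / 2 := fun ζ h =>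
    ((le_abs_self _).trans (Complex.abs_re_le_norm ζ)).trans h
  have hμre : μ.re < 1 / 2 := ((le_abs_self _).trans (Complex.abs_re_le_norm μ)).trans_lt hμ
  have hUo : IsOpen {z : ℂ | z.re < 1 / 2} := isOpen_lt Complex.continuous_re continuous_const
  have hU : {z : ℂ | z.re < 1 / 2} ∈ 𝓝 μ := hUo.mem_nhds hμre
  set f₀ : ℂ → V →L[ℂ] V := fun ζ => (ζ - μ) • opResolvent T ζ with hf₀
  have hd₀ : DifferentiableOn ℂ f₀ ({z : ℂ | z.re < 1 / 2} \ {μ}) :=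
    (by fun_prop : DifferentiableOn ℂ (fun ζ : ℂ => ζ - μ) _).smul
      (differentiableOn_opResolvent fun z hz => hρ z (le_of_lt hz.1) hz.2)
  have hbd : BddAbove (norm ∘ f₀ '' (Metric.ball 0 (1 / 2) \ {μ})) := by
    refine ⟨C, ?_⟩
    rintro _ ⟨z, ⟨hz, hzμ⟩, rfl⟩
    change ‖(z - μ) • opResolvent T z‖ ≤ C
    rw [norm_smul]
    exact hC z (mem_ball_zero_iff.1 hz) hzμ
  have hballU : Metric.ball (0 : ℂ) (1 / 2) ⊆ {z : ℂ | z.re < 1 / 2} := fun z hz =>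
    ((le_abs_self _).trans (Complex.abs_re_le_norm z)).trans_lt (mem_ball_zero_iff.1 hz)
  have hball : Metric.ball (0 : ℂ) (1 / 2) ∈ 𝓝 μ :=
    Metric.isOpen_ball.mem_nhds (mem_ball_zero_iff.2 hμ)
  set L := limUnder (𝓝[≠] μ) f₀
  -- Riemann's removable singularity theorem applies to `(ζ - μ) R(ζ)`, which is bounded near `μ`;
  -- the value `L` at `μ` is the residue.
  set f := Function.update f₀ μ L with hf
  have hfμ : f μ = L := Function.update_self _ _ _
  have hfne : ∀ ζ, ζ ≠ μ → f ζ = (ζ - μ) • opResolvent T ζ := fun ζ h =>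
    Function.update_of_ne h _ _
  have hfball : DifferentiableOn ℂ f (Metric.ball 0 (1 / 2)) :=
    Complex.differentiableOn_update_limUnder_of_bddAbove hball
      (hd₀.mono fun z hz => ⟨hballU hz.1, hz.2⟩) hbd
  have hfat : DifferentiableAt ℂ f μ := hfball.differentiableAt hball
  have hfd : DifferentiableOn ℂ f {z : ℂ | z.re < 1 / 2} := by
    intro z hz
    by_cases hzμ : z = μ
    · rw [hzμ]
      exact hfat.differentiableWithinAt
    · have h1 : DifferentiableAt ℂ f₀ z :=
        hd₀.differentiableAt ((hUo.sdiff isClosed_singleton).mem_nhds ⟨hz, hzμ⟩)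
      exact (h1.congr_of_eventuallyEq (by
        filter_upwards [isOpen_ne.mem_nhds hzμ] with w hw
        exact Function.update_of_ne hw _ _)).differentiableWithinAt
  have hfc : ContinuousOn f {z : ℂ | z.re ≤ 1 / 2} := by
    intro z hz
    by_cases hzμ : z = μ
    · rw [hzμ]
      exact hfat.continuousAt.continuousWithinAt
    · have h1 : ContinuousWithinAt f₀ ({z : ℂ | z.re ≤ 1 / 2} \ {μ}) z :=
        ((by fun_prop : Continuous fun ζ : ℂ => ζ - μ).continuousWithinAt).smul
          ((continuousOn_opResolvent z (hρ z hz hzμ)).mono fun w hw => hρ w hw.1 hw.2)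
      have h2 : ContinuousWithinAt f ({z : ℂ | z.re ≤ 1 / 2} \ {μ}) z :=
        h1.congr (fun w hw => Function.update_of_ne hw.2 _ _) (Function.update_of_ne hzμ _ _)
      refine h2.mono_of_mem_nhdsWithin ?_
      exact inter_mem self_mem_nhdsWithin (mem_nhdsWithin_of_mem_nhds (isOpen_ne.mem_nhds hzμ))
  have hsphere : ∀ ζ ∈ Metric.sphere (0 : ℂ) (1 / 2), ζ.re ≤ 1 / 2 ∧ ζ ≠ μ := by
    intro ζ hζ
    rw [mem_sphere_zero_iff_norm] at hζ
    refine ⟨hre ζ hζ.le, ?_⟩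
    rintro rfl
    exact hμ.ne hζ
  have hci : CircleIntegrable (opResolvent T) 0 (1 / 2) :=
    (continuousOn_opResolvent.mono fun ζ hζ =>
      hρ ζ (hsphere ζ hζ).1 (hsphere ζ hζ).2).circleIntegrable (by norm_num)
  -- Cauchy's integral formula for `f` at `μ`.
  have hP : circleProjection T = -L := by
    have h1 : (∮ ζ in C(0, 1 / 2), opResolvent T ζ) = ∮ ζ in C(0, 1 / 2), (ζ - μ)⁻¹ • f ζ := by
      refine circleIntegral.integral_congr (by norm_num) fun ζ hζ => ?_
      have hne := (hsphere ζ hζ).2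
      change _ = (ζ - μ)⁻¹ • f ζ
      rw [hfne ζ hne, inv_smul_smul₀ (sub_ne_zero.2 hne)]
    have h2 := Complex.circleIntegral_sub_inv_smul_of_differentiable_on_off_countable
      countable_empty (mem_ball_zero_iff.2 hμ)
      (hfc.mono fun z hz => hre z (mem_closedBall_zero_iff.1 hz))
      (fun z hz => hfball.differentiableAt (Metric.isOpen_ball.mem_nhds hz.1))
    rw [circleProjection, h1, h2, hfμ, neg_smul, inv_smul_smul₀]
    simp [Real.pi_ne_zero]
  have hlim : Tendsto f₀ (𝓝[≠] μ) (𝓝 L) := by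
    have h1 : Tendsto f (𝓝[≠] μ) (𝓝 L) := by
      rw [← hfμ]; exact hfat.continuousAt.tendsto.mono_left nhdsWithin_le_nhds
    exact h1.congr' (by
      filter_upwards [self_mem_nhdsWithin] with w hw
      exact Function.update_of_ne hw _ _)
  have hnear : ∀ᶠ ζ in 𝓝[≠] μ, ζ.re ≤ 1 / 2 ∧ ζ ≠ μ := by
    filter_upwards [nhdsWithin_le_nhds hU, self_mem_nhdsWithin] with ζ h1 h2
    exact ⟨le_of_lt h1, h2⟩
  have hcomm : ∀ ξ : ℂ, ξ.re ≤ 1 / 2 → ξ ≠ μ → (opResolvent T ξ).comp L = L.comp (opResolvent T ξ) := by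
    intro ξ hξ hξμ
    have h1 : Tendsto (fun ζ => (opResolvent T ξ).comp (f₀ ζ)) (𝓝[≠] μ)
        (𝓝 ((opResolvent T ξ).comp L)) := (continuous_const.clm_comp continuous_id).continuousAt.tendsto.comp hlim
    have h2 : Tendsto (fun ζ => (f₀ ζ).comp (opResolvent T ξ)) (𝓝[≠] μ)
        (𝓝 (L.comp (opResolvent T ξ))) := (continuous_id.clm_comp continuous_const).continuousAt.tendsto.comp hlim
    refine tendsto_nhds_unique h1 (h2.congr' ?_)
    filter_upwards [hnear] with ζ hζ
    simp only [hf₀, ContinuousLinearMap.comp_smul, ContinuousLinearMap.smul_comp]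
    rw [(isResolventAt_opResolvent (hρ ξ hξ hξμ)).comm
      (isResolventAt_opResolvent (hρ ζ hζ.1 hζ.2))]
  -- The resolvent identity multiplied by `ζ - μ`, in the limit `ζ → μ`. It shows that the range of
  -- `L` consists of eigenvectors.
  have hRL : ∀ ξ : ℂ, ξ.re ≤ 1 / 2 → ξ ≠ μ → (μ - ξ) • (opResolvent T ξ).comp L = L := by
    intro ξ hξ hξμ
    have h1 : Tendsto (fun ζ => (ζ - ξ) • (opResolvent T ξ).comp (f₀ ζ)) (𝓝[≠] μ)
        (𝓝 ((μ - ξ) • (opResolvent T ξ).comp L)) := by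
      have hz : Tendsto (fun ζ : ℂ => ζ - ξ) (𝓝[≠] μ) (𝓝 (μ - ξ)) :=
        ((by fun_prop : Continuous fun ζ : ℂ => ζ - ξ).tendsto μ).mono_left nhdsWithin_le_nhds
      exact hz.smul
        ((continuous_const.clm_comp continuous_id).continuousAt.tendsto.comp hlim)
    have h2 : Tendsto (fun ζ => f₀ ζ - (ζ - μ) • opResolvent T ξ) (𝓝[≠] μ) (𝓝 (L - (μ - μ) • opResolvent T ξ)) := by
      have hz : Tendsto (fun ζ : ℂ => ζ - μ) (𝓝[≠] μ) (𝓝 (μ - μ)) :=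
        ((by fun_prop : Continuous fun ζ : ℂ => ζ - μ).tendsto μ).mono_left nhdsWithin_le_nhds
      exact hlim.sub (hz.smul_const _)
    rw [sub_self, zero_smul, sub_zero] at h2
    refine tendsto_nhds_unique h1 (h2.congr' ?_)
    filter_upwards [hnear] with ζ hζ
    have h3 := (isResolventAt_opResolvent (hρ ζ hζ.1 hζ.2)).sub_eq
      (isResolventAt_opResolvent (hρ ξ hξ hξμ))
    rw [(isResolventAt_opResolvent (hρ ζ hζ.1 hζ.2)).comm
      (isResolventAt_opResolvent (hρ ξ hξ hξμ))] at h3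
    simp only [hf₀, ContinuousLinearMap.comp_smul]
    rw [← smul_sub, h3, smul_comm]
  have hmaps : ∀ u, Maps T (L u) (μ • L u) := by
    intro u
    have hξ : (-1 : ℂ).re ≤ 1 / 2 := by norm_num
    have hξμ : (-1 : ℂ) ≠ μ := by
      rintro rfl
      norm_num at hμ
    have h1 := congrArg (fun A : V →L[ℂ] V => A u) (hRL (-1) hξ hξμ)
    have h1 : (μ - (-1)) • opResolvent T (-1) (L u) = L u := h1
    have h2 := ((isResolventAt_opResolvent (hρ _ hξ hξμ)).maps (L u)).smul (μ - (-1))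
    rw [h1, smul_add, smul_comm, h1, ← add_smul] at h2
    rwa [sub_add_cancel] at h2
  have hfix : ∀ u, Maps T u (μ • u) → L u = -u := by
    intro u hu
    have h1 : Tendsto (fun ζ => f₀ ζ u) (𝓝[≠] μ) (𝓝 (L u)) :=
      (ContinuousLinearMap.apply ℂ V u).continuous.continuousAt.tendsto.comp hlim
    refine tendsto_nhds_unique h1 (tendsto_const_nhds.congr' ?_)
    filter_upwards [hnear] with ζ hζ
    have h2 := (isResolventAt_opResolvent (hρ ζ hζ.1 hζ.2)).apply_of_maps hu
    rw [← sub_smul, map_smul] at h2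
    change -u = (ζ - μ) • opResolvent T ζ u
    rw [← neg_sub μ ζ, neg_smul, h2]
  have hLL : ∀ u, L (L u) = - L u := fun u => hfix _ (hmaps u)
  -- The resolvent minus its polar part `L / (ζ - μ)` is the slope of `f` at `μ`; off `μ` it equals
  -- `R(ζ) (1 - P)`.
  have hN : ∀ ζ : ℂ, ζ.re ≤ 1 / 2 → ζ ≠ μ → ∀ u, dslope f μ ζ u = opResolvent T ζ (u + L u) := by
    intro ζ hζ hζμ u
    rw [dslope_of_ne _ hζμ, slope_def_module, hfμ, hfne ζ hζμ, smul_sub,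
      inv_smul_smul₀ (sub_ne_zero.2 hζμ), map_add, sub_eq_add_neg]
    have h1 := congrArg (fun A : V →L[ℂ] V => A u) (hRL ζ hζ hζμ)
    have h1 : (μ - ζ) • opResolvent T ζ (L u) = L u := h1
    change opResolvent T ζ u + -((ζ - μ)⁻¹ • L u) = _
    nth_rewrite 1 [← h1]
    rw [smul_smul, ← neg_smul, ← neg_sub ζ μ, mul_neg, neg_neg,
      inv_mul_cancel₀ (sub_ne_zero.2 hζμ), one_smul]
  refine ⟨hci, fun u => ?_, fun u hu => ?_, dslope f μ, ?_, ?_, ?_⟩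
  · rw [hP]
    have := (hmaps u).smul (-1)
    rw [smul_comm, neg_one_smul] at this
    exact this
  · rw [hP]
    change -(L u) = u
    rw [hfix u hu, neg_neg]
  · exact (continuousOn_dslope (s := {z : ℂ | z.re ≤ 1 / 2})
      (mem_of_superset hU fun z (hz : z.re < 1 / 2) => (hz.le : z.re ≤ 1 / 2))).2 ⟨hfc, hfat⟩
  · exact (Complex.differentiableOn_dslope hU).2 hfd
  · intro ζ hζ hζn u
    have hζμ : ζ ≠ μ := by
      rintro rfl
      exact absurd hμ (not_lt.2 hζn)
    have hc := fun w => congrArg (fun A : V →L[ℂ] V => A w) (hcomm ζ hζ hζμ)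
    have hc : ∀ w, opResolvent T ζ (L w) = L (opResolvent T ζ w) := hc
    rw [hN ζ hζ hζμ, hN ζ hζ hζμ, hP, ← hc, map_add L, hLL, add_neg_cancel, map_zero, add_zero]
    change _ = opResolvent T ζ (opResolvent T ζ (u - -(L u)))
    rw [sub_neg_eq_add]

end SimplePole

end KineticBM

/-! ### The secular equation and the eigenvalue near zero -/

namespace KineticBM

theorem norm_sq_ofReal_sub (q : ℝ) (ζ : ℂ) :
    ‖(q : ℂ) - ζ‖ ^ 2 = (q - ζ.re) ^ 2 + ζ.im ^ 2 := by
  rw [← Complex.normSq_eq_norm_sq, Complex.normSq_apply]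
  simp only [Complex.sub_re, Complex.ofReal_re, Complex.sub_im, Complex.ofReal_im]
  ring

theorem norm_le_norm_ofReal_sub {q : ℝ} (hq : 1 ≤ q) {ζ : ℂ} (hζ : ζ.re ≤ 1 / 2) :
    ‖ζ‖ ≤ ‖(q : ℂ) - ζ‖ := by
  refine (sq_le_sq₀ (norm_nonneg _) (norm_nonneg _)).1 ?_
  rw [norm_sq_ofReal_sub, ← Complex.normSq_eq_norm_sq, Complex.normSq_apply]
  nlinarith

theorem sub_half_le_norm_ofReal_sub (q : ℝ) {ζ : ℂ} (hζ : ζ.re ≤ 1 / 2) :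
    q - 1 / 2 ≤ ‖(q : ℂ) - ζ‖ := by
  have h := Complex.re_le_norm ((q : ℂ) - ζ)
  rw [Complex.sub_re, Complex.ofReal_re] at h
  linarith

/-- Uses `4 (q - 1/2)² - q = (4q - 1)(q - 1) ≥ 0`. -/
theorem le_four_mul_norm_sq_ofReal_sub {q : ℝ} (hq : 1 ≤ q) {ζ : ℂ} (hζ : ζ.re ≤ 1 / 2) :
    q ≤ 4 * ‖(q : ℂ) - ζ‖ ^ 2 := by
  have h1 := pow_le_pow_left₀ (by linarith) (sub_half_le_norm_ofReal_sub q hζ) 2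
  nlinarith

/-- A contraction of the half plane `Re ζ ≤ 1/2` into a smaller disc has a fixed point. -/
theorem exists_fixedPoint_halfPlane {Φ : ℂ → ℂ} {q : ℝ} (hq0 : 0 ≤ q) (hq : q < 1)
    (hb : ∀ ζ : ℂ, ζ.re ≤ 1 / 2 → ‖Φ ζ‖ < 1 / 2)
    (hL : ∀ ζ ξ : ℂ, ζ.re ≤ 1 / 2 → ξ.re ≤ 1 / 2 → ‖Φ ζ - Φ ξ‖ ≤ q * ‖ζ - ξ‖) :
    ∃ μ : ℂ, ‖μ‖ < 1 / 2 ∧ Φ μ = μ ∧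
      ∀ ζ : ℂ, ζ.re ≤ 1 / 2 → (1 - q) * ‖ζ - μ‖ ≤ ‖Φ ζ - ζ‖ := by
  have hre : ∀ ζ ∈ Metric.closedBall (0 : ℂ) (1 / 2), ζ.re ≤ 1 / 2 := fun ζ h =>
    ((le_abs_self _).trans (Complex.abs_re_le_norm ζ)).trans (mem_closedBall_zero_iff.1 h)
  have hmaps : Set.MapsTo Φ (Metric.closedBall (0 : ℂ) (1 / 2)) (Metric.closedBall (0 : ℂ) (1 / 2)) :=
    fun ζ h => mem_closedBall_zero_iff.2 (hb ζ (hre ζ h)).le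
  have hcon : ContractingWith ⟨q, hq0⟩ (hmaps.restrict Φ _ _) := by
    refine ⟨by exact_mod_cast hq, LipschitzWith.of_dist_le_mul fun a b => ?_⟩
    rw [Subtype.dist_eq, Subtype.dist_eq, dist_eq_norm, dist_eq_norm]
    exact hL a b (hre a a.2) (hre b b.2)
  obtain ⟨μ, hμ, hfix, -⟩ := hcon.exists_fixedPoint' Metric.isClosed_closedBall.isComplete hmaps
    (x := 0) (by simp) (edist_ne_top _ _)
  have hfix : Φ μ = μ := hfix
  refine ⟨μ, ?_, hfix, fun ζ hζ => ?_⟩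
  · rw [← hfix]; exact hb μ (hre μ hμ)
  · have h1 := hL ζ μ hζ (hre μ hμ)
    rw [hfix] at h1
    have h2 : ζ - μ = (Φ ζ - μ) - (Φ ζ - ζ) := by ring
    have h3 := norm_sub_le (Φ ζ - μ) (Φ ζ - ζ)
    rw [← h2] at h3
    linarith

namespace UnitaryRep

variable {V : Type*} [NormedAddCommGroup V] [InnerProductSpace ℂ V] [CompleteSpace V]
  {π : UnitaryRep V}

theorem HasCasimir.unique [Nontrivial V] {a b : ℝ} (ha : π.HasCasimir a) (hb : π.HasCasimir b) :
    a = b := by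
  obtain ⟨v, hv⟩ := exists_ne (0 : V)
  obtain ⟨w, hw, hws⟩ := π.dense_smoothVectors.inter_open_nonempty _ isOpen_ne ⟨v, hv⟩
  have h1 := (ha ⟨w, hws⟩).symm.trans (hb ⟨w, hws⟩)
  exact Complex.ofReal_injective (smul_left_injective ℂ hw h1)

section Resolvent

variable {lam x κ : ℝ}

theorem opResolvent_kineticOp (hlam : π.HasCasimir lam) (hκ : 0 ≤ κ) (hxκ : |x| * κ < 1) {ζ : ℂ}
    {m : ℝ} (hm : 0 < m)
    (hH : ∀ k ∈ π.kTypes,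
      (k : ℝ) ^ 2 + lam / 4 ≤ κ ^ 2 * ‖(((k : ℝ) ^ 2 : ℝ) : ℂ) - ζ‖ ^ 2)
    (hd : ∀ k ∈ π.kTypes, m ≤ ‖(((k : ℝ) ^ 2 : ℝ) : ℂ) - ζ‖) :
    ζ ∉ opSpectrum (π.kineticOp x) ∧
      ‖opResolvent (π.kineticOp x) ζ‖ ≤ 1 / (1 - |x| * κ) / m := by
  obtain ⟨R, hR, hn, -⟩ := (π.isDiagonal_neg_xiSq).exists_isResolventAt inner_neg_xiSq_symm hlam hκ
    hxκ hm hH hd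
  rw [← kineticOp_ofReal] at hR
  refine ⟨hR.notMem_opSpectrum, ?_⟩
  rw [hR.opResolvent_eq, div_div, mul_comm]
  exact hn

theorem isContractionSemigroup_kineticOp (hlam : π.HasCasimir lam) (hκ : 0 ≤ κ)
    (hxκ : |x| * κ < 1)
    (hH : ∀ ζ : ℂ, ζ.re ≤ 1 / 2 → 1 / 2 ≤ ‖ζ‖ → ∀ k ∈ π.kTypes,
      (k : ℝ) ^ 2 + lam / 4 ≤ κ ^ 2 * ‖(((k : ℝ) ^ 2 : ℝ) : ℂ) - ζ‖ ^ 2) :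
    IsContractionSemigroup (π.kineticOp x) (expNeg (π.kineticOp x)) := by
  refine isContractionSemigroup_expNeg
    (exists_isContractionSemigroup (dense_kineticOp_domain x) fun a ha => ?_)
  have hre : (-(a : ℂ)).re = -a := by simp
  have hn : ‖(-(a : ℂ))‖ = a := by
    rw [norm_neg, Complex.norm_real, Real.norm_eq_abs, abs_of_nonneg (by linarith)]
  obtain ⟨R, hR, -, h0⟩ := (π.isDiagonal_neg_xiSq).exists_isResolventAt inner_neg_xiSq_symm hlam hκ
    hxκ one_pos (hH (-(a : ℂ)) (by rw [hre]; linarith) (by rw [hn]; linarith)) (fun k _ => by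
      have := Complex.re_le_norm ((((k : ℝ) ^ 2 : ℝ) : ℂ) - -(a : ℂ))
      rw [Complex.sub_re, Complex.ofReal_re, hre] at this
      nlinarith [sq_nonneg (k : ℝ)])
  rw [← kineticOp_ofReal] at hR
  refine ⟨R, hR, ?_⟩
  have := h0 0 (fun k _ => sq_nonneg _) (by rw [hre]; linarith)
  rwa [hre, zero_sub, neg_neg] at this

end Resolvent

theorem one_le_sq_of_ne_zero {k : ℤ} (hk : k ≠ 0) : (1 : ℝ) ≤ (k : ℝ) ^ 2 := by
  have : (1 : ℤ) ≤ k ^ 2 := by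
    have := pow_pos (abs_pos.2 hk) 2
    rw [sq_abs] at this
    omega
  exact_mod_cast this

/-- From `q ≤ 4 |q - ζ|²` and `q ≥ 1` also `λ/4 ≤ λ |q - ζ|²`, so even `λ + 4` would do as the
factor. -/
theorem sq_add_casimir_le {lam : ℝ} (hlam : 0 ≤ lam) {q : ℝ} (hq : 1 ≤ q) {ζ : ℂ}
    (hζ : ζ.re ≤ 1 / 2) : q + lam / 4 ≤ (lam + 6) * ‖(q : ℂ) - ζ‖ ^ 2 := by
  have h1 := le_four_mul_norm_sq_ofReal_sub hq hζ
  nlinarith [sq_nonneg ‖(q : ℂ) - ζ‖]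

section Augmented

variable (π) (e : V)

/-- The operator `-Ξ² + 2 ⟪e, ·⟫ e` on smooth vectors. -/
def augXiSq : π.smoothVectors →ₗ[ℂ] V :=
  -π.xiSq + ((2 : ℂ) • ((innerSL ℂ e).toLinearMap ∘ₗ π.smoothVectors.subtype)).smulRight e

omit [CompleteSpace V] in
theorem augXiSq_apply (v : π.smoothVectors) :
    π.augXiSq e v = (-π.xiSq) v + (2 * inner ℂ e (v : V)) • e := rfl

/-- The closed operator given by `-Ξ² + 2 ⟪e, ·⟫ e + x H`. -/
def augOp (x : ℝ) : V →ₗ.[ℂ] V :=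
  (LinearPMap.mk π.smoothVectors (π.augXiSq e + (-(x : ℂ)) • π.hDer))†

variable {π e}

omit [CompleteSpace V] in
theorem inner_augXiSq_symm (v w : π.smoothVectors) :
    inner ℂ (π.augXiSq e v) (w : V) = inner ℂ (v : V) (π.augXiSq e w) := by
  rw [augXiSq_apply, augXiSq_apply, inner_add_left, inner_add_right, inner_neg_xiSq_symm,
    inner_smul_left, inner_smul_right, map_mul, inner_conj_symm, Complex.conj_ofNat]
  ring

theorem maps_kineticOp_iff_augOp (x : ℝ) (u w : V) :
    Maps (π.kineticOp x) u w ↔ Maps (π.augOp e x) u (w + ((2 : ℂ) * inner ℂ e u) • e) := by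
  rw [kineticOp_ofReal, augOp, maps_adjoint_iff (by exact π.dense_smoothVectors),
    maps_adjoint_iff (by exact π.dense_smoothVectors)]
  refine forall_congr' fun v => ?_
  change inner ℂ w (v : V) = inner ℂ u ((-π.xiSq) v + (-(x : ℂ)) • π.hDer v) ↔
    inner ℂ (w + ((2 : ℂ) * inner ℂ e u) • e) (v : V) =
      inner ℂ u (π.augXiSq e v + (-(x : ℂ)) • π.hDer v)
  rw [augXiSq_apply, inner_add_left, inner_add_right, inner_add_right, inner_add_right,
    inner_smul_left, inner_smul_right _ _ (2 * _), map_mul, inner_conj_symm, Complex.conj_ofNat]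
  constructor <;> intro h <;> linear_combination h

/-- Multiplicity one enters here: the rank one term acts on all of `V_0` and raises its eigenvalue
from `0` to `2`, leaving the others unchanged. -/
theorem isDiagonal_augXiSq (he : e ∈ π.kSpace 0)
    (hspan : ∀ v ∈ π.kSpace 0, inner ℂ e v • e = v) :
    π.IsDiagonal (π.augXiSq e) (fun k => if k = 0 then 2 else (k : ℝ) ^ 2) := by
  intro k v hv
  rw [augXiSq_apply, π.isDiagonal_neg_xiSq k v hv]
  by_cases hk : k = 0
  · subst hk
    rw [mul_smul, hspan _ hv]
    simp
  · rw [π.inner_eq_zero_of_kSpace (Ne.symm hk) he hv]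
    simp [hk]

variable {lam x : ℝ}

/-- The eigenvalues of the augmented operator are at least `1`, so the relative bound persists
inside the disc. The norm bound comes from the quadratic form: `1 / (1 - 1/2) = 2`. -/
theorem opResolvent_augOp (hlam : π.HasCasimir lam) (hpos : 0 < lam) (hx : |x| * √(lam + 6) < 1)
    (he : e ∈ π.kSpace 0) (hspan : ∀ v ∈ π.kSpace 0, inner ℂ e v • e = v) {ζ : ℂ}
    (hζ : ζ.re ≤ 1 / 2) :
    IsResolventAt (π.augOp e x) ζ (opResolvent (π.augOp e x) ζ) ∧
      ‖opResolvent (π.augOp e x) ζ‖ ≤ 2 := by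
  have hd1 : ∀ k : ℤ, (1 : ℝ) ≤ if k = 0 then 2 else (k : ℝ) ^ 2 := by
    intro k
    split_ifs with hk
    · norm_num
    · exact one_le_sq_of_ne_zero hk
  have hk2 : ∀ k : ℤ, (k : ℝ) ^ 2 ≤ if k = 0 then 2 else (k : ℝ) ^ 2 := by
    intro k
    split_ifs with hk
    · simp [hk]
    · exact le_rfl
  obtain ⟨R, hR, -, hc⟩ := (isDiagonal_augXiSq he hspan).exists_isResolventAt inner_augXiSq_symm
    hlam (Real.sqrt_nonneg _) hx (ζ := ζ) (m := 1 / 2) (by norm_num)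
    (fun k _ => by
      rw [Real.sq_sqrt (by linarith)]
      have := sq_add_casimir_le hpos.le (hd1 k) hζ
      linarith [hk2 k])
    (fun k _ => by
      have := sub_half_le_norm_ofReal_sub (if k = 0 then 2 else (k : ℝ) ^ 2) hζ
      linarith [hd1 k])
  have hRa : IsResolventAt (π.augOp e x) ζ R := hR
  rw [hRa.opResolvent_eq]
  refine ⟨hRa, (hc 1 (fun k _ => hd1 k) (by linarith)).trans ?_⟩
  rw [div_le_iff₀ (by linarith)]
  linarith

end Augmented

section Eigenvalue

variable {lam x : ℝ} {e : π.smoothVectors}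

theorem augXiSq_self (he : (e : V) ∈ π.kSpace 0)
    (hspan : ∀ v ∈ π.kSpace 0, inner ℂ (e : V) v • (e : V) = v) :
    π.augXiSq e e = (2 : ℂ) • (e : V) := by
  have := isDiagonal_augXiSq he hspan 0 e he
  simpa using this

/-- The secular equation for the resolvent of `-Ξ² + x H` as a rank one perturbation. -/
theorem secular_identity (hn : ‖e‖ = 1) (he : (e : V) ∈ π.kSpace 0)
    (hspan : ∀ v ∈ π.kSpace 0, inner ℂ (e : V) v • (e : V) = v) {ζ : ℂ} {R : V →L[ℂ] V}
    (hR : IsResolventAt (π.augOp e x) ζ R) (hζ : 2 - ζ ≠ 0) :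
    (2 - ζ) * (1 - 2 * inner ℂ (e : V) (R e)) =
      2 * (x : ℂ) ^ 2 / (2 - ζ) * inner ℂ (π.hDer e) (R (π.hDer e)) - ζ := by
  have hn' : ‖(e : V)‖ = 1 := hn
  have hee : inner ℂ (e : V) (e : V) = 1 := by
    rw [inner_self_eq_norm_sq_to_K, hn']; simp
  have hhe : inner ℂ (π.hDer e) (e : V) = 0 := by
    rw [← inner_conj_symm, π.inner_hDer_of_mem_zero e e he he, map_zero]
  -- Apply `R` to the image `(2 - ζ) e + x H e` of `e` under the augmented operator minus `ζ`.
  have hstrong : (2 - ζ) • R e = e - (x : ℂ) • R (π.hDer e) := by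
    have h1 := hR.apply_of_maps (maps_mk_adjoint_of_mem inner_augXiSq_symm x e)
    rw [augXiSq_self he hspan] at h1
    have h2 : (2 : ℂ) • (e : V) + (x : ℂ) • π.hDer e - ζ • (e : V) =
        (2 - ζ) • (e : V) + (x : ℂ) • π.hDer e := by module
    rw [h2, map_add, map_smul, map_smul] at h1
    exact eq_sub_of_add_eq h1
  -- Pair the equation for `R (H e)` with `e` and let the formal adjoint act on `e`, using `⟪e, H e⟫
  -- = 0`.
  have hweak : (2 - ζ) * inner ℂ (e : V) (R (π.hDer e)) =
      (x : ℂ) * inner ℂ (π.hDer e) (R (π.hDer e)) := by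
    have h1 := (maps_adjoint_iff (by exact π.dense_smoothVectors)).1 (hR.maps (π.hDer e)) e
    have h1 : inner ℂ (π.hDer e + ζ • R (π.hDer e)) (e : V) =
        inner ℂ (R (π.hDer e)) (π.augXiSq e e + (-(x : ℂ)) • π.hDer e) := h1
    rw [augXiSq_self he hspan] at h1
    have h2 := congrArg conj h1
    simp only [inner_conj_symm, inner_add_left, inner_add_right, inner_smul_left,
      inner_smul_right, map_add, map_mul, map_neg, Complex.conj_ofReal, Complex.conj_conj,
      Complex.conj_ofNat, π.inner_hDer_of_mem_zero e e he he] at h2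
    linear_combination -h2
  have h3 := congrArg (inner ℂ (e : V)) hstrong
  rw [inner_smul_right, inner_sub_right, hee, inner_smul_right] at h3
  have h4 : inner ℂ (e : V) (R (π.hDer e)) =
      (x : ℂ) / (2 - ζ) * inner ℂ (π.hDer e) (R (π.hDer e)) := by
    field_simp
    linear_combination hweak
  rw [h4] at h3
  linear_combination (-2 : ℂ) * h3

/-- The zeros of `D(ζ) = 1 - 2 ⟪e, R(ζ) e⟫` are the fixed points of `Φ`. From `‖R‖ ≤ 2`, `‖H e‖² =
λ/8`, `|2 - ζ| ≥ 3/2` and `x² λ < 1` one gets `|Φ| ≤ x² λ / 3 < 1/2` and the Lipschitz constant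
`8/9`. The separation estimate for contractions bounds `|D(ζ)|` below by a multiple of `|ζ - μ|`, so
the pole is simple. -/
theorem exists_simple_eigenvalue (hirr : π.IsIrreducible) (hlam : π.HasCasimir lam)
    (hpos : 0 < lam) (h0 : (0 : ℤ) ∈ π.kTypes) (hx : |x| * √(lam + 6) < 1) :
    ∃ μ : ℂ, ‖μ‖ < 1 / 2 ∧
      (∃ u : V, u ≠ 0 ∧ Maps (π.kineticOp x) u (μ • u) ∧
        ∀ v, Maps (π.kineticOp x) v (μ • v) → ∃ c : ℂ, v = c • u) ∧
      (∀ ζ : ℂ, ζ.re ≤ 1 / 2 → ζ ≠ μ → ζ ∉ opSpectrum (π.kineticOp x)) ∧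
      ∃ C : ℝ, ∀ ζ : ℂ, ‖ζ‖ < 1 / 2 → ζ ≠ μ →
        ‖ζ - μ‖ * ‖opResolvent (π.kineticOp x) ζ‖ ≤ C := by
  obtain ⟨e, hn, he, hspan⟩ := π.exists_unit_kSpace_zero hirr hlam hpos h0
  have hn' : ‖(e : V)‖ = 1 := hn
  set R := fun ζ => opResolvent (π.augOp e x) ζ
  have hR : ∀ ζ : ℂ, ζ.re ≤ 1 / 2 → IsResolventAt (π.augOp e x) ζ (R ζ) := fun ζ h =>
    (opResolvent_augOp hlam hpos hx he hspan h).1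
  have hRn : ∀ ζ : ℂ, ζ.re ≤ 1 / 2 → ‖R ζ‖ ≤ 2 := fun ζ h =>
    (opResolvent_augOp hlam hpos hx he hspan h).2
  have h32 : ∀ ζ : ℂ, ζ.re ≤ 1 / 2 → 3 / 2 ≤ ‖2 - ζ‖ := fun ζ h => by
    have := sub_half_le_norm_ofReal_sub 2 h
    norm_num at this ⊢
    exact this
  have hne : ∀ ζ : ℂ, ζ.re ≤ 1 / 2 → 2 - ζ ≠ 0 := fun ζ h =>
    norm_pos_iff.1 (by linarith [h32 ζ h])
  have hh : ‖π.hDer e‖ ^ 2 = lam / 8 := by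
    rw [π.norm_sq_hDer_of_mem_zero hlam e he, hn]; ring
  have hx2 : x ^ 2 * lam < 1 := by
    have h1 : (|x| * √(lam + 6)) ^ 2 < 1 := by
      have := mul_nonneg (abs_nonneg x) (Real.sqrt_nonneg (lam + 6))
      nlinarith
    rw [mul_pow, sq_abs, Real.sq_sqrt (by linarith)] at h1
    nlinarith [sq_nonneg x]
  have hx0 : 0 ≤ x ^ 2 * lam := by positivity
  set ρ : ℂ → ℂ := fun ζ => inner ℂ (π.hDer e) (R ζ (π.hDer e)) with hρ
  have hinner : ∀ B : V →L[ℂ] V, ‖inner ℂ (π.hDer e) (B (π.hDer e))‖ ≤ ‖B‖ * (lam / 8) := by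
    intro B
    refine (norm_inner_le_norm _ _).trans ?_
    rw [← hh]
    have := mul_le_mul_of_nonneg_left (B.le_opNorm (π.hDer e)) (norm_nonneg (π.hDer e))
    linarith
  have hρb : ∀ ζ : ℂ, ζ.re ≤ 1 / 2 → ‖ρ ζ‖ ≤ lam / 4 := fun ζ h => by
    have := mul_le_mul_of_nonneg_right (hRn ζ h) (by linarith : 0 ≤ lam / 8)
    linarith [hinner (R ζ)]
  have hρL : ∀ ζ ξ : ℂ, ζ.re ≤ 1 / 2 → ξ.re ≤ 1 / 2 → ‖ρ ζ - ρ ξ‖ ≤ lam / 2 * ‖ζ - ξ‖ := by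
    intro ζ ξ hζ hξ
    have h1 : ρ ζ - ρ ξ = inner ℂ (π.hDer e) ((R ζ - R ξ) (π.hDer e)) := by
      rw [sub_apply, inner_sub_right]
    have h2 : ‖R ζ - R ξ‖ ≤ 4 * ‖ζ - ξ‖ := by
      rw [(hR ζ hζ).sub_eq (hR ξ hξ), norm_smul, mul_comm]
      refine mul_le_mul_of_nonneg_right ?_ (norm_nonneg _)
      refine ((R ζ).opNorm_comp_le (R ξ)).trans ?_
      have := mul_le_mul (hRn ζ hζ) (hRn ξ hξ) (norm_nonneg _) (by norm_num)
      linarith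
    rw [h1]
    refine (hinner _).trans ?_
    have := mul_le_mul_of_nonneg_right h2 (by linarith : 0 ≤ lam / 8)
    linarith
  set Φ : ℂ → ℂ := fun ζ => 2 * (x : ℂ) ^ 2 / (2 - ζ) * ρ ζ with hΦ
  have hxn : ‖2 * (x : ℂ) ^ 2‖ = 2 * x ^ 2 := by
    rw [norm_mul, norm_pow, Complex.norm_real, Real.norm_eq_abs, sq_abs]; simp
  have hΦb : ∀ ζ : ℂ, ζ.re ≤ 1 / 2 → ‖Φ ζ‖ < 1 / 2 := by
    intro ζ hζ
    have h1 : ‖Φ ζ‖ = 2 * x ^ 2 * ‖ρ ζ‖ / ‖2 - ζ‖ := by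
      rw [hΦ, norm_mul, norm_div, hxn]; ring
    rw [h1, div_lt_iff₀ (by linarith [h32 ζ hζ])]
    have h2 := mul_le_mul_of_nonneg_left (hρb ζ hζ) (by positivity : 0 ≤ 2 * x ^ 2)
    linarith [h32 ζ hζ]
  -- The quotients `(λ/2) / (3/2)` and `(λ/4) / (9/4)` are `λ/3` and `λ/9`; twice their sum is
  -- `8λ/9`, and `x² λ < 1`.
  have hΦL : ∀ ζ ξ : ℂ, ζ.re ≤ 1 / 2 → ξ.re ≤ 1 / 2 → ‖Φ ζ - Φ ξ‖ ≤ 8 / 9 * ‖ζ - ξ‖ := by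
    intro ζ ξ hζ hξ
    have h1 : Φ ζ - Φ ξ = 2 * (x : ℂ) ^ 2 *
        ((ρ ζ - ρ ξ) / (2 - ζ) + ρ ξ * (ζ - ξ) / ((2 - ζ) * (2 - ξ))) := by
      have ha := hne ζ hζ
      have hb := hne ξ hξ
      rw [hΦ]
      field_simp
      ring
    have h2 : ‖(ρ ζ - ρ ξ) / (2 - ζ)‖ ≤ lam / 3 * ‖ζ - ξ‖ := by
      rw [norm_div, div_le_iff₀ (by linarith [h32 ζ hζ])]
      have := mul_le_mul_of_nonneg_left (h32 ζ hζ)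
        (by positivity : 0 ≤ lam / 3 * ‖ζ - ξ‖)
      linarith [hρL ζ ξ hζ hξ]
    have h3 : ‖ρ ξ * (ζ - ξ) / ((2 - ζ) * (2 - ξ))‖ ≤ lam / 9 * ‖ζ - ξ‖ := by
      have h4 : (9 / 4 : ℝ) ≤ ‖2 - ζ‖ * ‖2 - ξ‖ := by
        have := mul_le_mul (h32 ζ hζ) (h32 ξ hξ) (by norm_num) (norm_nonneg _)
        linarith
      rw [norm_div, norm_mul, norm_mul, div_le_iff₀ (by linarith)]
      have h5 := mul_le_mul_of_nonneg_left h4 (by positivity : 0 ≤ lam / 9 * ‖ζ - ξ‖)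
      have h6 := mul_le_mul_of_nonneg_right (hρb ξ hξ) (norm_nonneg (ζ - ξ))
      linarith
    rw [h1, norm_mul, hxn]
    have h4 := mul_le_mul_of_nonneg_left ((norm_add_le _ _).trans (add_le_add h2 h3))
      (by positivity : 0 ≤ 2 * x ^ 2)
    refine h4.trans ?_
    have := mul_le_mul_of_nonneg_right hx2.le (norm_nonneg (ζ - ξ))
    linarith
  obtain ⟨μ, hμ, hfix, hsep⟩ := exists_fixedPoint_halfPlane (by norm_num) (by norm_num) hΦb hΦL
  have hμre : μ.re ≤ 1 / 2 := ((le_abs_self _).trans (Complex.abs_re_le_norm μ)).trans hμ.le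
  have hsec : ∀ ζ : ℂ, ζ.re ≤ 1 / 2 →
      (2 - ζ) * (1 - 2 * inner ℂ (e : V) (R ζ e)) = Φ ζ - ζ := fun ζ hζ =>
    secular_identity hn he hspan (hR ζ hζ) (hne ζ hζ)
  have hT := maps_kineticOp_iff_augOp (π := π) (e := (e : V)) x
  have hDμ : 1 - 2 * inner ℂ (e : V) (R μ e) = 0 := by
    have := hsec μ hμre
    rw [hfix, sub_self] at this
    exact (mul_eq_zero.1 this).resolve_left (hne μ hμre)
  have hD : ∀ ζ : ℂ, ζ.re ≤ 1 / 2 →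
      1 / 9 * ‖ζ - μ‖ ≤ ‖2 - ζ‖ * ‖1 - 2 * inner ℂ (e : V) (R ζ e)‖ := fun ζ hζ => by
    rw [← norm_mul, hsec ζ hζ]
    have := hsep ζ hζ
    linarith
  have hD0 : ∀ ζ : ℂ, ζ.re ≤ 1 / 2 → ζ ≠ μ → 1 - 2 * inner ℂ (e : V) (R ζ e) ≠ 0 := by
    intro ζ hζ hζμ h
    have h1 := hD ζ hζ
    rw [h, norm_zero, mul_zero] at h1
    linarith [norm_pos_iff.2 (sub_ne_zero.2 hζμ)]
  -- The constant is `182 = 2 · 1 + 8 · (45/2)`, from `|ζ - μ| ≤ 1` and `|ζ - μ| / |D| ≤ 9 |2 - ζ| ≤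
  -- 9 · (5/2)` on the disc.
  refine ⟨μ, hμ, ⟨R μ e, ?_, (hR μ hμre).maps_of_rankOne hT hDμ, fun v hv => ⟨_,
    (hR μ hμre).eq_smul_of_rankOne hT hv⟩⟩, fun ζ hζ hζμ =>
    ((hR ζ hζ).of_rankOne hT (hD0 ζ hζ hζμ)).notMem_opSpectrum, 182, fun ζ hζ hζμ => ?_⟩
  · intro h
    rw [h, inner_zero_right, mul_zero, sub_zero] at hDμ
    exact one_ne_zero hDμ
  · have hζre : ζ.re ≤ 1 / 2 := ((le_abs_self _).trans (Complex.abs_re_le_norm ζ)).trans hζ.le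
    rw [((hR ζ hζre).of_rankOne hT (hD0 ζ hζre hζμ)).opResolvent_eq]
    set D := 1 - 2 * inner ℂ (e : V) (R ζ e) with hDdef
    have hDpos : 0 < ‖D‖ := norm_pos_iff.2 (hD0 ζ hζre hζμ)
    have h1 : ‖((innerSL ℂ (e : V)).comp (R ζ)).smulRight (R ζ e)‖ ≤ 4 := by
      rw [ContinuousLinearMap.norm_smulRight_apply]
      have h2 : ‖(innerSL ℂ (e : V)).comp (R ζ)‖ ≤ 2 := by
        refine ((innerSL ℂ (e : V)).opNorm_comp_le (R ζ)).trans ?_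
        rw [innerSL_apply_norm, hn', one_mul]
        exact hRn ζ hζre
      have h3 : ‖R ζ e‖ ≤ 2 := by
        have := (R ζ).le_opNorm (e : V)
        rw [hn', mul_one] at this
        exact this.trans (hRn ζ hζre)
      have := mul_le_mul h2 h3 (norm_nonneg _) (by norm_num)
      linarith
    have h2 : ‖R ζ + (2 / D) • ((innerSL ℂ (e : V)).comp (R ζ)).smulRight (R ζ e)‖ ≤
        2 + 2 / ‖D‖ * 4 := by
      refine (norm_add_le _ _).trans (add_le_add (hRn ζ hζre) ?_)
      rw [norm_smul, norm_div, Complex.norm_ofNat]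
      exact mul_le_mul_of_nonneg_left h1 (by positivity)
    have h3 : ‖ζ - μ‖ ≤ 1 := (norm_sub_le _ _).trans (by linarith)
    have h4 : ‖2 - ζ‖ ≤ 5 / 2 := (norm_sub_le _ _).trans (by rw [Complex.norm_ofNat]; linarith)
    have h5 : ‖ζ - μ‖ / ‖D‖ ≤ 45 / 2 := by
      rw [div_le_iff₀ hDpos]
      have := mul_le_mul_of_nonneg_right h4 hDpos.le
      linarith [hD ζ hζre]
    calc _ ≤ ‖ζ - μ‖ * (2 + 2 / ‖D‖ * 4) := mul_le_mul_of_nonneg_left h2 (norm_nonneg _)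
      _ = 2 * ‖ζ - μ‖ + 8 * (‖ζ - μ‖ / ‖D‖) := by ring
      _ ≤ 182 := by linarith

end Eigenvalue

end UnitaryRep

end KineticBM

/-! ### Spectral gap and expansion in the unitary series -/

namespace KineticBM

namespace UnitaryRep

variable {V : Type*} [NormedAddCommGroup V] [InnerProductSpace ℂ V] [CompleteSpace V]
  {π : UnitaryRep V} {lam x : ℝ}

theorem pos_of_principal_or_complementary (hlam : π.HasCasimir lam)
    (h : (∃ s : ℝ, π.IsPrincipalSeries s) ∨ (∃ s : ℝ, π.IsComplementarySeries s)) :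
    π.IsIrreducible ∧ 0 < lam ∧ (0 : ℤ) ∈ π.kTypes := by
  rcases h with ⟨s, hirr, hs, hk⟩ | ⟨s, ⟨h1, h2, -⟩, hirr, hs, hk⟩
  · have := hirr.1
    refine ⟨hirr, ?_, hk ▸ Set.mem_univ _⟩
    rw [hlam.unique hs]
    positivity
  · have := hirr.1
    refine ⟨hirr, ?_, hk ▸ Set.mem_univ _⟩
    rw [hlam.unique hs]
    nlinarith

theorem norm_sq_half_line (y : ℝ) : ‖(1 / 2 : ℂ) + y * Complex.I‖ ^ 2 = (1 / 2) ^ 2 + y ^ 2 := by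
  have := norm_sq_line (1 / 2) y
  rwa [show ((1 / 2 : ℝ) : ℂ) = 1 / 2 by push_cast; rfl] at this

theorem half_line_re (y : ℝ) : ((1 / 2 : ℂ) + y * Complex.I).re = 1 / 2 := by
  simp

theorem half_le_norm_half_line (y : ℝ) : 1 / 2 ≤ ‖(1 / 2 : ℂ) + y * Complex.I‖ := by
  refine (sq_le_sq₀ (by norm_num) (norm_nonneg _)).1 ?_
  rw [norm_sq_half_line]
  nlinarith [sq_nonneg y]

/-- The spectral gap and the expansion of the semigroup in the spherical representations with
positive Casimir eigenvalue. -/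
theorem kineticOp_expansion (hirr : π.IsIrreducible) (hlam : π.HasCasimir lam) (hpos : 0 < lam)
    (h0 : (0 : ℤ) ∈ π.kTypes) (hx : |x| < 1 / Real.sqrt (lam + 6)) :
    IsContractionSemigroup (π.kineticOp x) (expNeg (π.kineticOp x)) ∧
    ∃ μ : ℂ,
      ‖μ‖ < 1 / 2 ∧
      opSpectrum (π.kineticOp x) ∩ {ζ : ℂ | ζ.re ≤ 1 / 2} = {μ} ∧
      CircleIntegrable (opResolvent (π.kineticOp x)) 0 (1 / 2) ∧
      (circleProjection (π.kineticOp x)).comp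
        (circleProjection (π.kineticOp x)) =
          circleProjection (π.kineticOp x) ∧
      (∀ u : V, u ∈ (circleProjection (π.kineticOp x)).range ↔
        ∃ h : u ∈ (π.kineticOp x).domain, π.kineticOp x ⟨u, h⟩ = μ • u) ∧
      Module.finrank ℂ (circleProjection (π.kineticOp x)).range = 1 ∧
      (∀ u ∈ π.sobolev2, ∀ t : ℝ, 0 < t →
        MeasureTheory.Integrable (lineIntegrand (π.kineticOp x) t u) ∧
        expNeg (π.kineticOp x) t u =
          Complex.exp (-μ * t) • circleProjection (π.kineticOp x) u +
          ((1 / (t : ℂ)) * (1 / (2 * (Real.pi : ℂ) * Complex.I))) •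
            lineIntegral (π.kineticOp x) t u) ∧
      (|x| ≤ 1 / Real.sqrt (lam + 6) / 2 → ∀ u : V, ∀ t : ℝ, 0 < t →
        ‖expNeg (π.kineticOp x) t u -
          Complex.exp (-μ * t) • circleProjection (π.kineticOp x) u‖ ≤
            4 / t * Real.exp (-t / 2) * ‖u‖) := by
  have hs6 : 0 < √(lam + 6) := Real.sqrt_pos.2 (by linarith)
  have hκ := hs6.le
  have hxκ : |x| * √(lam + 6) < 1 := (lt_div_iff₀ hs6).1 hx
  have hH : ∀ ζ : ℂ, ζ.re ≤ 1 / 2 → 1 / 2 ≤ ‖ζ‖ → ∀ k ∈ π.kTypes,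
      (k : ℝ) ^ 2 + lam / 4 ≤ √(lam + 6) ^ 2 * ‖(((k : ℝ) ^ 2 : ℝ) : ℂ) - ζ‖ ^ 2 := by
    intro ζ hζ hn k _
    rw [Real.sq_sqrt (by linarith)]
    -- For `k = 0` the required inequality is `λ/4 ≤ (λ + 6) |ζ|²`, which is where `|ζ| ≥ 1/2`
    -- enters.
    by_cases hk : k = 0
    · subst hk
      have : (1 / 2 : ℝ) ^ 2 ≤ ‖ζ‖ ^ 2 := pow_le_pow_left₀ (by norm_num) hn 2
      simp only [Int.cast_zero, ne_eq, OfNat.ofNat_ne_zero, not_false_eq_true, zero_pow,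
        Complex.ofReal_zero, zero_sub, norm_neg]
      nlinarith
    · exact sq_add_casimir_le hpos.le (one_le_sq_of_ne_zero hk) hζ
  have hres : ∀ ζ : ℂ, ζ.re ≤ 1 / 2 → 1 / 2 ≤ ‖ζ‖ → ζ ∉ opSpectrum (π.kineticOp x) ∧
      ‖opResolvent (π.kineticOp x) ζ‖ ≤ 1 / (1 - |x| * √(lam + 6)) / ‖ζ‖ := by
    intro ζ hζ hn
    refine opResolvent_kineticOp hlam hκ hxκ (by linarith) (hH ζ hζ hn) fun k _ => ?_
    by_cases hk : k = 0
    · simp [hk]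
    · exact norm_le_norm_ofReal_sub (one_le_sq_of_ne_zero hk) hζ
  have hS := isContractionSemigroup_kineticOp hlam hκ hxκ hH
  obtain ⟨μ, hμ, ⟨v, hv0, hv, hv1⟩, hρ, C, hC⟩ := exists_simple_eigenvalue hirr hlam hpos h0 hxκ
  obtain ⟨hci, hPmaps, hPfix, N, hNc, hNd, hN⟩ := circleProjection_of_simplePole hμ hρ hC
  have hμre : μ.re ≤ 1 / 2 := ((le_abs_self _).trans (Complex.abs_re_le_norm μ)).trans hμ.le
  have hrange : ∀ u : V, u ∈ (circleProjection (π.kineticOp x)).range ↔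
      Maps (π.kineticOp x) u (μ • u) := by
    intro u
    constructor
    · rintro ⟨w, rfl⟩
      exact hPmaps w
    · intro h
      exact ⟨u, hPfix u h⟩
  have hexp := fun (u : V) (t : ℝ) (ht : 0 < t) =>
    semigroup_expansion hS hres hμ hPmaps hNc hNd hN u ht
  refine ⟨hS, μ, hμ, ?_, hci, ?_, hrange, ?_, fun u _ t ht => hexp u t ht, fun hx2 u t ht => ?_⟩
  · ext ζ
    constructor
    · rintro ⟨h1, h2⟩
      by_contra hne
      exact hρ ζ h2 hne h1
    · rintro rfl
      exact ⟨mem_opSpectrum_of_maps hv0 hv, hμre⟩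
  · ext u
    exact hPfix _ (hPmaps u)
  · have hmem : v ∈ (circleProjection (π.kineticOp x)).range := (hrange v).2 hv
    refine finrank_eq_one ⟨v, hmem⟩ (fun h => hv0 (congrArg Subtype.val h)) fun w => ?_
    obtain ⟨c, hc⟩ := hv1 w ((hrange w).1 w.2)
    exact ⟨c, Subtype.ext hc.symm⟩
  · rw [(hexp u t ht).2, add_sub_cancel_left]
    have h12 : |x| * √(lam + 6) ≤ 1 / 2 := by
      have := mul_le_mul_of_nonneg_right hx2 hκ
      rwa [div_div, mul_comm (√(lam + 6)) 2, ← div_div, div_mul_cancel₀ _ hs6.ne'] at this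
    -- On the line `|ζ|² = 1/4 + y²` and `‖R‖ ≤ 2 / |ζ|`, so `δ = 1/2` and `2 / (t δ) = 4 / t`.
    refine (norm_lineIntegral_le (δ := 1 / 2) (by norm_num) (fun y => ?_) u ht).trans
      (le_of_eq (by field_simp; ring))
    have h1 := (hres _ (half_line_re y).le (half_le_norm_half_line y)).2
    have h2 : 1 / (1 - |x| * √(lam + 6)) ≤ 2 := by
      rw [div_le_iff₀ (by linarith)]; linarith
    have h3 := h1.trans (div_le_div_of_nonneg_right h2 (norm_nonneg _))
    refine (pow_le_pow_left₀ (norm_nonneg _) h3 2).trans (le_of_eq ?_)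
    rw [div_pow, norm_sq_half_line, div_eq_mul_inv]
    norm_num

/-- The spectral gap and the expansion of the semigroup in the discrete series. -/
theorem kineticOp_expansion_of_isDiscreteSeries {n : ℕ} (hn : π.IsDiscreteSeries n)
    (hx : |x| < 1 / Real.sqrt 32) :
    IsContractionSemigroup (π.kineticOp x) (expNeg (π.kineticOp x)) ∧
    opSpectrum (π.kineticOp x) ∩ {ζ : ℂ | ζ.re ≤ 1 / 2} = ∅ ∧
    (∀ u ∈ π.sobolev2, ∀ t : ℝ, 0 < t →
      MeasureTheory.Integrable (lineIntegrand (π.kineticOp x) t u) ∧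
      expNeg (π.kineticOp x) t u =
        ((1 / (t : ℂ)) * (1 / (2 * (Real.pi : ℂ) * Complex.I))) •
          lineIntegral (π.kineticOp x) t u) ∧
    (|x| ≤ 1 / (2 * Real.sqrt 32) → ∀ u : V, ∀ t : ℝ, 0 < t →
      ‖expNeg (π.kineticOp x) t u‖ ≤
        2 / (t * ((n : ℝ) ^ 2 - 1 / 2)) * Real.exp (-t / 2) * ‖u‖ ∧
      2 / (t * ((n : ℝ) ^ 2 - 1 / 2)) * Real.exp (-t / 2) * ‖u‖ ≤
        4 / t * Real.exp (-t / 2) * ‖u‖) := by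
  obtain ⟨hn1, hirr, hlam, hk⟩ := hn
  have hn1' : (1 : ℝ) ≤ n := by exact_mod_cast hn1
  have hkn : ∀ k ∈ π.kTypes, (n : ℝ) ^ 2 ≤ (k : ℝ) ^ 2 := by
    intro k hkk
    have h1 : (n : ℤ) ≤ |k| := by
      rcases hk with hk | hk
      · rw [hk] at hkk
        exact le_trans hkk (le_abs_self k)
      · rw [hk] at hkk
        exact le_trans hkk (neg_le_abs k)
    have h2 : (n : ℝ) ≤ |(k : ℝ)| := by exact_mod_cast h1
    rw [← sq_abs (k : ℝ)]
    exact pow_le_pow_left₀ (by positivity) h2 2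
  have hk1 : ∀ k ∈ π.kTypes, (1 : ℝ) ≤ (k : ℝ) ^ 2 := fun k hkk => by nlinarith [hkn k hkk]
  -- With `k² ≥ 1` and a nonpositive Casimir value, `κ = 2` works on the whole half plane; of `√32`
  -- only the bound `√32 > 4` matters.
  have hs32 : (4 : ℝ) < √32 := by
    rw [Real.lt_sqrt (by norm_num)]; norm_num
  have hxs : |x| * √32 < 1 := (lt_div_iff₀ (by linarith)).1 hx
  have hxκ : |x| * 2 < 1 := by nlinarith [abs_nonneg x]
  have hH : ∀ ζ : ℂ, ζ.re ≤ 1 / 2 → ∀ k ∈ π.kTypes,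
      (k : ℝ) ^ 2 + (1 - (2 * (n : ℝ) - 1) ^ 2) / 4 ≤
        2 ^ 2 * ‖(((k : ℝ) ^ 2 : ℝ) : ℂ) - ζ‖ ^ 2 := by
    intro ζ hζ k hkk
    have := le_four_mul_norm_sq_ofReal_sub (hk1 k hkk) hζ
    nlinarith
  have hspec : ∀ ζ : ℂ, ζ.re ≤ 1 / 2 → ζ ∉ opSpectrum (π.kineticOp x) := fun ζ hζ =>
    (opResolvent_kineticOp hlam (by norm_num) hxκ (m := 1 / 2) (by norm_num) (hH ζ hζ)
      fun k hkk => by linarith [sub_half_le_norm_ofReal_sub ((k : ℝ) ^ 2) hζ, hk1 k hkk]).1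
  have hres : ∀ ζ : ℂ, ζ.re ≤ 1 / 2 → 1 / 2 ≤ ‖ζ‖ → ζ ∉ opSpectrum (π.kineticOp x) ∧
      ‖opResolvent (π.kineticOp x) ζ‖ ≤ 1 / (1 - |x| * 2) / ‖ζ‖ := fun ζ hζ hζn =>
    opResolvent_kineticOp hlam (by norm_num) hxκ (by linarith) (hH ζ hζ)
      fun k hkk => norm_le_norm_ofReal_sub (hk1 k hkk) hζ
  have hS := isContractionSemigroup_kineticOp hlam (by norm_num) hxκ fun ζ hζ _ => hH ζ hζ
  have hexp : ∀ (u : V) (t : ℝ), 0 < t →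
      MeasureTheory.Integrable (lineIntegrand (π.kineticOp x) t u) ∧
      expNeg (π.kineticOp x) t u = ((1 / (t : ℂ)) * (1 / (2 * (Real.pi : ℂ) * Complex.I))) •
        lineIntegral (π.kineticOp x) t u := by
    intro u t ht
    -- There is no pole in the half plane, so the resolvent is its own holomorphic part and the
    -- projection is zero.
    have := semigroup_expansion hS hres (P := 0) (μ := 0) (N := opResolvent (π.kineticOp x))
      (by simp) (fun u => ⟨zero_mem _, by
        rw [zero_smul]; exact (π.kineticOp x).map_zero⟩)
      (continuousOn_opResolvent.mono fun ζ hζ => hspec ζ hζ)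
      (differentiableOn_opResolvent fun ζ (hζ : ζ.re < 1 / 2) => hspec ζ hζ.le)
      (fun ζ _ _ u => by simp) u ht
    simpa using this
  refine ⟨hS, ?_, fun u _ t ht => hexp u t ht, fun hx2 u t ht => ?_⟩
  · ext ζ
    simp only [Set.mem_inter_iff, Set.mem_ofPred_eq, Set.mem_empty_iff_false, iff_false, not_and]
    exact fun h1 h2 => hspec ζ h2 h1
  have hδ : (1 / 2 : ℝ) ≤ (n : ℝ) ^ 2 - 1 / 2 := by nlinarith
  constructor
  · rw [(hexp u t ht).2]
    refine norm_lineIntegral_le (by linarith) (fun y => ?_) u ht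
    -- A lower bound for the distance from `1/2 + iy` to the eigenvalues `k² ≥ n²` of `-Ξ²`; it
    -- gives `δ = n² - 1/2`.
    set m := √(((n : ℝ) ^ 2 - 1 / 2) ^ 2 + y ^ 2) with hm
    have hm0 : 0 < ((n : ℝ) ^ 2 - 1 / 2) ^ 2 + y ^ 2 := by positivity
    have hmpos : 0 < m := Real.sqrt_pos.2 hm0
    have h1 := (opResolvent_kineticOp hlam (by norm_num) hxκ hmpos (hH _ (half_line_re y).le)
      fun k hkk => by
        rw [hm]
        refine Real.sqrt_le_iff.2 ⟨norm_nonneg _, ?_⟩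
        rw [norm_sq_ofReal_sub, half_line_re]
        have hkk2 := hkn k hkk
        have him : ((1 / 2 : ℂ) + y * Complex.I).im = y := by simp
        rw [him]
        nlinarith).2
    have hx3 : |x| * 2 ≤ 1 / 2 := by
      have h2 := (le_div_iff₀ (by linarith)).1 hx2
      nlinarith [abs_nonneg x]
    have h2 : 1 / (1 - |x| * 2) ≤ 2 := by
      rw [div_le_iff₀ (by linarith)]; linarith
    have h3 := h1.trans (div_le_div_of_nonneg_right h2 hmpos.le)
    refine (pow_le_pow_left₀ (norm_nonneg _) h3 2).trans (le_of_eq ?_)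
    rw [div_pow, hm, Real.sq_sqrt hm0.le, div_eq_mul_inv]
    norm_num
  · refine mul_le_mul_of_nonneg_right (mul_le_mul_of_nonneg_right ?_ (Real.exp_nonneg _))
      (norm_nonneg u)
    rw [div_le_div_iff₀ (by positivity) ht]
    nlinarith

end UnitaryRep

end KineticBM

end

theorem theorem4p3 {V : Type*} [NormedAddCommGroup V] [InnerProductSpace ℂ V] [CompleteSpace V]
    (π : KineticBM.UnitaryRep V) :
    -- principal and complementary series
    (∀ lam : ℝ, π.HasCasimir lam →
      ((∃ s : ℝ, π.IsPrincipalSeries s) ∨ (∃ s : ℝ, π.IsComplementarySeries s)) →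
      ∀ x : ℝ, |x| < 1 / Real.sqrt (lam + 6) →
        KineticBM.IsContractionSemigroup (π.kineticOp x) (KineticBM.expNeg (π.kineticOp x)) ∧
        ∃ μ : ℂ,
          ‖μ‖ < 1 / 2 ∧
          KineticBM.opSpectrum (π.kineticOp x) ∩ {ζ : ℂ | ζ.re ≤ 1 / 2} = {μ} ∧
          CircleIntegrable (KineticBM.opResolvent (π.kineticOp x)) 0 (1 / 2) ∧
          (KineticBM.circleProjection (π.kineticOp x)).comp
            (KineticBM.circleProjection (π.kineticOp x)) =
              KineticBM.circleProjection (π.kineticOp x) ∧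
          (∀ u : V, u ∈ (KineticBM.circleProjection (π.kineticOp x)).range ↔
            ∃ h : u ∈ (π.kineticOp x).domain, π.kineticOp x ⟨u, h⟩ = μ • u) ∧
          Module.finrank ℂ (KineticBM.circleProjection (π.kineticOp x)).range = 1 ∧
          (∀ u ∈ π.sobolev2, ∀ t : ℝ, 0 < t →
            MeasureTheory.Integrable (KineticBM.lineIntegrand (π.kineticOp x) t u) ∧
            KineticBM.expNeg (π.kineticOp x) t u =
              Complex.exp (-μ * t) • KineticBM.circleProjection (π.kineticOp x) u +
              ((1 / (t : ℂ)) * (1 / (2 * (Real.pi : ℂ) * Complex.I))) •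
                KineticBM.lineIntegral (π.kineticOp x) t u) ∧
          (|x| ≤ 1 / Real.sqrt (lam + 6) / 2 → ∀ u : V, ∀ t : ℝ, 0 < t →
            ‖KineticBM.expNeg (π.kineticOp x) t u -
              Complex.exp (-μ * t) • KineticBM.circleProjection (π.kineticOp x) u‖ ≤
                4 / t * Real.exp (-t / 2) * ‖u‖)) ∧
    -- discrete series
    (∀ n : ℕ, π.IsDiscreteSeries n →
      ∀ x : ℝ, |x| < 1 / Real.sqrt 32 →
        KineticBM.IsContractionSemigroup (π.kineticOp x) (KineticBM.expNeg (π.kineticOp x)) ∧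
        KineticBM.opSpectrum (π.kineticOp x) ∩ {ζ : ℂ | ζ.re ≤ 1 / 2} = ∅ ∧
        (∀ u ∈ π.sobolev2, ∀ t : ℝ, 0 < t →
          MeasureTheory.Integrable (KineticBM.lineIntegrand (π.kineticOp x) t u) ∧
          KineticBM.expNeg (π.kineticOp x) t u =
            ((1 / (t : ℂ)) * (1 / (2 * (Real.pi : ℂ) * Complex.I))) •
              KineticBM.lineIntegral (π.kineticOp x) t u) ∧
        (|x| ≤ 1 / (2 * Real.sqrt 32) → ∀ u : V, ∀ t : ℝ, 0 < t →
          ‖KineticBM.expNeg (π.kineticOp x) t u‖ ≤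
            2 / (t * ((n : ℝ) ^ 2 - 1 / 2)) * Real.exp (-t / 2) * ‖u‖ ∧
          2 / (t * ((n : ℝ) ^ 2 - 1 / 2)) * Real.exp (-t / 2) * ‖u‖ ≤
            4 / t * Real.exp (-t / 2) * ‖u‖)) := by
  refine ⟨fun lam hlam hser x hx => ?_, fun n hn x hx => ?_⟩
  · obtain ⟨hirr, hpos, hk⟩ := KineticBM.UnitaryRep.pos_of_principal_or_complementary hlam hser
    exact KineticBM.UnitaryRep.kineticOp_expansion hirr hlam hpos hk hx
  · exact KineticBM.UnitaryRep.kineticOp_expansion_of_isDiscreteSeries hn hx
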